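/- \textbf{Theorem (Max-Min Online algorithm).} An instance of SRAMF (stochastic ride-pooling assignment with mixed fleets, in sample-average form) consists of disjoint finite vehicle sets $S_A$ (augmented) and $S_B$ (basis) with capacities $C_i\in\mathbb N$, a budget $K\in\mathbb N$, and $N\ge 1$ scenarios $\xi$. Each scenario has a finite set $D(\xi)$ of ride-requests $j$ with passenger numbers $w_j\ge 1$ and a finite set $E(\xi)$ of hyperedges. The sets $E(\xi)$ are disjoint. Each hyperedge $e$ consists of one vehicle $i\in S_A\cup S_B$ and a set $J\subseteq D(\xi)$ with $\sum_{j\in J}w_j\le C_i$, and has a rational value $v_e>0$. For $S\subseteq S_A$ let $\hat v(S,\xi)$ be the maximum of $\sum_{e\in E(\xi)}v_ex_e$ over all $x\ge 0$ such that $\sum_{e\in E(\xi):\,g\in e}x_e\le 1$ for every vehicle and every request $g$ of $\xi$, and $x_e=0$ if the vehicle of $e$ lies in $S_A\setminus S$. Let $v(S,\xi)$ be the same maximum over $x_e\in\{0,1\}$. Put $\hat v(S)=\frac1N\sum_\xi\hat v(S,\xi)$ and $v^*(S)=\frac1N\sum_\xi v(S,\xi)$. Let $G=S_A\cup S_B\cup\bigcup_\xi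 D(\xi)$ and, for $e\in E(\xi')$, let $c_e(g,\xi)=N/v_e$ if $g\in e$ and $\xi=\xi'$, and $c_e(g,\xi)=0$ otherwise. (1) For every instance and every $S\subseteq S_A$, $$\hat v(S)=\min\Big\{\sum_{g\in G,\,\xi}u_{g,\xi}\;:\;u\ge 0,\ c_e^{\intercal}u\ge 1\text{ for every hyperedge } e \text{ whose vehicle lies in } S\cup S_B\Big\},$$ and the minimum is attained. (2) There are a function $\varepsilon:\mathbb N\to\mathbb R$ with $\varepsilon(p)\to 0$ as $p\to\infty$ and $2e+\varepsilon(p)>0$ for all $p\ge 2$, and a deterministic algorithm, running in time polynomial in the bit length of the explicitly given instance (on a random-access machine with logarithmic cost), that outputs for every instance a set $S_R\subseteq S_A$ with $|S_R|\le K$ and, for every scenario, a feasible integral assignment using only vehicles of $S_R\cup S_B$, such that the following holds. Let $p\ge 2$ be any integer that is at least the row sparsity of the covering LP in (1), i.e. the maximal number of nonzero entries in a row $c_e$ (for instance $p=1+\max_iC_i$, if this is at least $2$). Then $$\hat v(S_R)\;\ge\;\frac{e-1}{(2e+\varepsilon(p))\ln p}\;\max_{S\subseteq S_A,\ |S|\le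 K}\hat v(S),$$ and the average over the scenarios of the total value of the assignment that is output is at least $$\frac{e-1}{(2e+\varepsilon(p))\,p\ln p}\;\max_{S\subseteq S_A,\ |S|\le K}v^*(S).$$ -/

import Mathlib

/-! ## Machine model: a random-access machine with logarithmic (bit) cost -/

namespace RAM

/-- The memory: natural-number cells addressed by natural numbers. -/
abbrev Mem := ℕ → ℕ

/-- Right-hand sides of instructions. Subtraction is truncated, `div` is the floor of the quotient,
`read a` is the content of the cell whose address is the value of `a`. -/
inductive Term where
  | lit (n : ℕ)
  | read (a : Term)
  | add (a b : Term)
  | sub (a b : Term)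
  | mul (a b : Term)
  | div (a b : Term)

/-- Value of a term in a memory. -/
def Term.eval (μ : Mem) : Term → ℕ
  | .lit n => n
  | .read a => μ (a.eval μ)
  | .add a b => a.eval μ + b.eval μ
  | .sub a b => a.eval μ - b.eval μ
  | .mul a b => a.eval μ * b.eval μ
  | .div a b => a.eval μ / b.eval μ

/-- Logarithmic cost: each elementary operation costs one plus the number of bits of its operands
(for a memory access: of the address and of the content). -/
def Term.cost (μ : Mem) : Term → ℕ
  | .lit n => 1 + n.size
  | .read a => a.cost μ + (1 + (a.eval μ).size + (μ (a.eval μ)).size)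
  | .add a b => a.cost μ + b.cost μ + (1 + (a.eval μ).size + (b.eval μ).size)
  | .sub a b => a.cost μ + b.cost μ + (1 + (a.eval μ).size + (b.eval μ).size)
  | .mul a b => a.cost μ + b.cost μ + (1 + (a.eval μ).size + (b.eval μ).size)
  | .div a b => a.cost μ + b.cost μ + (1 + (a.eval μ).size + (b.eval μ).size)

/-- Programs. `write a b` stores the value of `b` in the cell whose address is the value of `a`;
tests ask whether a term is nonzero. -/
inductive Prog where
  | skip
  | write (a b : Term)
  | seq (P Q : Prog)
  | cond (t : Term) (P Q : Prog)
  | loop (t : Term) (P : Prog)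

/-- `Exec P μ c ν`: started in memory `μ`, the program `P` halts in memory `ν` at total cost `c`. -/
inductive Exec : Prog → Mem → ℕ → Mem → Prop
  | skip (μ : Mem) : Exec .skip μ 1 μ
  | write (μ : Mem) (a b : Term) :
      Exec (.write a b) μ
        (a.cost μ + b.cost μ + (1 + (a.eval μ).size + (b.eval μ).size))
        (Function.update μ (a.eval μ) (b.eval μ))
  | seq {P Q : Prog} {μ ν ρ : Mem} {c d : ℕ} :
      Exec P μ c ν → Exec Q ν d ρ → Exec (.seq P Q) μ (c + d) ρ
  | condTrue {t : Term} {P Q : Prog} {μ ν : Mem} {c : ℕ} :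
      t.eval μ ≠ 0 → Exec P μ c ν → Exec (.cond t P Q) μ (t.cost μ + 1 + c) ν
  | condFalse {t : Term} {P Q : Prog} {μ ν : Mem} {c : ℕ} :
      t.eval μ = 0 → Exec Q μ c ν → Exec (.cond t P Q) μ (t.cost μ + 1 + c) ν
  | loopTrue {t : Term} {P : Prog} {μ ν ρ : Mem} {c d : ℕ} :
      t.eval μ ≠ 0 → Exec P μ c ν → Exec (.loop t P) ν d ρ →
        Exec (.loop t P) μ (t.cost μ + 1 + c + d) ρ
  | loopDone {t : Term} {P : Prog} {μ : Mem} :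
      t.eval μ = 0 → Exec (.loop t P) μ (t.cost μ + 1) μ

/-- Initial memory of a machine with `r` work registers (cells `0, …, r - 1`): the input list in
the cells from `r` on, all other cells zero. -/
def load (r : ℕ) (xs : List ℕ) : Mem := fun i => if i < r then 0 else xs.getD (i - r) 0

/-- Length in bits of an input list (one separator per entry). -/
def bitSize (xs : List ℕ) : ℕ := (xs.map fun x => x.size + 1).sum

/-- `f` is computed by one program (with some fixed number `r` of work registers) whose cost is
bounded by a polynomial in the bit length of the input; `enc` encodes inputs and `dec` decodes the
output, which is left in the cells from `r` on. -/
def PolyTimeComputable {α : Type} {β : α → Type} (enc : α → List ℕ)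
    (dec : (a : α) → (ℕ → ℕ) → β a) (f : (a : α) → β a) : Prop :=
  ∃ (r : ℕ) (P : Prog) (q : Polynomial ℕ), ∀ a : α, ∃ (c : ℕ) (ν : Mem),
    Exec P (load r (enc a)) c ν ∧ c ≤ q.eval (bitSize (enc a)) ∧
      dec a (fun i => ν (r + i)) = f a

end RAM

/-! ## Stochastic ride-pooling assignment with mixed fleets (SRAMF), sample-average form -/

/-- An instance: `nA` augmented vehicles, `nB` basis vehicles, a ground set of `nD` ride-requests,
`N` sampled scenarios, `m` hyperedges in total and the budget `K`. Every hyperedge belongs to one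
scenario and consists of one vehicle and a set of requests of that scenario. -/
structure SRAMF where
  nA : ℕ
  nB : ℕ
  nD : ℕ
  N : ℕ
  m : ℕ
  K : ℕ
  N_pos : 0 < N
  capacity : Fin nA ⊕ Fin nB → ℕ
  /-- `D(ξ)` -/
  demand : Fin N → Finset (Fin nD)
  /-- number of passengers of a request in a scenario -/
  passengers : Fin N → Fin nD → ℕ
  scenario : Fin m → Fin N
  vehicle : Fin m → Fin nA ⊕ Fin nB
  requests : Fin m → Finset (Fin nD)
  value : Fin m → ℚ
  passengers_pos : ∀ ξ, ∀ j ∈ demand ξ, 0 < passengers ξ j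
  requests_subset : ∀ e, requests e ⊆ demand (scenario e)
  capacity_le : ∀ e, ∑ j ∈ requests e, passengers (scenario e) j ≤ capacity (vehicle e)
  value_pos : ∀ e, 0 < value e

namespace SRAMF

variable (I : SRAMF)

/-- `E(ξ)` -/
def edges (ξ : Fin I.N) : Finset (Fin I.m) := Finset.univ.filter fun e => I.scenario e = ξ

/-- The available vehicles `S ∪ S_B`. -/
def fleet (S : Finset (Fin I.nA)) : Finset (Fin I.nA ⊕ Fin I.nB) := S.disjSum Finset.univ

/-- `x` satisfies the assignment LP of scenario `ξ` for the selected set `S`. -/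
def FracAssignment (S : Finset (Fin I.nA)) (ξ : Fin I.N) (x : Fin I.m → ℝ) : Prop :=
  (∀ j ∈ I.demand ξ, ∑ e ∈ (I.edges ξ).filter (fun e => j ∈ I.requests e), x e ≤ 1) ∧
  (∀ i, ∑ e ∈ (I.edges ξ).filter (fun e => I.vehicle e = i), x e ≤ 1) ∧
  (∀ e ∈ I.edges ξ, I.vehicle e ∉ I.fleet S → x e = 0) ∧
  (∀ e ∈ I.edges ξ, 0 ≤ x e)

/-- `x` is moreover integral. -/
def IntAssignment (S : Finset (Fin I.nA)) (ξ : Fin I.N) (x : Fin I.m → ℝ) : Prop :=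
  I.FracAssignment S ξ x ∧ ∀ e ∈ I.edges ξ, x e = 0 ∨ x e = 1

/-- Total value of `x` in scenario `ξ`. -/
noncomputable def scenarioValue (ξ : Fin I.N) (x : Fin I.m → ℝ) : ℝ :=
  ∑ e ∈ I.edges ξ, (I.value e : ℝ) * x e

/-- `v̂(S)`: the sample average of the optimal values of the assignment LPs. -/
noncomputable def vHat (S : Finset (Fin I.nA)) : ℝ :=
  (1 / (I.N : ℝ)) * ∑ ξ, sSup (I.scenarioValue ξ '' {x | I.FracAssignment S ξ x})

/-- `v*(S)`: the sample average of the optimal values of the integral assignment problems. -/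
noncomputable def vStar (S : Finset (Fin I.nA)) : ℝ :=
  (1 / (I.N : ℝ)) * ∑ ξ, sSup (I.scenarioValue ξ '' {x | I.IntAssignment S ξ x})

/-- The vertices of a hyperedge, in the ground set of all vehicles and all requests. -/
def verts (e : Fin I.m) : Finset ((Fin I.nA ⊕ Fin I.nB) ⊕ Fin I.nD) :=
  ({I.vehicle e} : Finset (Fin I.nA ⊕ Fin I.nB)).disjSum (I.requests e)

/-- The row `c_e` of the covering LP, with variables `u (g, ξ)`. -/
noncomputable def coeff (e : Fin I.m)
    (k : ((Fin I.nA ⊕ Fin I.nB) ⊕ Fin I.nD) × Fin I.N) : ℝ :=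
  if k.1 ∈ I.verts e ∧ I.scenario e = k.2 then (I.N : ℝ) / (I.value e : ℝ) else 0

/-- Row sparsity of the covering LP: the maximal number of nonzero coefficients in a row. -/
noncomputable def rowSparsity : ℕ :=
  Finset.univ.sup fun e => (Finset.univ.filter fun k => I.coeff e k ≠ 0).card

/-- Feasible solutions of the covering LP for the selected set `S`. -/
def CoverFeasible (S : Finset (Fin I.nA))
    (u : ((Fin I.nA ⊕ Fin I.nB) ⊕ Fin I.nD) × Fin I.N → ℝ) : Prop :=
  (∀ k, 0 ≤ u k) ∧ ∀ e, I.vehicle e ∈ I.fleet S → 1 ≤ ∑ k, I.coeff e k * u k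

/-- Objective values of the feasible solutions of the covering LP for `S`. -/
def coverValues (S : Finset (Fin I.nA)) : Set ℝ :=
  (fun u => ∑ k, u k) '' {u | I.CoverFeasible S u}

/-- A first-stage selection together with hyperedges chosen in all the scenarios. -/
abbrev Solution : Type := Finset (Fin I.nA) × Finset (Fin I.m)

/-- The 0/1 vector of a set of hyperedges. -/
def indicator (M : Finset (Fin I.m)) : Fin I.m → ℝ := fun e => if e ∈ M then 1 else 0

/-- Sample-average value of a set of chosen hyperedges. -/
noncomputable def assignmentValue (M : Finset (Fin I.m)) : ℝ :=
  (1 / (I.N : ℝ)) * ∑ ξ, I.scenarioValue ξ (I.indicator M)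

/-! Encoding: dimensions and budget; capacities; for each scenario the number of requests followed
by one entry per ground request (number of passengers, or 0 if it is not in `D(ξ)`); for each
hyperedge its scenario, vehicle, value (numerator, denominator) and 0/1 incidence row. -/

/-- Position of a vehicle in the list of augmented vehicles followed by basis vehicles. -/
def vehicleIndex (i : Fin I.nA ⊕ Fin I.nB) : ℕ := (finSumFinEquiv i : Fin (I.nA + I.nB)).val

def encodeScenario (ξ : Fin I.N) : List ℕ :=
  (I.demand ξ).card ::
    List.ofFn fun j : Fin I.nD => if j ∈ I.demand ξ then I.passengers ξ j else 0

def encodeEdge (e : Fin I.m) : List ℕ :=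
  [(I.scenario e).val, I.vehicleIndex (I.vehicle e), (I.value e).num.toNat, (I.value e).den] ++
    List.ofFn fun j : Fin I.nD => if j ∈ I.requests e then 1 else 0

def encode : List ℕ :=
  [I.nA, I.nB, I.nD, I.N, I.m, I.K] ++
    (List.ofFn fun i : Fin (I.nA + I.nB) => I.capacity (finSumFinEquiv.symm i)) ++
    (List.ofFn I.encodeScenario).flatten ++ (List.ofFn I.encodeEdge).flatten

/-- Output convention: the first `nA` output cells mark the selected vehicles (by a nonzero content)
and the next `m` output cells mark the chosen hyperedges. -/
def decode (ν : ℕ → ℕ) : I.Solution :=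
  (Finset.univ.filter fun i => ν i.val ≠ 0, Finset.univ.filter fun e => ν (I.nA + e.val) ≠ 0)

/-- Maximal vehicle capacity. -/
def maxCapacity : ℕ := Finset.univ.sup I.capacity

/-- The row sparsity is at most one plus the maximal capacity. -/
theorem rowSparsity_le_maxCapacity_add_one : I.rowSparsity ≤ I.maxCapacity + 1 := by
  refine Finset.sup_le fun e _ => ?_
  have h1 : (Finset.univ.filter fun k => I.coeff e k ≠ 0) ⊆
      (I.verts e) ×ˢ {I.scenario e} := by
    rintro ⟨g, ξ⟩ hk
    rw [Finset.mem_filter] at hk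
    have h2 : g ∈ I.verts e ∧ I.scenario e = ξ := by
      by_contra h
      exact hk.2 (if_neg h)
    simp [h2.1, h2.2]
  have h3 : (I.requests e).card ≤ ∑ j ∈ I.requests e, I.passengers (I.scenario e) j := by
    rw [Finset.card_eq_sum_ones]
    exact Finset.sum_le_sum fun j hj => I.passengers_pos _ j (I.requests_subset e hj)
  have h4 : I.capacity (I.vehicle e) ≤ I.maxCapacity := Finset.le_sup (Finset.mem_univ _)
  have h5 := Finset.card_le_card h1
  have h6 := I.capacity_le e
  simp only [Finset.card_product, Finset.card_singleton, verts, Finset.card_disjSum] at h5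
  omega

end SRAMF

/-! The covering LP is the dual of all scenario assignment LPs taken together, because hyperedges of
different scenarios share no covering variable. So (1) is strong duality:
`exists_packing_covering_eq` obtains it from a saddle point of a matrix game, and
`exists_isCover_sum_eq` carries it over to instances.

For (2), the selection is a max-min problem: each augmented vehicle contributes a class of covering
constraints, and one wants few classes whose optimal cover is expensive. An online covering
algorithm drives the choice. It keeps an integral cover that only grows; a violated constraint of
value V with k variables is treated by doubling these variables and adding V/(8k), rounded down, to
each. Two facts about the cost of this cover carry the proof. Competitiveness (`GreedyRun.sum_le`):
the cost is at most `ratio p` times that of any cover z of the classes processed. An update costs at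
most 9V/8 and raises a potential, a capped logarithm of u/z weighted by z, by at least 7V/8; the cap
bounds the potential by O(log p) times the cost of z. Greedy growth (`GreedyRun.mul_le_sum`):
processing in each round the class that makes the cover most expensive reaches 1 - 1/e of the
optimal cover of any rival set T. Submodularity of the LP value is not needed: the current cover
plus the increments of all classes of T covers T, so one increment is at least the average of the
missing amount. Hence (1 - 1/e) v̂(S) ≤ cost ≤ `ratio p` · v̂(S_R). The ratio grows like 9/(7 ln 2)
· ln p with 9/(7 ln 2) < 2, so the error term vanishes for large p.

The integral assignment is a greedy matching by value. Giving the vertices of each chosen hyperedge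
its value covers every available hyperedge, at a cost of at most p times the value of the matching;
thus v̂(S_R) ≤ p · value (`Loaded.vHat_le`), and v* ≤ v̂ finishes.

The algorithm is an explicit program. `Runs` bounds time and growth of the numbers by one budget
that adds under composition, so polynomially many steps stay polynomial. The relations `GreedyRun`
and `MatchRun` separate the machine from the analysis: the program is shown to follow them, and the
guarantees hold for every run. -/

/-- LP duality for fractional matchings and fractional covers of a finite weighted hypergraph. -/
theorem exists_packing_covering_eq {ι κ : Type*} [Fintype ι] [Fintype κ] [DecidableEq ι]
    [DecidableEq κ] (F : ι → Finset κ)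
    (hF : ∀ e, (F e).Nonempty) (c : ι → ℝ) (hc : ∀ e, 0 < c e) :
    ∃ (x : ι → ℝ) (u : κ → ℝ), (∀ e, 0 ≤ x e) ∧ (∀ g, 0 ≤ u g) ∧
      (∀ g, ∑ e with g ∈ F e, x e ≤ 1) ∧ (∀ e, c e ≤ ∑ g ∈ F e, u g) ∧
      ∑ e, c e * x e = ∑ g, u g := by
  rcases isEmpty_or_nonempty ι with hι | ⟨⟨e₀⟩⟩
  -- Without hyperedges the simplex of mixed strategies would be empty.
  · exact ⟨fun _ => 0, fun _ => 0, by simp, by simp, by simp, fun e => (hι.false e).elim, by simp⟩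
  obtain ⟨g₀, -⟩ := hF e₀
  -- Payoff of a game in which one player mixes hyperedges to make it small and the other mixes
  -- vertices to make it large. Dividing optimal strategies by the value `l`, and also by `c` on the
  -- hyperedge side, gives a packing and a cover, both of value 1/`l`.
  let f : (ι → ℝ) → (κ → ℝ) → ℝ := fun y z => ∑ e, y e / c e * ∑ g ∈ F e, z g
  have hf2 : ∀ y z, f y z = ∑ g, z g * ∑ e with g ∈ F e, y e / c e := by
    intro y z
    have h1 : ∀ e, ∑ g ∈ F e, z g = ∑ g, if g ∈ F e then z g else 0 := fun e => by simp
    simp only [f, Finset.sum_filter]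
    simp only [h1, Finset.mul_sum]
    rw [Finset.sum_comm]
    refine Finset.sum_congr rfl fun g _ => Finset.sum_congr rfl fun e _ => ?_
    split_ifs <;> ring
  have hconv1 : ∀ z, IsLinearMap ℝ fun y => f y z := fun z =>
    ⟨fun y y' => by simp [f, add_div, add_mul, Finset.sum_add_distrib],
      fun r y => by simp [f, Finset.mul_sum, mul_div_assoc, mul_assoc]⟩
  have hconv2 : ∀ y, IsLinearMap ℝ fun z => f y z := fun y =>
    ⟨fun z z' => by simp [f, mul_add, Finset.sum_add_distrib], fun r z => by
      simp only [f, Pi.smul_apply, smul_eq_mul, ← Finset.mul_sum]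
      rw [Finset.mul_sum]
      exact Finset.sum_congr rfl fun e _ => by ring⟩
  obtain ⟨a, ha, b, hb, hab⟩ := Sion.exists_isSaddlePointOn (f := f)
    (X := stdSimplex ℝ ι) (Y := stdSimplex ℝ κ)
    ⟨_, single_mem_stdSimplex ℝ e₀⟩ (convex_stdSimplex ℝ ι) (isCompact_stdSimplex ℝ ι)
    (fun z _ => (Continuous.lowerSemicontinuous (by fun_prop)).lowerSemicontinuousOn _)
    (fun z _ => ((hconv1 z).mk'.convexOn (convex_stdSimplex ℝ ι)).quasiconvexOn)
    (convex_stdSimplex ℝ κ) ⟨_, single_mem_stdSimplex ℝ g₀⟩ (isCompact_stdSimplex ℝ κ)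
    (fun y _ => (Continuous.upperSemicontinuous (by fun_prop)).upperSemicontinuousOn _)
    (fun y _ => ((hconv2 y).mk'.concaveOn (convex_stdSimplex ℝ κ)).quasiconcaveOn)
  set l := f a b with hl
  have hle : ∀ e, l * c e ≤ ∑ g ∈ F e, b g := by
    intro e
    have h := hab _ (single_mem_stdSimplex ℝ e) b hb
    have h2 : f (Pi.single e 1) b = (∑ g ∈ F e, b g) / c e := by
      simp only [f]
      rw [Finset.sum_eq_single e]
      · simp; ring
      · intro e' _ he'; simp [he']
      · simp
    rw [h2, le_div_iff₀ (hc e)] at h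
    exact h
  have hge : ∀ g, ∑ e with g ∈ F e, a e / c e ≤ l := by
    intro g
    have h := hab a ha _ (single_mem_stdSimplex ℝ g)
    have h2 : f a (Pi.single g 1) = ∑ e with g ∈ F e, a e / c e := by
      rw [hf2, Finset.sum_eq_single g]
      · simp
      · intro e' _ he'; simp [he']
      · simp
    rwa [h2] at h
  -- A vertex of a hyperedge played with positive weight already secures a positive payoff; this is
  -- where nonemptiness of the hyperedges enters.
  have hlpos : 0 < l := by
    have : ∃ e ∈ Finset.univ, 0 < a e := by
      by_contra hcon
      push Not at hcon
      have := Finset.sum_nonpos hcon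
      linarith [ha.2]
    obtain ⟨e, -, he⟩ := this
    obtain ⟨g, hg⟩ := hF e
    refine lt_of_lt_of_le (div_pos he (hc e)) (le_trans ?_ (hge g))
    exact Finset.single_le_sum (f := fun e => a e / c e)
      (fun e _ => div_nonneg (ha.1 e) (hc e).le) (by simpa using hg)
  refine ⟨fun e => a e / c e / l, fun g => b g / l, fun e => ?_, fun g => ?_, fun g => ?_,
    fun e => ?_, ?_⟩
  · exact div_nonneg (div_nonneg (ha.1 e) (hc e).le) hlpos.le
  · exact div_nonneg (hb.1 g) hlpos.le
  · rw [← Finset.sum_div, div_le_one hlpos]; exact hge g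
  · rw [← Finset.sum_div, le_div_iff₀ hlpos, mul_comm]; exact hle e
  · rw [← Finset.sum_div, hb.2]
    have : ∀ e, c e * (a e / c e / l) = a e / l := fun e => by have := (hc e).ne'; field_simp
    simp only [this]
    rw [← Finset.sum_div, ha.2]

/-! ### Duality between assignments and covers -/

namespace SRAMF

variable (I : SRAMF)

/-- The vertices of a hyperedge together with its scenario: the variables of its covering row. -/
def cells (e : Fin I.m) : Finset (((Fin I.nA ⊕ Fin I.nB) ⊕ Fin I.nD) × Fin I.N) :=
  I.verts e ×ˢ {I.scenario e}

theorem vehicle_mem_cells (e : Fin I.m) : (Sum.inl (I.vehicle e), I.scenario e) ∈ I.cells e := by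
  simp [cells, verts]

theorem cells_nonempty (e : Fin I.m) : (I.cells e).Nonempty := ⟨_, I.vehicle_mem_cells e⟩

theorem coeff_eq (e : Fin I.m) (k : ((Fin I.nA ⊕ Fin I.nB) ⊕ Fin I.nD) × Fin I.N) :
    I.coeff e k = if k ∈ I.cells e then (I.N : ℝ) / (I.value e : ℝ) else 0 := by
  simp only [coeff, cells, Finset.mem_product, Finset.mem_singleton, eq_comm]

theorem N_pos_real : (0 : ℝ) < I.N := by exact_mod_cast I.N_pos

theorem value_pos_real (e : Fin I.m) : (0 : ℝ) < (I.value e : ℝ) := by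
  exact_mod_cast I.value_pos e

theorem card_cells_le_rowSparsity (e : Fin I.m) : (I.cells e).card ≤ I.rowSparsity := by
  have h : I.cells e = Finset.univ.filter fun k => I.coeff e k ≠ 0 := by
    ext k
    have := (div_pos I.N_pos_real (I.value_pos_real e)).ne'
    simp only [Finset.mem_filter, Finset.mem_univ, true_and, coeff_eq]
    split_ifs with hk
    · simp [hk, this]
    · simp [hk]
  rw [h]
  exact Finset.le_sup (f := fun e => (Finset.univ.filter fun k => I.coeff e k ≠ 0).card)
    (Finset.mem_univ e)

/-- Feasibility for the covering LP in the unscaled variables `N * u`. -/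
def IsCover (S : Finset (Fin I.nA))
    (u : ((Fin I.nA ⊕ Fin I.nB) ⊕ Fin I.nD) × Fin I.N → ℝ) : Prop :=
  (∀ k, 0 ≤ u k) ∧ ∀ e, I.vehicle e ∈ I.fleet S → (I.value e : ℝ) ≤ ∑ k ∈ I.cells e, u k

theorem sum_coeff_mul (e : Fin I.m) (u : ((Fin I.nA ⊕ Fin I.nB) ⊕ Fin I.nD) × Fin I.N → ℝ) :
    ∑ k, I.coeff e k * u k = (I.N : ℝ) / (I.value e : ℝ) * ∑ k ∈ I.cells e, u k := by
  simp only [coeff_eq, ite_mul, zero_mul, Finset.sum_ite_mem, Finset.univ_inter, Finset.mul_sum]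

theorem coverFeasible_iff (S : Finset (Fin I.nA))
    (u : ((Fin I.nA ⊕ Fin I.nB) ⊕ Fin I.nD) × Fin I.N → ℝ) :
    I.CoverFeasible S u ↔ I.IsCover S fun k => I.N * u k := by
  have hN := I.N_pos_real
  refine and_congr (forall_congr' fun k => ?_) (forall_congr' fun e => imp_congr_right fun _ => ?_)
  · exact (mul_nonneg_iff_of_pos_left hN).symm
  · rw [sum_coeff_mul, ← Finset.mul_sum, div_mul_eq_mul_div, le_div_iff₀ (I.value_pos_real e),
      one_mul]

theorem mem_edges {ξ : Fin I.N} {e : Fin I.m} : e ∈ I.edges ξ ↔ I.scenario e = ξ := by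
  simp [edges]

/-- Every vertex carries total weight at most one. -/
theorem FracAssignment.sum_le_one {I : SRAMF} {S : Finset (Fin I.nA)} {ξ : Fin I.N}
    {x : Fin I.m → ℝ} (hx : I.FracAssignment S ξ x) (g : (Fin I.nA ⊕ Fin I.nB) ⊕ Fin I.nD) :
    ∑ e ∈ (I.edges ξ).filter (fun e => g ∈ I.verts e), x e ≤ 1 := by
  rcases g with i | j
  · convert hx.2.1 i using 2
    ext e; simp [verts, eq_comm]
  · by_cases hj : j ∈ I.demand ξ
    · convert hx.1 j hj using 2
      ext e; simp [verts]
    -- A ground request outside `I.demand ξ` lies in no hyperedge of the scenario, so its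
    -- constraint, absent from the LP, holds trivially.
    · rw [Finset.sum_eq_zero]
      · exact zero_le_one
      · intro e he
        simp only [Finset.mem_filter, mem_edges, verts, Finset.inr_mem_disjSum] at he
        exact absurd (he.1 ▸ I.requests_subset e he.2) hj

/-- Weak duality in one scenario: replace each value by its cover sum and exchange the summations;
every vertex then counts at most once. Unavailable hyperedges need no cover because `x` vanishes on
them. -/
theorem scenarioValue_le_of_isCover {S : Finset (Fin I.nA)} {ξ : Fin I.N}
    {x : Fin I.m → ℝ} (hx : I.FracAssignment S ξ x)
    {u : ((Fin I.nA ⊕ Fin I.nB) ⊕ Fin I.nD) × Fin I.N → ℝ} (hu : I.IsCover S u) :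
    I.scenarioValue ξ x ≤ ∑ g, u (g, ξ) := by
  have hcell : ∀ e ∈ I.edges ξ, ∑ k ∈ I.cells e, u k = ∑ g ∈ I.verts e, u (g, ξ) := by
    intro e he
    rw [cells, Finset.sum_product]
    simp [I.mem_edges.1 he]
  calc I.scenarioValue ξ x ≤ ∑ e ∈ I.edges ξ, (∑ g ∈ I.verts e, u (g, ξ)) * x e := by
        refine Finset.sum_le_sum fun e he => ?_
        by_cases h : I.vehicle e ∈ I.fleet S
        · exact mul_le_mul_of_nonneg_right (hcell e he ▸ hu.2 e h) (hx.2.2.2 e he)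
        · simp [hx.2.2.1 e he h]
    _ = ∑ g, u (g, ξ) * ∑ e ∈ (I.edges ξ).filter (fun e => g ∈ I.verts e), x e := by
        simp only [Finset.sum_mul, Finset.mul_sum, Finset.sum_filter]
        rw [Finset.sum_comm]
        refine Finset.sum_congr rfl fun e _ => ?_
        simp
    _ ≤ ∑ g, u (g, ξ) := by
        refine Finset.sum_le_sum fun g _ => ?_
        exact mul_le_of_le_one_right (hu.1 _) (hx.sum_le_one g)

theorem zero_fracAssignment (S : Finset (Fin I.nA)) (ξ : Fin I.N) :
    I.FracAssignment S ξ 0 := by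
  simp [FracAssignment]

/-- `v̂(S)` is both a lower bound for all unscaled covers and attained by one. -/
theorem exists_isCover_sum_eq (S : Finset (Fin I.nA)) :
    (∃ u, I.IsCover S u ∧ ∑ k, u k = I.N * I.vHat S) ∧
      ∀ u, I.IsCover S u → I.N * I.vHat S ≤ ∑ k, u k := by
  have hN := I.N_pos_real
  have hv : I.N * I.vHat S = ∑ ξ, sSup (I.scenarioValue ξ '' {x | I.FracAssignment S ξ x}) := by
    rw [vHat, ← mul_assoc, mul_one_div_cancel hN.ne', one_mul]
  have hsum : ∀ u : ((Fin I.nA ⊕ Fin I.nB) ⊕ Fin I.nD) × Fin I.N → ℝ,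
      ∑ k, u k = ∑ ξ, ∑ g, u (g, ξ) := fun u => Fintype.sum_prod_type_right u
  have hub : ∀ u, I.IsCover S u → I.N * I.vHat S ≤ ∑ k, u k := by
    intro u hu
    rw [hv, hsum]
    refine Finset.sum_le_sum fun ξ _ => csSup_le ⟨_, 0, I.zero_fracAssignment S ξ, rfl⟩ ?_
    rintro _ ⟨x, hx, rfl⟩
    exact I.scenarioValue_le_of_isCover hx hu
  refine ⟨?_, hub⟩
  -- Duality is applied once, to the available hyperedges of all scenarios. The packing, extended by
  -- zero, is a feasible assignment in each scenario separately.
  obtain ⟨x, u, hx0, hu0, hx, hu, hxu⟩ := exists_packing_covering_eq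
    (ι := {e // I.vehicle e ∈ I.fleet S}) (fun e => I.cells e.1) (fun e => I.cells_nonempty e.1)
    (fun e => (I.value e.1 : ℝ)) (fun e => I.value_pos_real e.1)
  have hcov : I.IsCover S u := ⟨hu0, fun e he => hu ⟨e, he⟩⟩
  refine ⟨u, hcov, le_antisymm ?_ (hub u hcov)⟩
  let y : Fin I.m → ℝ := fun e => if h : I.vehicle e ∈ I.fleet S then x ⟨e, h⟩ else 0
  have hy0 : ∀ e, 0 ≤ y e := fun e => by
    by_cases h : I.vehicle e ∈ I.fleet S <;> simp [y, h, hx0]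
  have hysum : ∀ s : Finset (Fin I.m), ∀ w : Fin I.m → ℝ,
      ∑ e ∈ s, w e * y e = ∑ e : {e // I.vehicle e ∈ I.fleet S}, if e.1 ∈ s then w e * x e else 0 := by
    intro s w
    have h1 : ∑ e ∈ s, w e * y e = ∑ e with I.vehicle e ∈ I.fleet S,
        if e ∈ s then w e * y e else 0 := by
      rw [Finset.sum_filter, ← Finset.univ_inter s, ← Finset.sum_ite_mem]
      refine Finset.sum_congr rfl fun e _ => ?_
      by_cases h : I.vehicle e ∈ I.fleet S <;> simp [y, h]
    rw [h1, Finset.sum_subtype (p := fun e => I.vehicle e ∈ I.fleet S) _ (by simp)]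
    refine Finset.sum_congr rfl fun e _ => ?_
    simp [y, e.2]
  have hyg : ∀ ξ g, ∑ e ∈ (I.edges ξ).filter (fun e => g ∈ I.verts e), y e ≤ 1 := by
    intro ξ g
    have h1 := hysum ((I.edges ξ).filter (fun e => g ∈ I.verts e)) 1
    simp only [Pi.one_apply, one_mul] at h1
    rw [h1, ← Finset.sum_filter]
    convert hx (g, ξ) using 2
    ext e
    simp only [cells, Finset.mem_filter, mem_edges, Finset.mem_product, Finset.mem_singleton,
      Finset.mem_univ, true_and, eq_comm, and_comm]
  have hyA : ∀ ξ, I.FracAssignment S ξ y := by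
    intro ξ
    refine ⟨fun j _ => ?_, fun i => ?_, fun e _ he => by simp [y, he], fun e _ => hy0 e⟩
    · convert hyg ξ (Sum.inr j) using 2
      ext e; simp [verts]
    · convert hyg ξ (Sum.inl i) using 2
      ext e; simp [verts, eq_comm]
  have hval : ∑ ξ, I.scenarioValue ξ y = ∑ k, u k := by
    rw [← hxu]
    have h1 := hysum Finset.univ fun e => (I.value e : ℝ)
    simp only [Finset.mem_univ, if_true] at h1
    rw [← h1]
    exact Finset.sum_fiberwise Finset.univ I.scenario _
  rw [← hval, hv]
  refine Finset.sum_le_sum fun ξ _ => le_csSup ?_ ⟨y, hyA ξ, rfl⟩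
  exact ⟨_, by rintro _ ⟨x, hx, rfl⟩; exact I.scenarioValue_le_of_isCover hx hcov⟩

/-- The substitution of `N * u` for `u` clears the coefficients N/v, and the same factor cancels the
average over scenarios. -/
theorem isLeast_coverValues (S : Finset (Fin I.nA)) : IsLeast (I.coverValues S) (I.vHat S) := by
  have hN := I.N_pos_real
  obtain ⟨⟨u, hu, hsum⟩, hlb⟩ := I.exists_isCover_sum_eq S
  constructor
  · refine ⟨fun k => u k / I.N, ?_, ?_⟩
    · rw [Set.mem_ofPred_eq, coverFeasible_iff]
      convert hu using 2
      field_simp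
    · simp only
      rw [← Finset.sum_div, hsum, mul_div_cancel_left₀ _ hN.ne']
  · rintro _ ⟨u, hu, rfl⟩
    have := hlb _ ((I.coverFeasible_iff S u).1 hu)
    rw [← Finset.mul_sum] at this
    exact le_of_mul_le_mul_left this hN

theorem vHat_nonneg (S : Finset (Fin I.nA)) : 0 ≤ I.vHat S := by
  obtain ⟨u, hu, hsum⟩ := (I.isLeast_coverValues S).1
  exact hsum ▸ Finset.sum_nonneg fun k _ => hu.1 k

theorem vStar_le_vHat (S : Finset (Fin I.nA)) : I.vStar S ≤ I.vHat S := by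
  obtain ⟨⟨u, hu, -⟩, -⟩ := I.exists_isCover_sum_eq S
  refine mul_le_mul_of_nonneg_left (Finset.sum_le_sum fun ξ _ => ?_) (by positivity)
  refine csSup_le_csSup ⟨∑ g, u (g, ξ), ?_⟩ ⟨_, 0, ⟨I.zero_fracAssignment S ξ, by simp⟩, rfl⟩
    (Set.image_mono fun x hx => hx.1)
  rintro _ ⟨x, hx, rfl⟩
  exact I.scenarioValue_le_of_isCover hx hu

end SRAMF

/-! ### Combinatorial core: online covering, greedy selection, greedy matching -/

namespace Covering

open Finset

/-! ### Multiplicative updates on integral covers -/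

/-- Double the entries of `w` on `F` and add `d` to them. -/
def raise (F : Finset ℕ) (d : ℕ) (w : ℕ → ℕ) : ℕ → ℕ := fun x => if x ∈ F then 2 * w x + d else w x

/-- One multiplicative update for the constraint `V ≤ ∑ x ∈ F, w x`. -/
def step (F : Finset ℕ) (V : ℕ) (w : ℕ → ℕ) : ℕ → ℕ :=
  if ∑ x ∈ F, w x < V then raise F (V / (8 * #F)) w else w

/-- Update the constraints of class `i` among the first `n` ones. -/
def sweep (F : ℕ → Finset ℕ) (V cl : ℕ → ℕ) (i : ℕ) : ℕ → (ℕ → ℕ) → ℕ → ℕ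
  | 0, w => w
  | n + 1, w =>
    if cl n = i then (step (F n) (V n))^[5] (sweep F V cl i n w) else sweep F V cl i n w

variable {F : ℕ → Finset ℕ} {V cl : ℕ → ℕ} {Y : ℕ}

theorem le_step (F : Finset ℕ) (V : ℕ) (w : ℕ → ℕ) (x : ℕ) : w x ≤ step F V w x := by
  unfold step
  split_ifs
  · generalize V / (8 * #F) = d
    unfold raise
    split_ifs <;> omega
  · exact le_rfl

theorem le_step_iterate (F : Finset ℕ) (V n : ℕ) (w : ℕ → ℕ) (x : ℕ) :
    w x ≤ (step F V)^[n] w x := by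
  induction n generalizing w with
  | zero => exact le_rfl
  | succ n ih => exact (le_step F V w x).trans (ih _)

/-- The single induction over a sweep: monotonicity as well as the invariant comparing cost and
potential are passed through it. -/
theorem sweep_induction {P : (ℕ → ℕ) → Prop} {i n : ℕ} {w : ℕ → ℕ}
    (hstep : ∀ e < n, cl e = i → ∀ w, P w → P (step (F e) (V e) w)) (hw : P w) :
    P (sweep F V cl i n w) := by
  induction n with
  | zero => exact hw
  | succ n ih =>
    have h := ih fun e he => hstep e (he.trans n.lt_succ_self)
    unfold sweep
    split_ifs with hc
    · have h1 : ∀ k, P ((step (F n) (V n))^[k] (sweep F V cl i n w)) := by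
        intro k
        induction k with
        | zero => exact h
        | succ k ihk =>
          rw [Function.iterate_succ_apply']
          exact hstep n n.lt_succ_self hc _ ihk
      exact h1 5
    · exact h

theorem le_sweep (i n : ℕ) (w : ℕ → ℕ) (x : ℕ) : w x ≤ sweep F V cl i n w x :=
  sweep_induction (P := fun w' => w x ≤ w' x)
    (fun e _ _ w' h => h.trans (le_step (F e) (V e) w' x)) le_rfl

theorem step_congr {F : Finset ℕ} (hF : F ⊆ range Y) (V : ℕ) {w w' : ℕ → ℕ}
    (h : ∀ x < Y, w x = w' x) : ∀ x < Y, step F V w x = step F V w' x := by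
  intro x hx
  have hs : ∑ x ∈ F, w x = ∑ x ∈ F, w' x :=
    Finset.sum_congr rfl fun x hx => h x (mem_range.1 (hF hx))
  unfold step raise
  rw [hs]
  split_ifs
  · simp only [h x hx]
  · exact h x hx

/-- No constraint reads an entry from `Y` on. The machine leaves these entries unspecified, so its
runs agree with the mathematical ones only below `Y`. -/
theorem sweep_congr (hF : ∀ e, F e ⊆ range Y) (i n : ℕ) {w w' : ℕ → ℕ}
    (h : ∀ x < Y, w x = w' x) : ∀ x < Y, sweep F V cl i n w x = sweep F V cl i n w' x := by
  induction n with
  | zero => exact h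
  | succ n ih =>
    unfold sweep
    split_ifs
    · have h1 : ∀ k, ∀ x < Y, (step (F n) (V n))^[k] (sweep F V cl i n w) x =
          (step (F n) (V n))^[k] (sweep F V cl i n w') x := by
        intro k
        induction k with
        | zero => exact ih
        | succ k ihk =>
          simp only [Function.iterate_succ_apply']
          exact step_congr (hF n) _ ihk
      exact h1 5
    · exact ih

/-- The quotient is at least 1, so rounding down loses at most a factor two. -/
theorem le_mul_div {V k : ℕ} (hk : 0 < k) (hV : 8 * k ≤ V) : V ≤ 16 * k * (V / (8 * k)) := by
  have h1 : V < 8 * k * (V / (8 * k) + 1) := Nat.lt_mul_div_succ V (by omega)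
  have h2 : 1 ≤ V / (8 * k) := (Nat.one_le_div_iff (by omega)).2 hV
  have h3 : 8 * k * 1 ≤ 8 * k * (V / (8 * k)) := Nat.mul_le_mul_left _ h2
  rw [Nat.mul_add] at h1
  rw [show 16 * k = 8 * k + 8 * k by ring, Nat.add_mul]
  omega

/-- As long as the constraint is violated, n updates raise each of its entries to at least d(2^n -
1) with d the rounded increment. Since V ≤ 16 · #F · d, five updates suffice: 2^5 - 1 = 31 exceeds
16, whereas 2^4 - 1 does not. -/
theorem le_sum_step_iterate (F : Finset ℕ) (hF : F.Nonempty) (V : ℕ) (hV : 8 * #F ≤ V)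
    (w : ℕ → ℕ) : V ≤ ∑ x ∈ F, (step F V)^[5] w x := by
  have hk : 0 < #F := hF.card_pos
  have key : ∀ n, V ≤ ∑ x ∈ F, (step F V)^[n] w x ∨
      ∀ x ∈ F, V / (8 * #F) * (2 ^ n - 1) ≤ (step F V)^[n] w x := by
    intro n
    induction n with
    | zero => right; simp
    | succ n ih =>
      simp only [Function.iterate_succ_apply']
      by_cases hs : V ≤ ∑ x ∈ F, (step F V)^[n] w x
      · left
        exact hs.trans (Finset.sum_le_sum fun x _ => le_step _ _ _ _)
      · right
        intro x hx
        have h1 := (ih.resolve_left hs) x hx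
        rw [step, if_pos (not_le.1 hs), raise, if_pos hx]
        have h2 : 2 ^ (n + 1) - 1 = 2 * (2 ^ n - 1) + 1 := by
          have := Nat.one_le_two_pow (n := n)
          omega
        rw [h2, Nat.mul_add, mul_one, Nat.mul_left_comm]
        have : 2 * (V / (8 * #F) * (2 ^ n - 1)) ≤ 2 * (step F V)^[n] w x := by omega
        exact Nat.add_le_add_right this _
  rcases key 5 with h | h
  · exact h
  · refine le_trans ?_ (Finset.card_nsmul_le_sum _ _ _ h)
    have := le_mul_div hk hV
    simp only [smul_eq_mul]
    norm_num
    nlinarith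

/-- Entries never decrease, so a constraint satisfied on its turn remains satisfied during the rest
of the sweep. -/
theorem le_sum_sweep {n i : ℕ} (hF : ∀ e < n, (F e).Nonempty) (hV : ∀ e < n, 8 * #(F e) ≤ V e)
    (w : ℕ → ℕ) {e : ℕ} (he : e < n) (hc : cl e = i) :
    V e ≤ ∑ x ∈ F e, sweep F V cl i n w x := by
  induction n with
  | zero => omega
  | succ n ih =>
    unfold sweep
    rcases Nat.lt_succ_iff_lt_or_eq.1 he with h | rfl
    · have h1 := ih (fun e he => hF e (by omega)) (fun e he => hV e (by omega)) h
      split_ifs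
      · exact h1.trans (Finset.sum_le_sum fun x _ => le_step_iterate _ _ _ _ _)
      · exact h1
    · rw [if_pos hc]
      exact le_sum_step_iterate _ (hF e he) _ (hV e he) _

/-! ### The potential -/

/-- Potential of an entry `u` of the cover relative to the entry `a` of a reference cover. -/
noncomputable def potential (p a u : ℝ) : ℝ :=
  a * min (Real.logb 2 (1 + 16 * p * u / a)) (Real.logb 2 (1 + 128 * p) + 1)

/-- Competitive ratio for constraints with at most `p` variables. -/
noncomputable def ratio (p : ℝ) : ℝ := 9 / 7 * (Real.logb 2 (1 + 128 * p) + 1)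

theorem potential_zero {p a : ℝ} (hp : 0 ≤ p) : potential p a 0 = 0 := by
  have : 0 ≤ Real.logb 2 (1 + 128 * p) := Real.logb_nonneg (by norm_num) (by linarith)
  simp only [potential, mul_zero, zero_div, add_zero, Real.logb_one]
  rw [min_eq_left (by linarith), mul_zero]

theorem potential_le {p a : ℝ} (ha : 0 ≤ a) (u : ℝ) :
    potential p a u ≤ a * (Real.logb 2 (1 + 128 * p) + 1) :=
  mul_le_mul_of_nonneg_left (min_le_right _ _) ha

theorem potential_mono {p a u v : ℝ} (hp : 0 ≤ p) (ha : 0 ≤ a) (hu : 0 ≤ u) (huv : u ≤ v) :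
    potential p a u ≤ potential p a v := by
  refine mul_le_mul_of_nonneg_left (min_le_min_right _ ?_) ha
  refine Real.logb_le_logb_of_le (by norm_num) (by positivity) ?_
  gcongr

/-- Put t = min(a, V)/a ≤ 1. The update multiplies 1 + 16pu/a by at least 1 + t, because doubling
pays for the mixed term and V ≤ 16pd for t itself; and log₂(1 + t) ≥ t on [0, 1]. The cap leaves
room: `u < 8 * a` keeps the old logarithm below log₂(1 + 128p), and the extra 1 absorbs t. -/
theorem potential_raise {p a u d V : ℝ} (hp : 0 ≤ p) (hu : 0 ≤ u) (hua : u < 8 * a)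
    (hV : 0 ≤ V) (hd : V ≤ 16 * p * d) :
    potential p a u + min a V ≤ potential p a (2 * u + d) := by
  have ha : 0 < a := by linarith
  have ht0 : 0 ≤ min a V / a := div_nonneg (le_min ha.le hV) ha.le
  have ht1 : min a V / a ≤ 1 := (div_le_one ha).2 (min_le_left _ _)
  have htV : min a V / a ≤ V / a := div_le_div_of_nonneg_right (min_le_right _ _) ha.le
  set t := min a V / a with ht
  have hmin : min a V = a * t := by rw [ht]; field_simp
  have hq : 0 ≤ 16 * p * u / a := by positivity
  -- Bernoulli's inequality for exponents in [0, 1] gives 2^t ≤ 1 + t.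
  have hlt : t ≤ Real.logb 2 (1 + t) := by
    rw [Real.le_logb_iff_rpow_le (by norm_num) (by linarith)]
    have := rpow_one_add_le_one_add_mul_self (s := 1) (by norm_num) ht0 ht1
    norm_num at this
    linarith
  have h1 : Real.logb 2 (1 + 16 * p * u / a) + t ≤ Real.logb 2 (1 + 16 * p * (2 * u + d) / a) := by
    have h2 : Real.logb 2 ((1 + 16 * p * u / a) * (1 + t)) ≤
        Real.logb 2 (1 + 16 * p * (2 * u + d) / a) := by
      refine Real.logb_le_logb_of_le (by norm_num) (by positivity) ?_
      have h3 : V / a ≤ 16 * p * d / a := div_le_div_of_nonneg_right hd ha.le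
      have h4 : 16 * p * (2 * u + d) / a = 2 * (16 * p * u / a) + 16 * p * d / a := by ring
      rw [h4]
      nlinarith
    rw [Real.logb_mul (by positivity) (by positivity)] at h2
    linarith
  have h5 : Real.logb 2 (1 + 16 * p * u / a) ≤ Real.logb 2 (1 + 128 * p) := by
    refine Real.logb_le_logb_of_le (by norm_num) (by positivity) ?_
    have : 16 * p * u / a ≤ 128 * p := by
      rw [div_le_iff₀ ha]
      nlinarith
    linarith
  rw [potential, potential, hmin, ← mul_add]
  refine mul_le_mul_of_nonneg_left (le_min ?_ ?_) ha.le
  · exact le_trans (add_le_add_left (min_le_left _ _) _) h1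
  · exact add_le_add ((min_le_left _ _).trans h5) ht1

/-- An update happens only if the sum over `F` is below V, so it costs at most V + V/8. The
potential gains at least V - V/8: truncated reference entries sum to at least V, and entries beyond
eight times their reference, which may gain nothing, are paid for by one eighth of the current sum.
The quotient is 9/7. -/
theorem sum_step_le {F : Finset ℕ} (hF : F ⊆ range Y) (hne : F.Nonempty) {V p : ℕ}
    (hV : 8 * #F ≤ V) (hp : #F ≤ p) {z : ℕ → ℝ} (hz : ∀ x, 0 ≤ z x) (hcov : (V : ℝ) ≤ ∑ x ∈ F, z x)
    {w : ℕ → ℕ} (hw : ∑ x ∈ range Y, (w x : ℝ) ≤ 9 / 7 * ∑ x ∈ range Y, potential p (z x) (w x)) :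
    ∑ x ∈ range Y, (step F V w x : ℝ) ≤
      9 / 7 * ∑ x ∈ range Y, potential p (z x) (step F V w x) := by
  by_cases hs : ∑ x ∈ F, w x < V
  swap
  · simpa only [step, if_neg hs] using hw
  have hk : 0 < #F := hne.card_pos
  have hp0 : (0 : ℝ) ≤ p := Nat.cast_nonneg p
  set d := V / (8 * #F) with hd
  have hstep : step F V w = raise F d w := by rw [step, if_pos hs]
  rw [hstep]
  have hsR : ∑ x ∈ F, (w x : ℝ) < V := by exact_mod_cast hs
  have hcost : ∑ x ∈ range Y, (raise F d w x : ℝ) =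
      ∑ x ∈ range Y, (w x : ℝ) + (∑ x ∈ F, (w x : ℝ) + #F * d) := by
    have h1 : ∀ x, (raise F d w x : ℝ) = w x + if x ∈ F then (w x : ℝ) + d else 0 := by
      intro x
      unfold raise
      split_ifs <;> push_cast <;> ring
    simp only [h1, Finset.sum_add_distrib, Finset.sum_ite_mem, Finset.inter_eq_right.2 hF,
      Finset.sum_const, nsmul_eq_mul]
  have hdV : (#F : ℝ) * d ≤ V / 8 := by
    have h1 : 8 * #F * d ≤ V := Nat.mul_div_le V _
    have h2 : (8 : ℝ) * #F * d ≤ V := by exact_mod_cast h1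
    linarith
  have hVd : (V : ℝ) ≤ 16 * p * d := by
    have h1 : V ≤ 16 * p * d := (le_mul_div hk hV).trans
      (Nat.mul_le_mul_right _ (Nat.mul_le_mul_left _ hp))
    exact_mod_cast h1
  -- Truncating the reference at V keeps the constraint covered: either one entry alone reaches V,
  -- or nothing is truncated.
  have hmin : (V : ℝ) ≤ ∑ x ∈ F, min (z x) V := by
    by_cases h : ∃ x ∈ F, (V : ℝ) ≤ z x
    · obtain ⟨x, hx, hxV⟩ := h
      have h1 := Finset.single_le_sum (f := fun x => min (z x) (V : ℝ))
        (fun x _ => le_min (hz x) (Nat.cast_nonneg V)) hx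
      simpa [hxV] using h1
    · push Not at h
      refine hcov.trans (Finset.sum_le_sum fun x hx => le_min le_rfl (h x hx).le)
  have hpot : ∑ x ∈ range Y, potential p (z x) (w x) + 7 / 8 * V ≤
      ∑ x ∈ range Y, potential p (z x) (raise F d w x) := by
    -- For `8 * z x ≤ w x` the added term is nonpositive and monotonicity suffices; otherwise
    -- `potential_raise` gives even more.
    have h1 : ∀ x ∈ range Y, potential p (z x) (w x) +
        (if x ∈ F then min (z x) (V : ℝ) - w x / 8 else 0) ≤
          potential p (z x) (raise F d w x) := by
      intro x _
      have hw0 : (0 : ℝ) ≤ w x := Nat.cast_nonneg _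
      have hmono : potential p (z x) (w x) ≤ potential p (z x) (raise F d w x) := by
        refine potential_mono hp0 (hz x) hw0 ?_
        unfold raise
        split_ifs <;> push_cast <;> linarith [(Nat.cast_nonneg d : (0 : ℝ) ≤ d)]
      by_cases hx : x ∈ F
      · rw [if_pos hx]
        by_cases hxz : (w x : ℝ) < 8 * z x
        · have h2 := potential_raise hp0 hw0 hxz (Nat.cast_nonneg V) hVd
          have h3 : (raise F d w x : ℝ) = 2 * w x + d := by simp [raise, hx]
          rw [h3]
          linarith
        · have : min (z x) (V : ℝ) ≤ z x := min_le_left _ _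
          linarith
      · rw [if_neg hx, add_zero]
        exact hmono
    have h2 := Finset.sum_le_sum h1
    rw [Finset.sum_add_distrib, Finset.sum_ite_mem, Finset.inter_eq_right.2 hF,
      Finset.sum_sub_distrib, ← Finset.sum_div] at h2
    linarith
  rw [hcost]
  linarith

/-! ### The greedy selection -/

/-- `z` covers the constraints of class `b` and of the classes in `S`. -/
def Covers (F : ℕ → Finset ℕ) (V cl : ℕ → ℕ) (m b : ℕ) (S : Finset ℕ) (z : ℕ → ℝ) : Prop :=
  (∀ x, 0 ≤ z x) ∧ ∀ e < m, (cl e = b ∨ cl e ∈ S) → (V e : ℝ) ≤ ∑ x ∈ F e, z x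

/-- Possible states of the greedy selection after `k` rounds: the current cover and the selected
classes. -/
inductive GreedyRun (F : ℕ → Finset ℕ) (V cl : ℕ → ℕ) (m Y b : ℕ) :
    ℕ → (ℕ → ℕ) → Finset ℕ → Prop
  | init {u w : ℕ → ℕ} : (∀ x < Y, u x = 0) → (∀ x < Y, w x = sweep F V cl b m u x) →
      GreedyRun F V cl m Y b 0 w ∅
  | next {k c : ℕ} {u w : ℕ → ℕ} {S : Finset ℕ} : GreedyRun F V cl m Y b k u S → c < b →
      (∀ c' < b, ∑ x ∈ range Y, sweep F V cl c' m u x ≤ ∑ x ∈ range Y, sweep F V cl c m u x) →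
      (∀ x < Y, w x = sweep F V cl c m u x) → GreedyRun F V cl m Y b (k + 1) w (insert c S)

variable {m b k : ℕ} {u : ℕ → ℕ} {S : Finset ℕ}

theorem GreedyRun.card_le (h : GreedyRun F V cl m Y b k u S) : #S ≤ k := by
  induction h with
  | init => simp
  | next _ _ _ _ ih => exact (Finset.card_insert_le _ _).trans (Nat.succ_le_succ ih)

theorem GreedyRun.lt (h : GreedyRun F V cl m Y b k u S) : ∀ i ∈ S, i < b := by
  induction h with
  | init => simp
  | next _ hc _ _ ih =>
    intro i hi
    rcases Finset.mem_insert.1 hi with rfl | hi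
    · exact hc
    · exact ih i hi

/-- The base class is processed at the start and the cover only grows. The comparison covers built
later have to satisfy this class too. -/
theorem GreedyRun.le_sum_base (hF : ∀ e < m, (F e).Nonempty) (hFY : ∀ e, F e ⊆ range Y)
    (hV : ∀ e < m, 8 * #(F e) ≤ V e) (h : GreedyRun F V cl m Y b k u S) {e : ℕ} (he : e < m)
    (hc : cl e = b) : V e ≤ ∑ x ∈ F e, u x := by
  induction h with
  | init h0 hw =>
    rw [Finset.sum_congr rfl fun x hx => hw x (mem_range.1 (hFY e hx))]
    exact le_sum_sweep hF hV _ he hc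
  | next _ _ _ hw ih =>
    rw [Finset.sum_congr rfl fun x hx => hw x (mem_range.1 (hFY e hx))]
    exact ih.trans (Finset.sum_le_sum fun x _ => le_sweep _ _ _ _)

/-- Every update of the run concerns the base class or a selected class, so one cover `z` of these
can serve as reference for the potential throughout. Cost at most 9/7 of the potential is the
invariant, and the cap of the potential turns it into the ratio. -/
theorem GreedyRun.sum_le (hF : ∀ e < m, (F e).Nonempty) (hFY : ∀ e, F e ⊆ range Y)
    (hV : ∀ e < m, 8 * #(F e) ≤ V e) {p : ℕ} (hp : ∀ e < m, #(F e) ≤ p)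
    (h : GreedyRun F V cl m Y b k u S) {z : ℕ → ℝ} (hz : Covers F V cl m b S z) :
    ∑ x ∈ range Y, (u x : ℝ) ≤ ratio p * ∑ x ∈ range Y, z x := by
  have hp0 : (0 : ℝ) ≤ p := Nat.cast_nonneg p
  have key : ∑ x ∈ range Y, (u x : ℝ) ≤ 9 / 7 * ∑ x ∈ range Y, potential p (z x) (u x) := by
    have hcongr : ∀ {w w' : ℕ → ℕ}, (∀ x < Y, w x = w' x) →
        ∑ x ∈ range Y, (w' x : ℝ) ≤ 9 / 7 * ∑ x ∈ range Y, potential p (z x) (w' x) →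
        ∑ x ∈ range Y, (w x : ℝ) ≤ 9 / 7 * ∑ x ∈ range Y, potential p (z x) (w x) := by
      intro w w' hw h'
      have h1 : ∑ x ∈ range Y, (w x : ℝ) = ∑ x ∈ range Y, (w' x : ℝ) :=
        Finset.sum_congr rfl fun x hx => by rw [hw x (mem_range.1 hx)]
      have h2 : ∑ x ∈ range Y, potential p (z x) (w x) = ∑ x ∈ range Y, potential p (z x) (w' x) :=
        Finset.sum_congr rfl fun x hx => by rw [hw x (mem_range.1 hx)]
      rwa [h1, h2]
    induction h with
    | init h0 hw =>
      refine hcongr hw (sweep_induction (P := fun w => ∑ x ∈ range Y, (w x : ℝ) ≤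
        9 / 7 * ∑ x ∈ range Y, potential p (z x) (w x)) (fun e he hc w h => ?_) ?_)
      · exact sum_step_le (hFY e) (hF e he) (hV e he) (hp e he) hz.1 (hz.2 e he (Or.inl hc)) h
      · rw [Finset.sum_eq_zero fun x hx => by rw [h0 x (mem_range.1 hx), Nat.cast_zero],
          Finset.sum_eq_zero fun x hx => by
            rw [h0 x (mem_range.1 hx), Nat.cast_zero, potential_zero hp0], mul_zero]
    | next _ _ _ hw ih =>
      refine hcongr hw (sweep_induction (P := fun w => ∑ x ∈ range Y, (w x : ℝ) ≤
        9 / 7 * ∑ x ∈ range Y, potential p (z x) (w x)) (fun e he hc w h => ?_) ?_)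
      · exact sum_step_le (hFY e) (hF e he) (hV e he) (hp e he) hz.1
          (hz.2 e he (Or.inr (by simp [hc]))) h
      -- A cover of the final selection also covers the smaller selection before this round.
      · exact ih ⟨hz.1, fun e he hc => hz.2 e he (hc.imp_right (Finset.mem_insert_of_mem))⟩
  refine key.trans ?_
  rw [ratio, mul_assoc, mul_comm _ (∑ x ∈ range Y, z x), Finset.sum_mul]
  exact mul_le_mul_of_nonneg_left (Finset.sum_le_sum fun x _ => potential_le (hz.1 x) _)
    (by norm_num)

/-- Each round closes at least the fraction 1/K of the gap to `v`, since the chosen class does at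
least as well as the average over a rival set of at most `K` classes. -/
theorem GreedyRun.sub_le (hF : ∀ e < m, (F e).Nonempty) (hFY : ∀ e, F e ⊆ range Y)
    (hV : ∀ e < m, 8 * #(F e) ≤ V e) {K : ℕ} (hK : 0 < K)
    (h : GreedyRun F V cl m Y b k u S) {T : Finset ℕ} (hT : ∀ i ∈ T, i < b) (hTK : #T ≤ K) {v : ℝ}
    (hv : ∀ z, Covers F V cl m b T z → v ≤ ∑ x ∈ range Y, z x) :
    v - ∑ x ∈ range Y, (u x : ℝ) ≤ (1 - 1 / K) ^ k * v := by
  have hK' : (0 : ℝ) < K := by exact_mod_cast hK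
  induction h with
  | @init u w h0 hw =>
    have : 0 ≤ ∑ x ∈ range Y, (w x : ℝ) := Finset.sum_nonneg fun _ _ => Nat.cast_nonneg _
    rw [pow_zero, one_mul]
    linarith
  | @next k c u w S hrun hc hmax hw ih =>
    set C : ℝ := ∑ x ∈ range Y, (u x : ℝ) with hC
    set C' : ℝ := ∑ x ∈ range Y, (w x : ℝ) with hC'
    have hC'eq : C' = ∑ x ∈ range Y, (sweep F V cl c m u x : ℝ) :=
      Finset.sum_congr rfl fun x hx => by rw [hw x (mem_range.1 hx)]
    have hinc : ∀ i x, (0 : ℝ) ≤ (sweep F V cl i m u x : ℝ) - u x := fun i x =>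
      sub_nonneg.2 (by exact_mod_cast le_sweep i m u x)
    have hCC : C ≤ C' := by
      rw [hC'eq]
      exact Finset.sum_le_sum fun x _ => by exact_mod_cast le_sweep c m u x
    have hgain : v ≤ C + K * (C' - C) := by
      have hcov : Covers F V cl m b T fun x =>
          u x + ∑ i ∈ T, ((sweep F V cl i m u x : ℝ) - u x) := by
        refine ⟨fun x => add_nonneg (Nat.cast_nonneg _) (Finset.sum_nonneg fun i _ => hinc i x),
          fun e he hce => ?_⟩
        rcases hce with hce | hce
        · have h1 : (V e : ℝ) ≤ ∑ x ∈ F e, (u x : ℝ) := by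
            exact_mod_cast hrun.le_sum_base hF hFY hV he hce
          exact h1.trans (Finset.sum_le_sum fun x _ => le_add_of_nonneg_right
            (Finset.sum_nonneg fun i _ => hinc i x))
        · have h1 : (V e : ℝ) ≤ ∑ x ∈ F e, (sweep F V cl (cl e) m u x : ℝ) := by
            exact_mod_cast le_sum_sweep hF hV u he rfl
          refine h1.trans (Finset.sum_le_sum fun x _ => ?_)
          have h2 := Finset.single_le_sum (f := fun i => (sweep F V cl i m u x : ℝ) - u x)
            (fun i _ => hinc i x) hce
          linarith
      refine (hv _ hcov).trans ?_
      rw [Finset.sum_add_distrib, Finset.sum_comm]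
      refine add_le_add_right ?_ _
      have h1 : ∀ i ∈ T, ∑ x ∈ range Y, ((sweep F V cl i m u x : ℝ) - u x) ≤ C' - C := by
        intro i hi
        rw [Finset.sum_sub_distrib, hC'eq]
        refine sub_le_sub_right ?_ _
        exact_mod_cast hmax i (hT i hi)
      refine (Finset.sum_le_card_nsmul _ _ _ h1).trans ?_
      rw [nsmul_eq_mul]
      exact mul_le_mul_of_nonneg_right (by exact_mod_cast hTK) (sub_nonneg.2 hCC)
    have hq : (0 : ℝ) ≤ 1 - 1 / K := by
      rw [sub_nonneg, div_le_one hK']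
      exact_mod_cast hK
    have h2 : v - C' ≤ (1 - 1 / K) * (v - C) := by
      have : (v - C) / K ≤ C' - C := by
        rw [div_le_iff₀ hK']
        linarith
      have h3 : (1 - 1 / K) * (v - C) = (v - C) - (v - C) / K := by ring
      linarith
    refine h2.trans ?_
    rw [pow_succ', mul_assoc]
    exact mul_le_mul_of_nonneg_left ih hq

/-- The gap bound with as many rounds as rival classes, and (1 - 1/k)^k ≤ 1/e. With zero rounds `T`
is empty and the base cover alone costs at least `v`. -/
theorem GreedyRun.mul_le_sum (hF : ∀ e < m, (F e).Nonempty) (hFY : ∀ e, F e ⊆ range Y)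
    (hV : ∀ e < m, 8 * #(F e) ≤ V e)
    (h : GreedyRun F V cl m Y b k u S) {T : Finset ℕ} (hT : ∀ i ∈ T, i < b) (hTK : #T ≤ k) {v : ℝ}
    (hv0 : 0 ≤ v) (hv : ∀ z, Covers F V cl m b T z → v ≤ ∑ x ∈ range Y, z x) :
    (1 - Real.exp (-1)) * v ≤ ∑ x ∈ range Y, (u x : ℝ) := by
  rcases Nat.eq_zero_or_pos k with rfl | hk
  · have hT0 : T = ∅ := Finset.card_eq_zero.1 (Nat.le_zero.1 hTK)
    subst hT0
    have h1 : v ≤ ∑ x ∈ range Y, (u x : ℝ) := by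
      refine hv (fun x => (u x : ℝ)) ⟨fun x => Nat.cast_nonneg _, fun e he hc => ?_⟩
      have h2 := h.le_sum_base hF hFY hV he (by simpa using hc)
      dsimp only
      exact_mod_cast h2
    nlinarith [Real.exp_pos (-1)]
  · have h1 := h.sub_le hF hFY hV hk hT hTK hv
    have h2 := Real.one_sub_div_pow_le_exp_neg (n := k) (t := 1) (by exact_mod_cast hk)
    have h3 := mul_le_mul_of_nonneg_right h2 hv0
    linarith

/-! ### The greedy matching -/

/-- Possible states of the greedy matching after `t` rounds: the vertex weights and the chosen
hyperedges. -/
inductive MatchRun (F : ℕ → Finset ℕ) (V : ℕ → ℕ) (av : ℕ → Prop) (m Y : ℕ) :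
    ℕ → (ℕ → ℕ) → Finset ℕ → Prop
  | init {w : ℕ → ℕ} : (∀ x < Y, w x = 0) → MatchRun F V av m Y 0 w ∅
  | pick {t e : ℕ} {w : ℕ → ℕ} {M : Finset ℕ} : MatchRun F V av m Y t w M → e < m → av e →
      ∑ x ∈ F e, w x = 0 →
      (∀ f < m, av f → ∑ x ∈ F f, w x = 0 → V f ≤ V e) →
      MatchRun F V av m Y (t + 1) (raise (F e) (V e) w) (insert e M)
  | idle {t : ℕ} {w : ℕ → ℕ} {M : Finset ℕ} : MatchRun F V av m Y t w M →
      (∀ f < m, av f → ∑ x ∈ F f, w x ≠ 0) → MatchRun F V av m Y (t + 1) w M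

variable {av : ℕ → Prop} {t : ℕ} {w : ℕ → ℕ} {M : Finset ℕ}

theorem raise_apply_of_sum_eq_zero {F : Finset ℕ} {w : ℕ → ℕ} (h : ∑ x ∈ F, w x = 0) (d x : ℕ) :
    raise F d w x = if x ∈ F then d else w x := by
  unfold raise
  split_ifs with hx
  · rw [Finset.sum_eq_zero_iff.1 h x hx, mul_zero, zero_add]
  · rfl

/-- Positive values make weight zero synonymous with unmatched. A later pick needs zero weight on
all its vertices, hence never touches the vertices of an earlier one. -/
theorem MatchRun.mem (hV : ∀ e < m, 0 < V e) (h : MatchRun F V av m Y t w M) :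
    ∀ e ∈ M, e < m ∧ av e ∧ ∀ x ∈ F e, w x = V e := by
  induction h with
  | init => simp
  | @pick t e w M _ he hav h0 _ ih =>
    intro f hf
    rcases Finset.mem_insert.1 hf with rfl | hf
    · exact ⟨he, hav, fun x hx => by rw [raise_apply_of_sum_eq_zero h0, if_pos hx]⟩
    · obtain ⟨hfm, hfa, hfw⟩ := ih f hf
      refine ⟨hfm, hfa, fun x hx => ?_⟩
      rw [raise_apply_of_sum_eq_zero h0]
      split_ifs with hxe
      · have h1 := Finset.sum_eq_zero_iff.1 h0 x hxe
        have h2 := hV f hfm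
        rw [hfw x hx] at h1
        omega
      · exact hfw x hx
  | idle _ _ ih => exact ih

theorem MatchRun.disjoint_of_sum_eq_zero (hV : ∀ e < m, 0 < V e) (h : MatchRun F V av m Y t w M)
    {e f : ℕ} (h0 : ∑ x ∈ F e, w x = 0) (hf : f ∈ M) : Disjoint (F e) (F f) := by
  obtain ⟨hfm, -, hfw⟩ := h.mem hV f hf
  rw [Finset.disjoint_left]
  intro x hxe hxf
  have h1 := Finset.sum_eq_zero_iff.1 h0 x hxe
  have h2 := hV f hfm
  rw [hfw x hxf] at h1
  omega

theorem MatchRun.disjoint (hV : ∀ e < m, 0 < V e) (h : MatchRun F V av m Y t w M) :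
    ∀ e ∈ M, ∀ f ∈ M, e ≠ f → Disjoint (F e) (F f) := by
  induction h with
  | init => simp
  | @pick t e w M hrun _ _ h0 _ ih =>
    intro f hf g hg hfg
    rcases Finset.mem_insert.1 hf with rfl | hfM <;> rcases Finset.mem_insert.1 hg with rfl | hgM
    · exact absurd rfl hfg
    · exact hrun.disjoint_of_sum_eq_zero hV h0 hgM
    · exact (hrun.disjoint_of_sum_eq_zero hV h0 hfM).symm
    · exact ih f hfM g hgM hfg
  | idle _ _ ih => exact ih

theorem MatchRun.sum_eq (hF : ∀ e < m, (F e).Nonempty) (hFY : ∀ e, F e ⊆ range Y)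
    (hV : ∀ e < m, 0 < V e) (h : MatchRun F V av m Y t w M) :
    ∑ x ∈ range Y, w x = ∑ e ∈ M, #(F e) * V e := by
  induction h with
  | init h0 => simp only [Finset.sum_empty]; exact Finset.sum_eq_zero fun x hx => h0 x (by simpa using hx)
  | @pick t e w M hrun he _ h0 _ ih =>
    -- If already chosen, `F e` would be disjoint from itself, hence empty.
    have heM : e ∉ M := fun heM => (hF e he).ne_empty
      (Finset.disjoint_self_iff_empty _ |>.1 (hrun.disjoint_of_sum_eq_zero hV h0 heM))
    rw [Finset.sum_insert heM, ← ih]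
    have h1 : ∀ x, raise (F e) (V e) w x = (if x ∈ F e then V e else 0) + w x := by
      intro x
      rw [raise_apply_of_sum_eq_zero h0]
      split_ifs with hx
      · rw [Finset.sum_eq_zero_iff.1 h0 x hx, add_zero]
      · rw [zero_add]
    simp only [h1, Finset.sum_add_distrib, Finset.sum_ite_mem, Finset.inter_eq_right.2 (hFY e),
      Finset.sum_const, smul_eq_mul]
  | idle _ _ ih => exact ih

/-- A hyperedge becomes blocked when a pick meets it. At that moment it was itself a candidate, so
the pick is at least as valuable and leaves its value on the common vertex. -/
theorem MatchRun.le_or_sum_eq_zero (h : MatchRun F V av m Y t w M) {f : ℕ}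
    (hFY : F f ⊆ range Y) (hf : f < m)
    (hav : av f) : (∃ x ∈ F f, V f ≤ w x) ∨ ∑ x ∈ F f, w x = 0 := by
  induction h with
  | init h0 => exact Or.inr (Finset.sum_eq_zero fun x hx => h0 x (by simpa using hFY hx))
  | @pick t e w M hrun he _ h0 hmax ih =>
    have hle : ∀ x, w x ≤ raise (F e) (V e) w x := fun x => by
      unfold raise
      split_ifs <;> omega
    rcases ih with ⟨x, hx, hxV⟩ | h1
    · exact Or.inl ⟨x, hx, hxV.trans (hle x)⟩
    · by_cases h2 : ∃ x ∈ F f, x ∈ F e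
      · obtain ⟨x, hxf, hxe⟩ := h2
        refine Or.inl ⟨x, hxf, ?_⟩
        rw [raise_apply_of_sum_eq_zero h0, if_pos hxe]
        exact hmax f hf hav h1
      · push Not at h2
        refine Or.inr (Finset.sum_eq_zero fun x hx => ?_)
        rw [raise_apply_of_sum_eq_zero h0, if_neg (h2 x hx)]
        exact Finset.sum_eq_zero_iff.1 h1 x hx
  | idle _ _ ih => exact ih

-- Progress measure: every pick blocks at least itself, and idle rounds occur only when nothing is
-- left to block.
open Classical in
theorem MatchRun.card_unblocked_le (hF : ∀ e < m, (F e).Nonempty) (hV : ∀ e < m, 0 < V e)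
    (h : MatchRun F V av m Y t w M) :
    #{f ∈ range m | av f ∧ ∑ x ∈ F f, w x = 0} ≤ m - t := by
  induction h with
  | init h0 => simpa using Finset.card_filter_le (range m) _
  | @pick t e w M hrun he hav h0 _ ih =>
    have hss : ({f ∈ range m | av f ∧ ∑ x ∈ F f, raise (F e) (V e) w x = 0} : Finset ℕ) ⊂
        {f ∈ range m | av f ∧ ∑ x ∈ F f, w x = 0} := by
      refine Finset.ssubset_iff_of_subset ?_ |>.2 ⟨e, Finset.mem_filter.2 ⟨Finset.mem_range.2 he, hav, h0⟩, ?_⟩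
      · intro f hf
        simp only [Finset.mem_filter] at hf ⊢
        refine ⟨hf.1, hf.2.1, Nat.le_zero.1 (hf.2.2 ▸ Finset.sum_le_sum fun x _ => ?_)⟩
        unfold raise
        split_ifs <;> omega
      · intro hmem
        obtain ⟨x, hx⟩ := hF e he
        have h1 := Finset.sum_eq_zero_iff.1 (Finset.mem_filter.1 hmem).2.2 x hx
        rw [raise_apply_of_sum_eq_zero h0, if_pos hx] at h1
        exact (hV e he).ne' h1
    have := Finset.card_lt_card hss
    omega
  | idle _ hall _ =>
    rw [Finset.filter_false_of_mem, Finset.card_empty]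
    · exact Nat.zero_le _
    · rintro f hf ⟨hfa, hf0⟩
      exact hall f (Finset.mem_range.1 hf) hfa hf0

/-- After `m` rounds every available hyperedge is blocked, so the vertex weights form a cover, whose
cost is given by `MatchRun.sum_eq`. -/
theorem MatchRun.exists_le (hF : ∀ e < m, (F e).Nonempty) (hFY : ∀ e, F e ⊆ range Y)
    (hV : ∀ e < m, 0 < V e) (h : MatchRun F V av m Y m w M) {f : ℕ} (hf : f < m) (hav : av f) :
    ∃ x ∈ F f, V f ≤ w x := by
  classical
  have h1 := h.card_unblocked_le hF hV
  rw [Nat.sub_self, Nat.le_zero, Finset.card_eq_zero] at h1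
  refine (h.le_or_sum_eq_zero (hFY f) hf hav).resolve_right fun h0 => ?_
  have : f ∈ ({f ∈ range m | av f ∧ ∑ x ∈ F f, w x = 0} : Finset ℕ) :=
    Finset.mem_filter.2 ⟨Finset.mem_range.2 hf, hav, h0⟩
  rw [h1] at this
  simp at this

end Covering

/-! ### Cost calculus: time and bit growth of programs -/

namespace RAM

/-! ### Polynomially bounded functions -/

/-- `f` is bounded by a polynomial. -/
def PolyBdd (f : ℕ → ℕ) : Prop := ∃ q : Polynomial ℕ, ∀ n, f n ≤ q.eval n

theorem PolyBdd.const (c : ℕ) : PolyBdd fun _ => c := ⟨Polynomial.C c, by simp⟩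

theorem PolyBdd.id : PolyBdd fun n => n := ⟨Polynomial.X, by simp⟩

theorem PolyBdd.add {f g : ℕ → ℕ} (hf : PolyBdd f) (hg : PolyBdd g) :
    PolyBdd fun n => f n + g n := by
  obtain ⟨p, hp⟩ := hf
  obtain ⟨q, hq⟩ := hg
  exact ⟨p + q, fun n => by simpa using Nat.add_le_add (hp n) (hq n)⟩

theorem PolyBdd.mul {f g : ℕ → ℕ} (hf : PolyBdd f) (hg : PolyBdd g) :
    PolyBdd fun n => f n * g n := by
  obtain ⟨p, hp⟩ := hf
  obtain ⟨q, hq⟩ := hg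
  exact ⟨p * q, fun n => by simpa using Nat.mul_le_mul (hp n) (hq n)⟩

/-! ### Syntactic bounds for terms -/

/-- The value of a term has at most `wt * (B + 1)` bits in a memory of `B`-bit numbers. -/
def Term.wt : Term → ℕ
  | .lit n => n.size + 1
  | .read a => a.wt + 1
  | .add a b => a.wt + b.wt
  | .sub a b => a.wt + b.wt
  | .mul a b => a.wt + b.wt
  | .div a b => a.wt + b.wt

/-- The cost of a term is at most `cw * (B + 1)` in a memory of `B`-bit numbers. -/
def Term.cw : Term → ℕ
  | .lit n => n.size + 1
  | .read a => a.cw + (1 + a.wt + 1)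
  | .add a b => a.cw + b.cw + (1 + a.wt + b.wt)
  | .sub a b => a.cw + b.cw + (1 + a.wt + b.wt)
  | .mul a b => a.cw + b.cw + (1 + a.wt + b.wt)
  | .div a b => a.cw + b.cw + (1 + a.wt + b.wt)

/-- Terms whose value exceeds the contents of the memory by a constant factor at most. -/
def Term.Lin : Term → Bool
  | .lit _ => true
  | .read _ => true
  | .add a b => a.Lin && b.Lin
  | .sub a _ => a.Lin
  | .mul _ _ => false
  | .div a _ => a.Lin

theorem Term.one_le_wt (t : Term) : 1 ≤ t.wt := by
  induction t <;> simp only [Term.wt] <;> omega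

theorem add_lt_two_pow {x y a b : ℕ} (hx : x < 2 ^ a) (hy : y < 2 ^ b) (ha : 1 ≤ a) (hb : 1 ≤ b) :
    x + y < 2 ^ (a + b) := by
  have h1 : 2 ^ 1 ≤ 2 ^ a := Nat.pow_le_pow_right two_pos ha
  have h2 : 2 ^ 1 ≤ 2 ^ b := Nat.pow_le_pow_right two_pos hb
  rw [pow_add]
  nlinarith

theorem Term.eval_lt {μ : Mem} {B : ℕ} (h : ∀ i, μ i < 2 ^ B) (t : Term) :
    t.eval μ < 2 ^ (t.wt * (B + 1)) := by
  have hle : ∀ {a b : Term} {x : ℕ}, x < 2 ^ (a.wt * (B + 1)) →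
      x < 2 ^ ((a.wt + b.wt) * (B + 1)) := fun hx =>
    hx.trans_le (Nat.pow_le_pow_right two_pos (Nat.mul_le_mul_right _ (Nat.le_add_right _ _)))
  have hone : ∀ a : Term, 1 ≤ a.wt * (B + 1) := fun a => Nat.mul_pos a.one_le_wt (Nat.succ_pos B)
  induction t with
  | lit n =>
    refine (Nat.lt_size_self n).trans_le (Nat.pow_le_pow_right two_pos ?_)
    simp only [Term.wt]
    nlinarith
  | read a _ =>
    refine (h _).trans_le (Nat.pow_le_pow_right two_pos ?_)
    simp only [Term.wt]
    nlinarith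
  | add a b iha ihb =>
    simp only [Term.wt, Term.eval, Nat.add_mul]
    exact add_lt_two_pow iha ihb (hone a) (hone b)
  | sub a b iha _ => exact hle ((Nat.sub_le _ _).trans_lt iha)
  | mul a b iha ihb =>
    simp only [Term.wt, Term.eval, Nat.add_mul, pow_add]
    exact Nat.mul_lt_mul'' iha ihb
  | div a b iha _ => exact hle ((Nat.div_le_self _ _).trans_lt iha)

/-- The gain in bits is a constant independent of `B`, which keeps numbers short over many passes of
a loop. A product can double the length, hence the exclusion of `mul`. -/
theorem Term.eval_lt_of_lin {μ : Mem} {B : ℕ} (h : ∀ i, μ i < 2 ^ B) {t : Term} (ht : t.Lin = true) :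
    t.eval μ < 2 ^ (B + t.wt) := by
  have hle : ∀ {a b : Term} {x : ℕ}, x < 2 ^ (B + a.wt) →
      x < 2 ^ (B + (a.wt + b.wt)) := fun hx =>
    hx.trans_le (Nat.pow_le_pow_right two_pos (by omega))
  induction t with
  | lit n =>
    refine (Nat.lt_size_self n).trans_le (Nat.pow_le_pow_right two_pos ?_)
    simp only [Term.wt]
    omega
  | read a _ => exact (h _).trans_le (Nat.pow_le_pow_right two_pos (by omega))
  | add a b iha ihb =>
    have h1 := iha (Bool.and_eq_true_iff.1 ht).1
    have h2 := ihb (Bool.and_eq_true_iff.1 ht).2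
    have ha := Nat.pow_le_pow_right two_pos a.one_le_wt
    have hb := Nat.pow_le_pow_right two_pos b.one_le_wt
    simp only [Term.wt, Term.eval]
    rw [pow_add] at h1 h2 ⊢
    rw [pow_add]
    have h3 : 2 ^ a.wt + 2 ^ b.wt ≤ 2 ^ a.wt * 2 ^ b.wt := by nlinarith
    calc _ < 2 ^ B * 2 ^ a.wt + 2 ^ B * 2 ^ b.wt := by omega
      _ = 2 ^ B * (2 ^ a.wt + 2 ^ b.wt) := by ring
      _ ≤ _ := Nat.mul_le_mul_left _ h3
  | sub a b iha _ => exact hle ((Nat.sub_le _ _).trans_lt (iha ht))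
  | mul a b => exact (Bool.false_ne_true ht).elim
  | div a b iha _ => exact hle ((Nat.div_le_self _ _).trans_lt (iha ht))

theorem Term.cost_le {μ : Mem} {B : ℕ} (h : ∀ i, μ i < 2 ^ B) (t : Term) :
    t.cost μ ≤ t.cw * (B + 1) := by
  have hs : ∀ a : Term, (a.eval μ).size ≤ a.wt * (B + 1) := fun a => Nat.size_le.2 (a.eval_lt h)
  induction t with
  | lit n => simp only [Term.cost, Term.cw]; nlinarith
  | read a iha =>
    have h1 := hs a
    have h2 : (μ (a.eval μ)).size ≤ B := Nat.size_le.2 (h _)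
    simp only [Term.cost, Term.cw]
    nlinarith
  | add a b iha ihb | sub a b iha ihb | mul a b iha ihb | div a b iha ihb =>
    have h1 := hs a
    have h2 := hs b
    simp only [Term.cost, Term.cw]
    nlinarith

/-! ### Runs with a joint bound for time and growth of the numbers -/

/-- `P` leads from `μ` to `ν`; the numbers in memory get at most `T` bits longer, and the cost is
at most `T * (B + T + 1)` if the numbers in `μ` have `B` bits. -/
def Runs (P : Prog) (μ : Mem) (T : ℕ) (ν : Mem) : Prop :=
  ∀ B, (∀ i, μ i < 2 ^ B) → (∀ i, ν i < 2 ^ (B + T)) ∧ ∃ c ≤ T * (B + T + 1), Exec P μ c ν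

theorem Runs.mono {P : Prog} {μ ν : Mem} {T T' : ℕ} (h : Runs P μ T ν) (hT : T ≤ T') :
    Runs P μ T' ν := by
  intro B hB
  obtain ⟨h1, c, hc, he⟩ := h B hB
  exact ⟨fun i => (h1 i).trans_le (Nat.pow_le_pow_right two_pos (by omega)), c,
    hc.trans (Nat.mul_le_mul hT (by omega)), he⟩

theorem runs_skip (μ : Mem) : Runs .skip μ 1 μ := fun B hB =>
  ⟨fun i => (hB i).trans_le (Nat.pow_le_pow_right two_pos (by omega)), 1, by omega, .skip μ⟩

/-- The second program starts from numbers of B + T bits; its cost bound already has room for them,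
so the budgets just add. -/
theorem Runs.seq {P Q : Prog} {μ ν ρ : Mem} {T T' : ℕ} (h : Runs P μ T ν) (h' : Runs Q ν T' ρ) :
    Runs (.seq P Q) μ (T + T') ρ := by
  intro B hB
  obtain ⟨h1, c, hc, he⟩ := h B hB
  obtain ⟨h2, d, hd, hf⟩ := h' (B + T) h1
  refine ⟨fun i => by simpa only [Nat.add_assoc] using h2 i, c + d, ?_, .seq he hf⟩
  have : T * (B + T + 1) ≤ T * (B + (T + T') + 1) := Nat.mul_le_mul_left _ (by omega)
  have : T' * (B + T + T' + 1) = T' * (B + (T + T') + 1) := by ring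
  rw [Nat.add_mul]
  omega

theorem update_lt {μ : Mem} {B T : ℕ} (hB : ∀ i, μ i < 2 ^ B) {a b : ℕ} (hb : b < 2 ^ (B + T))
    (i : ℕ) : Function.update μ a b i < 2 ^ (B + T) := by
  rw [Function.update_apply]
  split_ifs
  · exact hb
  · exact (hB i).trans_le (Nat.pow_le_pow_right two_pos (by omega))

/-- Bound for the cost of a `write`. -/
def writeCost (a b : Term) : ℕ := a.cw + b.cw + 1 + a.wt + b.wt

theorem cost_write_le {μ : Mem} {B : ℕ} (hB : ∀ i, μ i < 2 ^ B) (a b : Term) :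
    a.cost μ + b.cost μ + (1 + (a.eval μ).size + (b.eval μ).size) ≤
      writeCost a b * (B + 1) := by
  have h1 := a.cost_le hB
  have h2 := b.cost_le hB
  have h3 := Nat.size_le.2 (a.eval_lt hB)
  have h4 := Nat.size_le.2 (b.eval_lt hB)
  unfold writeCost
  nlinarith

theorem runs_write (μ : Mem) (a b : Term) (hb : b.Lin = true) :
    Runs (.write a b) μ (writeCost a b) (Function.update μ (a.eval μ) (b.eval μ)) := by
  intro B hB
  refine ⟨update_lt hB ((b.eval_lt_of_lin hB hb).trans_le
    (Nat.pow_le_pow_right two_pos (by unfold writeCost; omega))), _,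
    (cost_write_le hB a b).trans (Nat.mul_le_mul_left _ (by omega)), .write μ a b⟩

/-- For products: the number of bits has to come from knowledge about the value instead of the
syntax. -/
theorem runs_write_of_lt (μ : Mem) (a b : Term) {s : ℕ} (hb : b.eval μ < 2 ^ s) :
    Runs (.write a b) μ (writeCost a b + s) (Function.update μ (a.eval μ) (b.eval μ)) := by
  intro B hB
  refine ⟨update_lt hB (hb.trans_le (Nat.pow_le_pow_right two_pos (by omega))), _,
    (cost_write_le hB a b).trans (Nat.mul_le_mul (by omega) (by omega)), .write μ a b⟩

theorem runs_test {t : Term} {μ ν : Mem} {P P' : Prog} {T : ℕ} (h : Runs P μ T ν)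
    (hP : ∀ c, Exec P μ c ν → Exec P' μ (t.cost μ + 1 + c) ν) : Runs P' μ (t.cw + 1 + T) ν := by
  intro B hB
  obtain ⟨h1, c, hc, he⟩ := h B hB
  refine ⟨fun i => (h1 i).trans_le (Nat.pow_le_pow_right two_pos (by omega)), _, ?_, hP c he⟩
  have h2 := t.cost_le hB
  have h3 : (t.cw + 1) * (B + 1) ≤ (t.cw + 1) * (B + (t.cw + 1 + T) + 1) :=
    Nat.mul_le_mul_left _ (by omega)
  have h4 : T * (B + T + 1) ≤ T * (B + (t.cw + 1 + T) + 1) := Nat.mul_le_mul_left _ (by omega)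
  rw [Nat.add_mul _ T]
  nlinarith

theorem Runs.condTrue {t : Term} {P Q : Prog} {μ ν : Mem} {T : ℕ} (h : Runs P μ T ν)
    (ht : t.eval μ ≠ 0) : Runs (.cond t P Q) μ (t.cw + 1 + T) ν :=
  runs_test h fun _ he => .condTrue ht he

theorem Runs.condFalse {t : Term} {P Q : Prog} {μ ν : Mem} {T : ℕ} (h : Runs Q μ T ν)
    (ht : t.eval μ = 0) : Runs (.cond t P Q) μ (t.cw + 1 + T) ν :=
  runs_test h fun _ he => .condFalse ht he

theorem runs_loop_done {t : Term} {P : Prog} {μ : Mem} (ht : t.eval μ = 0) :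
    Runs (.loop t P) μ (t.cw + 1) μ := by
  intro B hB
  refine ⟨fun i => (hB i).trans_le (Nat.pow_le_pow_right two_pos (by omega)), _, ?_, .loopDone ht⟩
  have h2 := t.cost_le hB
  nlinarith

theorem Runs.loop_step {t : Term} {P : Prog} {μ ν ρ : Mem} {T T' : ℕ} (ht : t.eval μ ≠ 0)
    (h : Runs P μ T ν) (h' : Runs (.loop t P) ν T' ρ) :
    Runs (.loop t P) μ (t.cw + 1 + (T + T')) ρ := by
  refine runs_test (P := .seq P (.loop t P)) (h.seq h') fun c he => ?_
  cases he with
  | seq h1 h2 => rw [← Nat.add_assoc]; exact .loopTrue ht h1 h2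

/-- A pass adds the same number of bits whatever the current size, so `n` passes cause linear rather
than geometric growth. -/
theorem runs_loop {t : Term} {P : Prog} {T n : ℕ} (Inv : ℕ → Mem → Prop)
    (hstep : ∀ k < n, ∀ μ, Inv k μ → t.eval μ ≠ 0 ∧ ∃ ν, Runs P μ T ν ∧ Inv (k + 1) ν)
    (hend : ∀ μ, Inv n μ → t.eval μ = 0) {μ : Mem} (h0 : Inv 0 μ) :
    ∃ ν, Runs (.loop t P) μ (n * (t.cw + 1 + T) + (t.cw + 1)) ν ∧ Inv n ν := by
  -- Induction on the number `j` of passes still to come.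
  have key : ∀ j ≤ n, ∀ μ, Inv (n - j) μ →
      ∃ ν, Runs (.loop t P) μ (j * (t.cw + 1 + T) + (t.cw + 1)) ν ∧ Inv n ν := by
    intro j
    induction j with
    | zero => exact fun _ μ h => ⟨μ, (runs_loop_done (hend μ h)).mono (by omega), h⟩
    | succ j ih =>
      intro hj μ hμ
      obtain ⟨ht, ν, hr, hν⟩ := hstep (n - (j + 1)) (by omega) μ hμ
      rw [show n - (j + 1) + 1 = n - j by omega] at hν
      obtain ⟨ρ, hr', hρ⟩ := ih (by omega) ν hν
      refine ⟨ρ, (hr.loop_step ht hr').mono (le_of_eq ?_), hρ⟩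
      ring
  exact key n le_rfl μ (by simpa using h0)

end RAM

namespace RAM

/-! ### Structured memories

Cells `0, …, 17` hold named scalars, the cells from `18` on five interleaved arrays. -/

/-- A memory seen as named scalars and arrays. -/
structure St where
  nA : ℕ
  nV : ℕ
  L : ℕ
  Y : ℕ
  m : ℕ
  K : ℕ
  E0 : ℕ
  st : ℕ
  Q : ℕ
  e : ℕ
  x : ℕ
  s : ℕ
  d : ℕ
  i : ℕ
  c : ℕ
  best : ℕ
  bi : ℕ
  t : ℕ
  inp : ℕ → ℕ
  V : ℕ → ℕ
  u : ℕ → ℕ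
  w : ℕ → ℕ
  out : ℕ → ℕ

namespace St

/-- The scalar with the given address. -/
def scal (σ : St) : ℕ → ℕ
  | 0 => σ.nA
  | 1 => σ.nV
  | 2 => σ.L
  | 3 => σ.Y
  | 4 => σ.m
  | 5 => σ.K
  | 6 => σ.E0
  | 7 => σ.st
  | 8 => σ.Q
  | 9 => σ.e
  | 10 => σ.x
  | 11 => σ.s
  | 12 => σ.d
  | 13 => σ.i
  | 14 => σ.c
  | 15 => σ.best
  | 16 => σ.bi
  | _ => σ.t

/-- The array with the given offset. -/
def arr (σ : St) : ℕ → ℕ → ℕ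
  | 0 => σ.inp
  | 1 => σ.V
  | 2 => σ.u
  | 3 => σ.w
  | _ => σ.out

/-- The memory of a machine in state `σ`. -/
def mem (σ : St) : Mem := fun a =>
  if a < 18 then σ.scal a else σ.arr ((a - 18) % 5) ((a - 18) / 5)

theorem mem_scal (σ : St) {a : ℕ} (ha : a < 18) : σ.mem a = σ.scal a := if_pos ha

theorem mem_arr (σ : St) {j : ℕ} (hj : j < 5) (i : ℕ) : σ.mem (18 + j + 5 * i) = σ.arr j i := by
  rw [mem, if_neg (by omega), show (18 + j + 5 * i - 18) % 5 = j by omega,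
    show (18 + j + 5 * i - 18) / 5 = i by omega]

theorem eq_mem {μ : Mem} {σ : St} (h1 : ∀ a < 18, μ a = σ.scal a)
    (h2 : ∀ j < 5, ∀ i, μ (18 + j + 5 * i) = σ.arr j i) : μ = σ.mem := by
  funext a
  by_cases ha : a < 18
  · rw [h1 a ha, mem_scal σ ha]
  · have h3 : a = 18 + (a - 18) % 5 + 5 * ((a - 18) / 5) := by omega
    rw [h3, h2 _ (Nat.mod_lt _ (by norm_num)), mem_arr σ (Nat.mod_lt _ (by norm_num))]

/-- Scalars and interleaved arrays exhaust all addresses, so nothing is lost in passing from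
memories to states. -/
theorem exists_eq_mem (μ : Mem) : ∃ σ : St, μ = σ.mem := by
  refine ⟨⟨μ 0, μ 1, μ 2, μ 3, μ 4, μ 5, μ 6, μ 7, μ 8,
    μ 9, μ 10, μ 11, μ 12, μ 13, μ 14, μ 15, μ 16, μ 17,
    fun i => μ (18 + 0 + 5 * i), fun i => μ (18 + 1 + 5 * i), fun i => μ (18 + 2 + 5 * i),
    fun i => μ (18 + 3 + 5 * i), fun i => μ (18 + 4 + 5 * i)⟩, eq_mem (fun a ha => ?_) fun j hj i => ?_⟩
  · interval_cases a <;> rfl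
  · interval_cases j <;> rfl

theorem update_scal {σ σ' : St} {a v : ℕ} (h : ∀ b < 18, Function.update σ.scal a v b = σ'.scal b)
    (ha : a < 18) (h' : σ'.arr = σ.arr) : Function.update σ.mem a v = σ'.mem := by
  refine eq_mem (fun b hb => ?_) fun j hj i => ?_
  · rw [← h b hb, Function.update_apply, Function.update_apply, mem_scal σ hb]
  · rw [Function.update_of_ne (by omega), mem_arr σ hj, h']

theorem update_arr {σ σ' : St} {j i v : ℕ} (hj : j < 5) (h : σ'.scal = σ.scal)
    (h' : ∀ j' < 5, σ'.arr j' = Function.update σ.arr j (Function.update (σ.arr j) i v) j') :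
    Function.update σ.mem (18 + j + 5 * i) v = σ'.mem := by
  refine eq_mem (fun b hb => ?_) fun j' hj' i' => ?_
  · rw [Function.update_of_ne (by omega), mem_scal σ hb, h]
  · rw [h' j' hj', Function.update_apply, Function.update_apply, mem_arr σ hj']
    by_cases hjj : j' = j
    · subst hjj
      rw [if_pos rfl, Function.update_apply]
      exact if_congr (by omega) rfl rfl
    · rw [if_neg hjj, if_neg (by omega)]

end St

open St

/-- Address of an array entry. -/
def adr (j : ℕ) (a : Term) : Term := .add (.lit (18 + j)) (.mul (.lit 5) a)

/-- The scalar `nA`. -/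
def vNA : Term := .read (.lit 0)

/-- The scalar `nV`. -/
def vNV : Term := .read (.lit 1)

/-- The scalar `L`. -/
def vL : Term := .read (.lit 2)

/-- The scalar `Y`. -/
def vY : Term := .read (.lit 3)

/-- The scalar `m`. -/
def vM : Term := .read (.lit 4)

/-- The scalar `K`. -/
def vK : Term := .read (.lit 5)

/-- The scalar `E0`. -/
def vE0 : Term := .read (.lit 6)

/-- The scalar `st`. -/
def vSt : Term := .read (.lit 7)

/-- The scalar `Q`. -/
def vQ : Term := .read (.lit 8)

/-- The scalar `e`. -/
def vE : Term := .read (.lit 9)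

/-- The scalar `x`. -/
def vX : Term := .read (.lit 10)

/-- The scalar `s`. -/
def vS : Term := .read (.lit 11)

/-- The scalar `d`. -/
def vD : Term := .read (.lit 12)

/-- The scalar `i`. -/
def vI : Term := .read (.lit 13)

/-- The scalar `c`. -/
def vC : Term := .read (.lit 14)

/-- The scalar `best`. -/
def vBest : Term := .read (.lit 15)

/-- The scalar `bi`. -/
def vBi : Term := .read (.lit 16)

/-- The scalar `t`. -/
def vT : Term := .read (.lit 17)

/-- An entry of the array `inp`. -/
def rInp (a : Term) : Term := .read (adr 0 a)

/-- An entry of the array `V`. -/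
def rV (a : Term) : Term := .read (adr 1 a)

/-- An entry of the array `u`. -/
def rU (a : Term) : Term := .read (adr 2 a)

/-- An entry of the array `w`. -/
def rW (a : Term) : Term := .read (adr 3 a)

/-- An entry of the array `out`. -/
def rOut (a : Term) : Term := .read (adr 4 a)

section Eval

variable (σ : St) (a : Term)

@[simp] theorem eval_vNA : vNA.eval σ.mem = σ.nA := rfl

@[simp] theorem eval_vNV : vNV.eval σ.mem = σ.nV := rfl

@[simp] theorem eval_vL : vL.eval σ.mem = σ.L := rfl

@[simp] theorem eval_vY : vY.eval σ.mem = σ.Y := rfl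

@[simp] theorem eval_vM : vM.eval σ.mem = σ.m := rfl

@[simp] theorem eval_vK : vK.eval σ.mem = σ.K := rfl

@[simp] theorem eval_vE0 : vE0.eval σ.mem = σ.E0 := rfl

@[simp] theorem eval_vSt : vSt.eval σ.mem = σ.st := rfl

@[simp] theorem eval_vQ : vQ.eval σ.mem = σ.Q := rfl

@[simp] theorem eval_vE : vE.eval σ.mem = σ.e := rfl

@[simp] theorem eval_vX : vX.eval σ.mem = σ.x := rfl

@[simp] theorem eval_vS : vS.eval σ.mem = σ.s := rfl

@[simp] theorem eval_vD : vD.eval σ.mem = σ.d := rfl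

@[simp] theorem eval_vC : vC.eval σ.mem = σ.c := rfl

@[simp] theorem eval_vBest : vBest.eval σ.mem = σ.best := rfl

@[simp] theorem eval_vT : vT.eval σ.mem = σ.t := rfl

@[simp] theorem eval_rInp : (rInp a).eval σ.mem = σ.inp (a.eval σ.mem) :=
  σ.mem_arr (j := 0) (by norm_num) _

@[simp] theorem eval_rV : (rV a).eval σ.mem = σ.V (a.eval σ.mem) :=
  σ.mem_arr (j := 1) (by norm_num) _

@[simp] theorem eval_rU : (rU a).eval σ.mem = σ.u (a.eval σ.mem) :=
  σ.mem_arr (j := 2) (by norm_num) _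

@[simp] theorem eval_rW : (rW a).eval σ.mem = σ.w (a.eval σ.mem) :=
  σ.mem_arr (j := 3) (by norm_num) _

@[simp] theorem eval_rOut : (rOut a).eval σ.mem = σ.out (a.eval σ.mem) :=
  σ.mem_arr (j := 4) (by norm_num) _

end Eval

/-! ### Programs specified by relations between states -/

/-- On the states satisfying `pre n` the program `P` runs for a time polynomial in `n` and
establishes the relation `post` between the initial and the final state. -/
def Realizes (P : Prog) (pre : ℕ → St → Prop) (post : St → St → Prop) : Prop :=
  ∃ T, PolyBdd T ∧ ∀ n σ, pre n σ → ∃ σ', Runs P σ.mem (T n) σ'.mem ∧ post σ σ'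

variable {P Q : Prog} {pre pre' : ℕ → St → Prop} {post post' : St → St → Prop}

theorem Realizes.conseq (h : Realizes P pre post) (h' : ∀ n σ σ', pre n σ → post σ σ' → post' σ σ') :
    Realizes P pre post' := by
  obtain ⟨T, hT, h⟩ := h
  refine ⟨T, hT, fun n σ hσ => ?_⟩
  obtain ⟨σ', h1, h2⟩ := h n σ hσ
  exact ⟨σ', h1, h' n σ σ' hσ h2⟩

theorem Realizes.restrict (h : Realizes P pre post) (h' : ∀ n σ, pre' n σ → pre n σ) :
    Realizes P pre' post := by
  obtain ⟨T, hT, h⟩ := h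
  exact ⟨T, hT, fun n σ hσ => h n σ (h' n σ hσ)⟩

theorem realizes_skip : Realizes .skip pre fun σ σ' => σ' = σ :=
  ⟨fun _ => 1, .const 1, fun _ σ _ => ⟨σ, runs_skip _, rfl⟩⟩

theorem Realizes.seq (h : Realizes P pre post) (h' : Realizes Q pre' post')
    (hpre : ∀ n σ σ', pre n σ → post σ σ' → pre' n σ') :
    Realizes (.seq P Q) pre fun σ σ'' => ∃ σ', post σ σ' ∧ post' σ' σ'' := by
  obtain ⟨T, hT, h⟩ := h
  obtain ⟨T', hT', h'⟩ := h'
  refine ⟨_, hT.add hT', fun n σ hσ => ?_⟩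
  obtain ⟨σ', h1, h2⟩ := h n σ hσ
  obtain ⟨σ'', h3, h4⟩ := h' n σ' (hpre n σ σ' hσ h2)
  exact ⟨σ'', h1.seq h3, σ', h2, h4⟩

theorem Realizes.cond (t : Term) (h : Realizes P (fun n σ => pre n σ ∧ t.eval σ.mem ≠ 0) post)
    (h' : Realizes Q (fun n σ => pre n σ ∧ t.eval σ.mem = 0) post') :
    Realizes (.cond t P Q) pre fun σ σ' =>
      (t.eval σ.mem ≠ 0 → post σ σ') ∧ (t.eval σ.mem = 0 → post' σ σ') := by
  obtain ⟨T, hT, h⟩ := h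
  obtain ⟨T', hT', h'⟩ := h'
  refine ⟨_, (PolyBdd.const (t.cw + 1)).add (hT.add hT'), fun n σ hσ => ?_⟩
  by_cases ht : t.eval σ.mem = 0
  · obtain ⟨σ', h1, h2⟩ := h' n σ ⟨hσ, ht⟩
    exact ⟨σ', (h1.condFalse ht).mono (by omega), fun h => absurd ht h, fun _ => h2⟩
  · obtain ⟨σ', h1, h2⟩ := h n σ ⟨hσ, ht⟩
    exact ⟨σ', (h1.condTrue ht).mono (by omega), fun _ => h2, fun h => absurd h ht⟩

/-- The invariant may mention the initial state, so at the last pass it is itself the specification.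
The bound of `N` by the size parameter keeps the total budget polynomial. -/
theorem Realizes.loop {P₀ : Prog} {post₀ : St → St → Prop} {t : Term} (N : St → ℕ)
    (Inv : St → ℕ → St → Prop)
    (hP₀ : Realizes P₀ pre post₀) (hP : Realizes P pre' post') (hN : ∀ n σ, pre n σ → N σ ≤ n)
    (h0 : ∀ n σ σ', pre n σ → post₀ σ σ' → Inv σ 0 σ')
    (hstep : ∀ n σ₀ k σ, pre n σ₀ → k < N σ₀ → Inv σ₀ k σ →
      t.eval σ.mem ≠ 0 ∧ pre' n σ ∧ ∀ σ', post' σ σ' → Inv σ₀ (k + 1) σ')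
    (hend : ∀ n σ₀ σ, pre n σ₀ → Inv σ₀ (N σ₀) σ → t.eval σ.mem = 0) :
    Realizes (.seq P₀ (.loop t P)) pre fun σ σ' => Inv σ (N σ) σ' := by
  obtain ⟨T₀, hT₀, g⟩ := hP₀
  obtain ⟨T, hT, h⟩ := hP
  refine ⟨_, hT₀.add ((PolyBdd.id.mul ((PolyBdd.const (t.cw + 1)).add hT)).add
    (PolyBdd.const (t.cw + 1))), fun n σ₀ hσ => ?_⟩
  obtain ⟨σ₁, hσ₁, hpost⟩ := g n σ₀ hσ
  obtain ⟨ν, h1, σ', rfl, h2⟩ := runs_loop (t := t) (P := P) (T := T n) (n := N σ₀)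
    (fun k μ => ∃ σ : St, μ = σ.mem ∧ Inv σ₀ k σ)
    (by
      rintro k hk _ ⟨σ, rfl, hσk⟩
      obtain ⟨h1, h2, h3⟩ := hstep n σ₀ k σ hσ hk hσk
      obtain ⟨σ', h4, h5⟩ := h n σ h2
      exact ⟨h1, σ'.mem, h4, σ', rfl, h3 σ' h5⟩)
    (by
      rintro _ ⟨σ, rfl, hσn⟩
      exact hend n σ₀ σ hσ hσn)
    ⟨σ₁, rfl, h0 n σ₀ σ₁ hσ hpost⟩
  exact ⟨σ', hσ₁.seq (h1.mono (Nat.add_le_add_right (Nat.mul_le_mul_right _ (hN n σ₀ hσ)) _)), h2⟩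

theorem realizes_write {a b : Term} {f : St → St}
    (hf : ∀ σ : St, Function.update σ.mem (a.eval σ.mem) (b.eval σ.mem) = (f σ).mem)
    (hb : b.Lin = true) : Realizes (.write a b) pre fun σ σ' => σ' = f σ :=
  ⟨_, .const (writeCost a b), fun _ σ _ => ⟨f σ, hf σ ▸ runs_write σ.mem a b hb, rfl⟩⟩

theorem realizes_write_of_lt {a b : Term} {f : St → St}
    (hf : ∀ σ : St, Function.update σ.mem (a.eval σ.mem) (b.eval σ.mem) = (f σ).mem)
    (hb : ∀ n σ, pre n σ → b.eval σ.mem < 2 ^ n) :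
    Realizes (.write a b) pre fun σ σ' => σ' = f σ :=
  ⟨_, (PolyBdd.const (writeCost a b)).add PolyBdd.id, fun n σ hσ =>
    ⟨f σ, hf σ ▸ runs_write_of_lt σ.mem a b (hb n σ hσ), rfl⟩⟩

section Updates

variable (σ : St) (v i : ℕ)

theorem update_nA : Function.update σ.mem 0 v = ({σ with nA := v} : St).mem :=
  update_scal (fun b hb => by interval_cases b <;> rfl) (by norm_num) rfl

theorem update_nV : Function.update σ.mem 1 v = ({σ with nV := v} : St).mem :=
  update_scal (fun b hb => by interval_cases b <;> rfl) (by norm_num) rfl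

theorem update_L : Function.update σ.mem 2 v = ({σ with L := v} : St).mem :=
  update_scal (fun b hb => by interval_cases b <;> rfl) (by norm_num) rfl

theorem update_Y : Function.update σ.mem 3 v = ({σ with Y := v} : St).mem :=
  update_scal (fun b hb => by interval_cases b <;> rfl) (by norm_num) rfl

theorem update_m : Function.update σ.mem 4 v = ({σ with m := v} : St).mem :=
  update_scal (fun b hb => by interval_cases b <;> rfl) (by norm_num) rfl

theorem update_K : Function.update σ.mem 5 v = ({σ with K := v} : St).mem :=
  update_scal (fun b hb => by interval_cases b <;> rfl) (by norm_num) rfl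

theorem update_E0 : Function.update σ.mem 6 v = ({σ with E0 := v} : St).mem :=
  update_scal (fun b hb => by interval_cases b <;> rfl) (by norm_num) rfl

theorem update_st : Function.update σ.mem 7 v = ({σ with st := v} : St).mem :=
  update_scal (fun b hb => by interval_cases b <;> rfl) (by norm_num) rfl

theorem update_Q : Function.update σ.mem 8 v = ({σ with Q := v} : St).mem :=
  update_scal (fun b hb => by interval_cases b <;> rfl) (by norm_num) rfl

theorem update_e : Function.update σ.mem 9 v = ({σ with e := v} : St).mem :=
  update_scal (fun b hb => by interval_cases b <;> rfl) (by norm_num) rfl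

theorem update_x : Function.update σ.mem 10 v = ({σ with x := v} : St).mem :=
  update_scal (fun b hb => by interval_cases b <;> rfl) (by norm_num) rfl

theorem update_s : Function.update σ.mem 11 v = ({σ with s := v} : St).mem :=
  update_scal (fun b hb => by interval_cases b <;> rfl) (by norm_num) rfl

theorem update_d : Function.update σ.mem 12 v = ({σ with d := v} : St).mem :=
  update_scal (fun b hb => by interval_cases b <;> rfl) (by norm_num) rfl

theorem update_i : Function.update σ.mem 13 v = ({σ with i := v} : St).mem :=
  update_scal (fun b hb => by interval_cases b <;> rfl) (by norm_num) rfl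

theorem update_c : Function.update σ.mem 14 v = ({σ with c := v} : St).mem :=
  update_scal (fun b hb => by interval_cases b <;> rfl) (by norm_num) rfl

theorem update_best : Function.update σ.mem 15 v = ({σ with best := v} : St).mem :=
  update_scal (fun b hb => by interval_cases b <;> rfl) (by norm_num) rfl

theorem update_bi : Function.update σ.mem 16 v = ({σ with bi := v} : St).mem :=
  update_scal (fun b hb => by interval_cases b <;> rfl) (by norm_num) rfl

theorem update_t : Function.update σ.mem 17 v = ({σ with t := v} : St).mem :=
  update_scal (fun b hb => by interval_cases b <;> rfl) (by norm_num) rfl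

theorem update_V : Function.update σ.mem (18 + 1 + 5 * i) v =
    ({σ with V := Function.update σ.V i v} : St).mem :=
  update_arr (by norm_num) rfl (fun j hj => by interval_cases j <;> rfl)

theorem update_u : Function.update σ.mem (18 + 2 + 5 * i) v =
    ({σ with u := Function.update σ.u i v} : St).mem :=
  update_arr (by norm_num) rfl (fun j hj => by interval_cases j <;> rfl)

theorem update_w : Function.update σ.mem (18 + 3 + 5 * i) v =
    ({σ with w := Function.update σ.w i v} : St).mem :=
  update_arr (by norm_num) rfl (fun j hj => by interval_cases j <;> rfl)

theorem update_out : Function.update σ.mem (18 + 4 + 5 * i) v =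
    ({σ with out := Function.update σ.out i v} : St).mem :=
  update_arr (by norm_num) rfl (fun j hj => by interval_cases j <;> rfl)

end Updates

/-- Assignment to `nA`. -/
def setNA (b : Term) : Prog := .write (.lit 0) b

/-- Assignment to `nV`. -/
def setNV (b : Term) : Prog := .write (.lit 1) b

/-- Assignment to `L`. -/
def setL (b : Term) : Prog := .write (.lit 2) b

/-- Assignment to `Y`. -/
def setY (b : Term) : Prog := .write (.lit 3) b

/-- Assignment to `m`. -/
def setM (b : Term) : Prog := .write (.lit 4) b

/-- Assignment to `K`. -/
def setK (b : Term) : Prog := .write (.lit 5) b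

/-- Assignment to `E0`. -/
def setE0 (b : Term) : Prog := .write (.lit 6) b

/-- Assignment to `st`. -/
def setSt (b : Term) : Prog := .write (.lit 7) b

/-- Assignment to `Q`. -/
def setQ (b : Term) : Prog := .write (.lit 8) b

/-- Assignment to `e`. -/
def setE (b : Term) : Prog := .write (.lit 9) b

/-- Assignment to `x`. -/
def setX (b : Term) : Prog := .write (.lit 10) b

/-- Assignment to `s`. -/
def setS (b : Term) : Prog := .write (.lit 11) b

/-- Assignment to `d`. -/
def setD (b : Term) : Prog := .write (.lit 12) b

/-- Assignment to `i`. -/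
def setI (b : Term) : Prog := .write (.lit 13) b

/-- Assignment to `c`. -/
def setC (b : Term) : Prog := .write (.lit 14) b

/-- Assignment to `best`. -/
def setBest (b : Term) : Prog := .write (.lit 15) b

/-- Assignment to `bi`. -/
def setBi (b : Term) : Prog := .write (.lit 16) b

/-- Assignment to `t`. -/
def setT (b : Term) : Prog := .write (.lit 17) b

/-- Assignment to an entry of `V`. -/
def storeV (a b : Term) : Prog := .write (adr 1 a) b

/-- Assignment to an entry of `u`. -/
def storeU (a b : Term) : Prog := .write (adr 2 a) b

/-- Assignment to an entry of `w`. -/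
def storeW (a b : Term) : Prog := .write (adr 3 a) b

/-- Assignment to an entry of `out`. -/
def storeOut (a b : Term) : Prog := .write (adr 4 a) b

theorem realizes_setNA (b : Term) (hb : b.Lin = true := by rfl) :
    Realizes (setNA b) pre fun σ σ' => σ' = { σ with nA := b.eval σ.mem } :=
  realizes_write (fun σ => update_nA σ _) hb

theorem realizes_setNV (b : Term) (hb : b.Lin = true := by rfl) :
    Realizes (setNV b) pre fun σ σ' => σ' = { σ with nV := b.eval σ.mem } :=
  realizes_write (fun σ => update_nV σ _) hb

theorem realizes_setL (b : Term) (hb : b.Lin = true := by rfl) :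
    Realizes (setL b) pre fun σ σ' => σ' = { σ with L := b.eval σ.mem } :=
  realizes_write (fun σ => update_L σ _) hb

theorem realizes_setM (b : Term) (hb : b.Lin = true := by rfl) :
    Realizes (setM b) pre fun σ σ' => σ' = { σ with m := b.eval σ.mem } :=
  realizes_write (fun σ => update_m σ _) hb

theorem realizes_setK (b : Term) (hb : b.Lin = true := by rfl) :
    Realizes (setK b) pre fun σ σ' => σ' = { σ with K := b.eval σ.mem } :=
  realizes_write (fun σ => update_K σ _) hb

theorem realizes_setSt (b : Term) (hb : b.Lin = true := by rfl) :
    Realizes (setSt b) pre fun σ σ' => σ' = { σ with st := b.eval σ.mem } :=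
  realizes_write (fun σ => update_st σ _) hb

theorem realizes_setE (b : Term) (hb : b.Lin = true := by rfl) :
    Realizes (setE b) pre fun σ σ' => σ' = { σ with e := b.eval σ.mem } :=
  realizes_write (fun σ => update_e σ _) hb

theorem realizes_setX (b : Term) (hb : b.Lin = true := by rfl) :
    Realizes (setX b) pre fun σ σ' => σ' = { σ with x := b.eval σ.mem } :=
  realizes_write (fun σ => update_x σ _) hb

theorem realizes_setS (b : Term) (hb : b.Lin = true := by rfl) :
    Realizes (setS b) pre fun σ σ' => σ' = { σ with s := b.eval σ.mem } :=
  realizes_write (fun σ => update_s σ _) hb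

theorem realizes_setD (b : Term) (hb : b.Lin = true := by rfl) :
    Realizes (setD b) pre fun σ σ' => σ' = { σ with d := b.eval σ.mem } :=
  realizes_write (fun σ => update_d σ _) hb

theorem realizes_setI (b : Term) (hb : b.Lin = true := by rfl) :
    Realizes (setI b) pre fun σ σ' => σ' = { σ with i := b.eval σ.mem } :=
  realizes_write (fun σ => update_i σ _) hb

theorem realizes_setC (b : Term) (hb : b.Lin = true := by rfl) :
    Realizes (setC b) pre fun σ σ' => σ' = { σ with c := b.eval σ.mem } :=
  realizes_write (fun σ => update_c σ _) hb

theorem realizes_setBest (b : Term) (hb : b.Lin = true := by rfl) :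
    Realizes (setBest b) pre fun σ σ' => σ' = { σ with best := b.eval σ.mem } :=
  realizes_write (fun σ => update_best σ _) hb

theorem realizes_setBi (b : Term) (hb : b.Lin = true := by rfl) :
    Realizes (setBi b) pre fun σ σ' => σ' = { σ with bi := b.eval σ.mem } :=
  realizes_write (fun σ => update_bi σ _) hb

theorem realizes_setT (b : Term) (hb : b.Lin = true := by rfl) :
    Realizes (setT b) pre fun σ σ' => σ' = { σ with t := b.eval σ.mem } :=
  realizes_write (fun σ => update_t σ _) hb

theorem realizes_storeU (a b : Term) (hb : b.Lin = true := by rfl) :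
    Realizes (storeU a b) pre fun σ σ' =>
    σ' = { σ with u := Function.update σ.u (a.eval σ.mem) (b.eval σ.mem) } :=
  realizes_write (fun σ => update_u σ _ _) hb

theorem realizes_storeW (a b : Term) (hb : b.Lin = true := by rfl) :
    Realizes (storeW a b) pre fun σ σ' =>
    σ' = { σ with w := Function.update σ.w (a.eval σ.mem) (b.eval σ.mem) } :=
  realizes_write (fun σ => update_w σ _ _) hb

theorem realizes_storeOut (a b : Term) (hb : b.Lin = true := by rfl) :
    Realizes (storeOut a b) pre fun σ σ' =>
    σ' = { σ with out := Function.update σ.out (a.eval σ.mem) (b.eval σ.mem) } :=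
  realizes_write (fun σ => update_out σ _ _) hb

end RAM

/-! ### Programs for the covering updates -/

namespace RAM

open Finset Covering

theorem Realizes.then {P Q : Prog} {pre : ℕ → St → Prop} {post post' : St → St → Prop}
    (h : Realizes P pre post) (h' : Realizes Q (fun _ _ => True) post') :
    Realizes (.seq P Q) pre fun σ σ'' => ∃ σ', post σ σ' ∧ post' σ' σ'' :=
  h.seq h' fun _ _ _ _ _ => trivial

/-- Bounds for the dimensions stored in a state. -/
def Bnd (n : ℕ) (σ : St) : Prop := σ.Y ≤ n ∧ σ.m ≤ n ∧ σ.nA ≤ n ∧ σ.nA + σ.m ≤ n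

/-! ### Access to the hyperedges -/

/-- Nonzero if and only if the values agree. -/
def eqT (a b : Term) : Term := .sub (.lit 1) (.add (.sub a b) (.sub b a))

theorem eval_eqT_ne_zero {a b : Term} {μ : Mem} : (eqT a b).eval μ ≠ 0 ↔ a.eval μ = b.eval μ := by
  simp only [eqT, Term.eval]
  omega

/-- Start of the input row of the current hyperedge. -/
def rowT : Term := .add vE0 (.mul vE vSt)

/-- The current vertex without its scenario. -/
def modT : Term := .sub vX (.mul vL (.div vX vL))

/-- Nonzero if and only if the current vertex belongs to the current hyperedge. -/
def memT : Term :=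
  .mul (eqT (.div vX vL) (rInp rowT))
    (.add (eqT modT (rInp (.add rowT (.lit 1))))
      (.mul (.sub (.lit 1) (.sub vNV modT)) (rInp (.add (.add rowT (.lit 4)) (.sub modT vNV)))))

/-- Vehicle of the current hyperedge. -/
def vehT : Term := rInp (.add rowT (.lit 1))

/-- Class of the current hyperedge: its augmented vehicle, or `nA` for the basis vehicles. -/
def clT : Term := .sub vehT (.sub vehT vNA)

/-- Nonzero if and only if the vehicle of the current hyperedge is available. -/
def avT : Term := .add (.sub (.lit 1) (.sub vNA vehT)) (rOut vehT)

namespace St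

variable (σ : St)

/-- Start of the input row of a hyperedge. -/
def row (e : ℕ) : ℕ := σ.E0 + e * σ.st

/-- Membership of a vertex in a hyperedge. -/
def IsMem (e x : ℕ) : Prop :=
  x / σ.L = σ.inp (σ.row e) ∧ (x - σ.L * (x / σ.L) = σ.inp (σ.row e + 1) ∨
    σ.nV ≤ x - σ.L * (x / σ.L) ∧ σ.inp (σ.row e + 4 + (x - σ.L * (x / σ.L) - σ.nV)) ≠ 0)

instance (e : ℕ) : DecidablePred (σ.IsMem e) := fun _ => inferInstanceAs (Decidable (_ ∧ _))

/-- The vertices of a hyperedge. -/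
def edge (e : ℕ) : Finset ℕ := {x ∈ range σ.Y | σ.IsMem e x}

/-- The class of a hyperedge. -/
def cls (e : ℕ) : ℕ := min (σ.inp (σ.row e + 1)) σ.nA

/-- Availability of a hyperedge. -/
def Avail (e : ℕ) : Prop :=
  σ.nA ≤ σ.inp (σ.row e + 1) ∨ σ.out (σ.inp (σ.row e + 1)) ≠ 0

/-- Vertices come in blocks of length `L`, one per scenario, vehicles before requests. The factor
testing `nV ≤ modT` is essential: truncated subtraction would send every vehicle to the first
request bit. -/
theorem eval_memT : memT.eval σ.mem ≠ 0 ↔ σ.IsMem σ.e σ.x := by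
  simp only [memT, Term.eval, ne_eq, mul_eq_zero, not_or, IsMem, Nat.add_eq_zero_iff, not_and_or]
  refine and_congr (eval_eqT_ne_zero.trans (by simp [Term.eval, rowT, row])) (or_congr
    (eval_eqT_ne_zero.trans (by simp [Term.eval, modT, rowT, row])) (and_congr ?_ ?_))
  · simp only [modT, Term.eval, eval_vNV, eval_vX, eval_vL]
    omega
  · simp [Term.eval, modT, rowT, row]

theorem eval_vehT : vehT.eval σ.mem = σ.inp (σ.row σ.e + 1) := by
  simp [vehT, rowT, row, Term.eval]

theorem eval_clT : clT.eval σ.mem = σ.cls σ.e := by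
  simp only [clT, Term.eval, eval_vehT, eval_vNA, cls]
  omega

/-- For a basis vehicle the first summand is 1, so the content of `out` at its index is irrelevant.
-/
theorem eval_avT : avT.eval σ.mem ≠ 0 ↔ σ.Avail σ.e := by
  simp only [avT, Term.eval, eval_vehT, eval_vNA, eval_rOut, Avail]
  omega

end St

/-! ### Sums over a hyperedge and updates on a hyperedge -/

theorem filter_range_succ (p : ℕ → Prop) [DecidablePred p] (k : ℕ) :
    {x ∈ range (k + 1) | p x} =
      if p k then insert k {x ∈ range k | p x} else {x ∈ range k | p x} := by
  rw [Finset.range_add_one, Finset.filter_insert]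

/-- Sum of the weights and number of vertices of the current hyperedge. -/
def sumP : Prog :=
  .seq (.seq (setX (.lit 0)) (.seq (setS (.lit 0)) (setD (.lit 0)))) <| .loop (.sub vY vX) <|
    .seq (.cond memT (.seq (setS (.add vS (rW vX))) (setD (.add vD (.lit 1)))) .skip)
      (setX (.add vX (.lit 1)))

theorem realizes_sumP : Realizes sumP Bnd fun σ σ' =>
    σ' = { σ with x := σ.Y, s := ∑ x ∈ σ.edge σ.e, σ.w x, d := #(σ.edge σ.e) } := by
  refine Realizes.loop (pre' := fun _ _ => True) (fun σ => σ.Y)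
    (fun σ k σ' => σ' = { σ with
      x := k
      s := ∑ x ∈ range k with σ.IsMem σ.e x, σ.w x
      d := #{x ∈ range k | σ.IsMem σ.e x} })
    ((realizes_setX _).then ((realizes_setS _).then (realizes_setD _)))
    ((Realizes.cond memT ((realizes_setS _).then (realizes_setD _)) realizes_skip).then
      (realizes_setX _)) (fun n σ h => h.1) ?_ ?_ ?_
  · rintro n σ _ _ ⟨_, rfl, _, rfl, rfl⟩
    simp [Term.eval]
  · rintro n σ k _ _ hk rfl
    refine ⟨by simp only [Term.eval, eval_vY, eval_vX]; omega, trivial, ?_⟩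
    rintro _ ⟨σ', ⟨h1, h2⟩, rfl⟩
    by_cases h : σ.IsMem σ.e k
    · obtain ⟨_, rfl, rfl⟩ := h1 ((St.eval_memT _).2 h)
      simp only [filter_range_succ, if_pos h]
      rw [Finset.sum_insert (by simp), Finset.card_insert_of_notMem (by simp), add_comm (σ.w k)]
      simp [Term.eval]
    · rw [h2 (not_not.1 (mt (St.eval_memT _).1 h))]
      simp [Term.eval, filter_range_succ, if_neg h]
  · rintro n σ _ _ rfl
    simp [Term.eval]

/-- Double the weights on the current hyperedge and add `d`. -/
def raiseP : Prog :=
  .seq (setX (.lit 0)) <| .loop (.sub vY vX) <|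
    .seq (.cond memT (storeW vX (.add (.add (rW vX) (rW vX)) vD)) .skip) (setX (.add vX (.lit 1)))

theorem realizes_raiseP : Realizes raiseP Bnd fun σ σ' =>
    σ' = { σ with x := σ.Y, w := raise (σ.edge σ.e) σ.d σ.w } := by
  refine Realizes.loop (pre' := fun _ _ => True) (fun σ => σ.Y)
    (fun σ k σ' => σ' = { σ with
      x := k
      w := raise {x ∈ range k | σ.IsMem σ.e x} σ.d σ.w }) (realizes_setX _)
    ((Realizes.cond memT (realizes_storeW _ _) realizes_skip).then
      (realizes_setX _)) (fun n σ h => h.1) ?_ ?_ ?_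
  · rintro n σ _ _ rfl
    simp only [Term.eval, Finset.range_zero, Finset.filter_empty, St.mk.injEq, true_and, and_true]
    funext x
    simp [raise]
  · rintro n σ k _ _ hk rfl
    refine ⟨by simp only [Term.eval, eval_vY, eval_vX]; omega, trivial, ?_⟩
    rintro _ ⟨σ', ⟨h1, h2⟩, rfl⟩
    by_cases h : σ.IsMem σ.e k
    · rw [h1 ((St.eval_memT _).2 h)]
      simp only [filter_range_succ, if_pos h, Term.eval, eval_vX, eval_rW, eval_vD, St.mk.injEq,
        true_and, and_true]
      funext x
      rw [Function.update_apply]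
      unfold raise
      by_cases hx : x = k
      · simp [hx, two_mul]
      · simp [hx]
    · rw [h2 (not_not.1 (mt (St.eval_memT _).1 h))]
      simp [Term.eval, filter_range_succ, if_neg h]
  · rintro n σ _ _ rfl
    simp [Term.eval]

/-- One multiplicative update for the current hyperedge. -/
def stepP : Prog :=
  .seq sumP <| .cond (.sub (rV vE) vS) (.seq (setD (.div (rV vE) (.mul (.lit 8) vD))) raiseP) .skip

/-- The scratch registers are left existential; only `w` matters afterwards. -/
theorem realizes_stepP : Realizes stepP Bnd fun σ σ' => ∃ x s d,
    σ' = { σ with x := x, s := s, d := d, w := step (σ.edge σ.e) (σ.V σ.e) σ.w } := by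
  refine (realizes_sumP.seq (pre' := Bnd) (Realizes.cond _ ((realizes_setD _).seq
    (realizes_raiseP) ?_) realizes_skip) ?_).conseq ?_
  · rintro n σ _ ⟨h, -⟩ rfl
    exact h
  · rintro n σ _ h rfl
    exact h
  · rintro n σ σ'' _ ⟨_, rfl, h1, h2⟩
    by_cases h : ∑ x ∈ σ.edge σ.e, σ.w x < σ.V σ.e
    · obtain ⟨_, rfl, rfl⟩ := h1 (by simp only [Term.eval, eval_rV, eval_vE, eval_vS]; omega)
      refine ⟨σ.Y, ∑ x ∈ σ.edge σ.e, σ.w x, σ.V σ.e / (8 * #(σ.edge σ.e)), ?_⟩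
      rw [step, if_pos h]
      simp only [Term.eval, eval_rV, eval_vE, eval_vD]
      rfl
    · rw [h2 (by simp only [Term.eval, eval_rV, eval_vE, eval_vS]; omega)]
      refine ⟨σ.Y, ∑ x ∈ σ.edge σ.e, σ.w x, #(σ.edge σ.e), ?_⟩
      rw [step, if_neg h]

/-- Process all hyperedges of class `i`. -/
def sweepP : Prog :=
  .seq (setE (.lit 0)) <| .loop (.sub vM vE) <|
    .seq (.cond (eqT clT vI)
      (.seq stepP <| .seq stepP <| .seq stepP <| .seq stepP stepP) .skip) (setE (.add vE (.lit 1)))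

theorem realizes_sweepP : Realizes sweepP Bnd fun σ σ' => ∃ x s d,
    σ' = { σ with
      e := σ.m, x := x, s := s, d := d, w := sweep σ.edge σ.V σ.cls σ.i σ.m σ.w } := by
  have h5 : Realizes (.seq stepP <| .seq stepP <| .seq stepP <| .seq stepP stepP) Bnd
      fun σ σ' => ∃ x s d,
        σ' = { σ with x := x, s := s, d := d, w := (step (σ.edge σ.e) (σ.V σ.e))^[5] σ.w } := by
    refine (realizes_stepP.seq (realizes_stepP.seq (realizes_stepP.seq (realizes_stepP.seq
      realizes_stepP ?_) ?_) ?_) ?_).conseq ?_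
    · rintro n σ _ h ⟨_, _, _, rfl⟩
      exact h
    · rintro n σ _ h ⟨_, _, _, rfl⟩
      exact h
    · rintro n σ _ h ⟨_, _, _, rfl⟩
      exact h
    · rintro n σ _ h ⟨_, _, _, rfl⟩
      exact h
    · rintro n σ _ _ ⟨_, ⟨_, _, _, rfl⟩, _, ⟨_, _, _, rfl⟩, _, ⟨_, _, _, rfl⟩, _, ⟨_, _, _, rfl⟩,
        x, s, d, rfl⟩
      exact ⟨x, s, d, rfl⟩
  refine Realizes.loop (pre' := Bnd) (fun σ => σ.m)
    (fun σ k σ' => ∃ x s d, σ' = { σ with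
      e := k, x := x, s := s, d := d, w := sweep σ.edge σ.V σ.cls σ.i k σ.w }) (realizes_setE _)
    ((Realizes.cond (eqT clT vI) (h5.restrict fun _ _ h => h.1) realizes_skip).then
      (realizes_setE _)) (fun n σ h => h.2.1) ?_ ?_ ?_
  · rintro n σ _ _ rfl
    exact ⟨_, _, _, rfl⟩
  · rintro n σ k _ hb hk ⟨x, s, d, rfl⟩
    refine ⟨by simp only [Term.eval, eval_vM, eval_vE]; omega, hb, ?_⟩
    rintro _ ⟨σ', ⟨h1, h2⟩, rfl⟩
    by_cases h : σ.cls k = σ.i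
    · obtain ⟨x', s', d', rfl⟩ := h1 (eval_eqT_ne_zero.2 ((St.eval_clT _).trans h))
      refine ⟨x', s', d', ?_⟩
      rw [sweep, if_pos h]
      rfl
    · rw [h2 (not_not.1 fun h' => h ((St.eval_clT _).symm.trans (eval_eqT_ne_zero.1 h')))]
      refine ⟨x, s, d, ?_⟩
      rw [sweep, if_neg h]
      rfl
  · rintro n σ _ _ ⟨_, _, _, rfl⟩
    simp [Term.eval]

end RAM

/-! ### Programs for the greedy selection -/

namespace RAM

open Finset Covering

/-- The two states contain the same instance. -/
structure Static (σ σ' : St) : Prop where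
  nA : σ'.nA = σ.nA
  nV : σ'.nV = σ.nV
  L : σ'.L = σ.L
  Y : σ'.Y = σ.Y
  m : σ'.m = σ.m
  K : σ'.K = σ.K
  E0 : σ'.E0 = σ.E0
  st : σ'.st = σ.st
  inp : σ'.inp = σ.inp
  V : σ'.V = σ.V

namespace Static

variable {σ σ' σ'' : St} {n : ℕ}

theorem trans (h : Static σ σ') (h' : Static σ' σ'') : Static σ σ'' := by
  constructor
  exacts [h'.nA.trans h.nA, h'.nV.trans h.nV, h'.L.trans h.L, h'.Y.trans h.Y, h'.m.trans h.m,
    h'.K.trans h.K, h'.E0.trans h.E0, h'.st.trans h.st, h'.inp.trans h.inp, h'.V.trans h.V]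

theorem bnd (h : Static σ σ') (hb : Bnd n σ) : Bnd n σ' := by
  unfold Bnd
  rwa [h.Y, h.m, h.nA]

theorem row (h : Static σ σ') (e : ℕ) : σ'.row e = σ.row e := by
  rw [St.row, St.row, h.E0, h.st]

theorem isMem (h : Static σ σ') (e x : ℕ) : σ'.IsMem e x ↔ σ.IsMem e x := by
  rw [St.IsMem, St.IsMem, h.row, h.inp, h.L, h.nV]

theorem edge (h : Static σ σ') : σ'.edge = σ.edge := by
  funext e
  ext x
  simp only [St.edge, Finset.mem_filter, h.Y, h.isMem]

theorem cls (h : Static σ σ') : σ'.cls = σ.cls := by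
  funext e
  rw [St.cls, St.cls, h.row, h.inp, h.nA]

end Static

theorem St.edge_subset (σ : St) (e : ℕ) : σ.edge e ⊆ range σ.Y := Finset.filter_subset _ _

/-! ### Copying, clearing and summing arrays -/

/-- Copy `u` to `w`. -/
def copyP : Prog :=
  .seq (setX (.lit 0)) <| .loop (.sub vY vX) <| .seq (storeW vX (rU vX)) (setX (.add vX (.lit 1)))

theorem realizes_copyP : Realizes copyP Bnd fun σ σ' => ∃ w : ℕ → ℕ, (∀ x < σ.Y, w x = σ.u x) ∧
    σ' = { σ with x := σ.Y, w := w } := by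
  refine Realizes.loop (pre' := fun _ _ => True) (fun σ => σ.Y)
    (fun σ k σ' => ∃ w : ℕ → ℕ, (∀ x < k, w x = σ.u x) ∧ σ' = { σ with x := k, w := w })
    (realizes_setX _) ((realizes_storeW _ _).then (realizes_setX _)) (fun n σ h => h.1) ?_ ?_ ?_
  · rintro n σ _ _ rfl
    exact ⟨σ.w, by simp, rfl⟩
  · rintro n σ k _ _ hk ⟨w, hw, rfl⟩
    refine ⟨by simp only [Term.eval, eval_vY, eval_vX]; omega, trivial, ?_⟩
    rintro _ ⟨_, rfl, rfl⟩
    refine ⟨Function.update w k (σ.u k), fun x hx => ?_, by simp [Term.eval]⟩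
    rw [Function.update_apply]
    split_ifs with h
    · rw [h]
    · exact hw x (by omega)
  · rintro n σ _ _ ⟨w, _, rfl⟩
    simp [Term.eval]

/-- Copy `w` to `u`. -/
def commitP : Prog :=
  .seq (setX (.lit 0)) <| .loop (.sub vY vX) <| .seq (storeU vX (rW vX)) (setX (.add vX (.lit 1)))

theorem realizes_commitP : Realizes commitP Bnd fun σ σ' => ∃ u : ℕ → ℕ,
    (∀ x < σ.Y, u x = σ.w x) ∧ σ' = { σ with x := σ.Y, u := u } := by
  refine Realizes.loop (pre' := fun _ _ => True) (fun σ => σ.Y)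
    (fun σ k σ' => ∃ u : ℕ → ℕ, (∀ x < k, u x = σ.w x) ∧ σ' = { σ with x := k, u := u })
    (realizes_setX _) ((realizes_storeU _ _).then (realizes_setX _)) (fun n σ h => h.1) ?_ ?_ ?_
  · rintro n σ _ _ rfl
    exact ⟨σ.u, by simp, rfl⟩
  · rintro n σ k _ _ hk ⟨u, hu, rfl⟩
    refine ⟨by simp only [Term.eval, eval_vY, eval_vX]; omega, trivial, ?_⟩
    rintro _ ⟨_, rfl, rfl⟩
    refine ⟨Function.update u k (σ.w k), fun x hx => ?_, by simp [Term.eval]⟩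
    rw [Function.update_apply]
    split_ifs with h
    · rw [h]
    · exact hu x (by omega)
  · rintro n σ _ _ ⟨u, _, rfl⟩
    simp [Term.eval]

/-- Clear `w`. -/
def clearP : Prog :=
  .seq (setX (.lit 0)) <| .loop (.sub vY vX) <| .seq (storeW vX (.lit 0)) (setX (.add vX (.lit 1)))

theorem realizes_clearP : Realizes clearP Bnd fun σ σ' => ∃ w : ℕ → ℕ, (∀ x < σ.Y, w x = 0) ∧
    σ' = { σ with x := σ.Y, w := w } := by
  refine Realizes.loop (pre' := fun _ _ => True) (fun σ => σ.Y)
    (fun σ k σ' => ∃ w : ℕ → ℕ, (∀ x < k, w x = 0) ∧ σ' = { σ with x := k, w := w })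
    (realizes_setX _) ((realizes_storeW _ _).then (realizes_setX _)) (fun n σ h => h.1) ?_ ?_ ?_
  · rintro n σ _ _ rfl
    exact ⟨σ.w, by simp, rfl⟩
  · rintro n σ k _ _ hk ⟨w, hw, rfl⟩
    refine ⟨by simp only [Term.eval, eval_vY, eval_vX]; omega, trivial, ?_⟩
    rintro _ ⟨_, rfl, rfl⟩
    refine ⟨Function.update w k 0, fun x hx => ?_, by simp [Term.eval]⟩
    rw [Function.update_apply]
    split_ifs with h
    · rfl
    · exact hw x (by omega)
  · rintro n σ _ _ ⟨w, _, rfl⟩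
    simp [Term.eval]

/-- Clear `out`. -/
def clearOutP : Prog :=
  .seq (setX (.lit 0)) <| .loop (.sub (.add vNA vM) vX) <|
    .seq (storeOut vX (.lit 0)) (setX (.add vX (.lit 1)))

theorem realizes_clearOutP : Realizes clearOutP Bnd fun σ σ' => ∃ out : ℕ → ℕ,
    (∀ x < σ.nA + σ.m, out x = 0) ∧ σ' = { σ with x := σ.nA + σ.m, out := out } := by
  refine Realizes.loop (pre' := fun _ _ => True) (fun σ => σ.nA + σ.m)
    (fun σ k σ' => ∃ out : ℕ → ℕ, (∀ x < k, out x = 0) ∧ σ' = { σ with x := k, out := out })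
    (realizes_setX _) ((realizes_storeOut _ _).then (realizes_setX _)) (fun n σ h => h.2.2.2)
    ?_ ?_ ?_
  · rintro n σ _ _ rfl
    exact ⟨σ.out, by simp, rfl⟩
  · rintro n σ k _ _ hk ⟨out, hout, rfl⟩
    refine ⟨by simp only [Term.eval, eval_vNA, eval_vM, eval_vX]; omega, trivial, ?_⟩
    rintro _ ⟨_, rfl, rfl⟩
    refine ⟨Function.update out k 0, fun x hx => ?_, by simp [Term.eval]⟩
    rw [Function.update_apply]
    split_ifs with h
    · rfl
    · exact hout x (by omega)
  · rintro n σ _ _ ⟨out, _, rfl⟩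
    simp [Term.eval]

/-- Sum of the array `w`. -/
def totP : Prog :=
  .seq (.seq (setX (.lit 0)) (setS (.lit 0))) <| .loop (.sub vY vX) <|
    .seq (setS (.add vS (rW vX))) (setX (.add vX (.lit 1)))

theorem realizes_totP : Realizes totP Bnd fun σ σ' =>
    σ' = { σ with x := σ.Y, s := ∑ x ∈ range σ.Y, σ.w x } := by
  refine Realizes.loop (pre' := fun _ _ => True) (fun σ => σ.Y)
    (fun σ k σ' => σ' = { σ with x := k, s := ∑ x ∈ range k, σ.w x })
    ((realizes_setX _).then (realizes_setS _)) ((realizes_setS _).then (realizes_setX _))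
    (fun n σ h => h.1) ?_ ?_ ?_
  · rintro n σ _ _ ⟨_, rfl, rfl⟩
    simp [Term.eval]
  · rintro n σ k _ _ hk rfl
    refine ⟨by simp only [Term.eval, eval_vY, eval_vX]; omega, trivial, ?_⟩
    rintro _ ⟨_, rfl, rfl⟩
    simp [Term.eval, Finset.sum_range_succ]
  · rintro n σ _ _ rfl
    simp [Term.eval]

/-! ### The greedy selection -/

/-- The cover after adding the hyperedges of class `c`. -/
def St.trial (σ : St) (c : ℕ) : ℕ → ℕ := sweep σ.edge σ.V σ.cls c σ.m σ.u

theorem Static.trial {σ σ' : St} (h : Static σ σ') (hu : σ'.u = σ.u) : σ'.trial = σ.trial := by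
  funext c
  rw [St.trial, St.trial, h.edge, h.V, h.cls, h.m, hu]

/-- Compute in `w` the cover after adding the hyperedges of class `i`. -/
def tryP : Prog := .seq copyP sweepP

theorem realizes_tryP : Realizes tryP Bnd fun σ σ' => ∃ e x s d w,
    (∀ x < σ.Y, w x = σ.trial σ.i x) ∧ σ' = { σ with e := e, x := x, s := s, d := d, w := w } := by
  refine (realizes_copyP.seq realizes_sweepP ?_).conseq ?_
  · rintro n σ _ hb ⟨w, _, rfl⟩
    exact hb
  · rintro n σ _ _ ⟨_, ⟨w, hw, rfl⟩, x, s, d, rfl⟩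
    exact ⟨σ.m, x, s, d, _, sweep_congr σ.edge_subset _ _ hw, rfl⟩

/-- Compute in `bi` the class with the most expensive cover. -/
def bestP : Prog :=
  .seq (.seq (setC (.lit 0)) (.seq (setBest (.lit 0)) (setBi (.lit 0)))) <| .loop (.sub vNA vC) <|
    .seq (setI vC) <| .seq tryP <| .seq totP <|
      .seq (.cond (.sub vS vBest) (.seq (setBest vS) (setBi vC)) .skip) (setC (.add vC (.lit 1)))

theorem realizes_bestP : Realizes bestP Bnd fun σ σ' =>
    Static σ σ' ∧ σ'.u = σ.u ∧ σ'.out = σ.out ∧ σ'.t = σ.t ∧ (σ.nA ≠ 0 → σ'.bi < σ.nA) ∧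
      ∀ c < σ.nA, ∑ x ∈ range σ.Y, σ.trial c x ≤ ∑ x ∈ range σ.Y, σ.trial σ'.bi x := by
  refine Realizes.conseq (Realizes.loop (pre' := Bnd) (fun σ => σ.nA)
    (fun σ k σ' => Static σ σ' ∧ σ'.u = σ.u ∧ σ'.out = σ.out ∧ σ'.t = σ.t ∧
      (σ.nA ≠ 0 → σ'.bi < σ.nA) ∧ σ'.c = k ∧ σ'.best ≤ ∑ x ∈ range σ.Y, σ.trial σ'.bi x ∧
        ∀ c < k, ∑ x ∈ range σ.Y, σ.trial c x ≤ σ'.best)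
    ((realizes_setC _).then ((realizes_setBest _).then (realizes_setBi _)))
    ((realizes_setI _).seq (realizes_tryP.seq (realizes_totP.then
      ((Realizes.cond (.sub vS vBest) ((realizes_setBest _).then (realizes_setBi _))
        realizes_skip).then (realizes_setC _))) ?_) ?_) (fun n σ h => h.2.2.1) ?_ ?_ ?_) ?_
  · rintro n σ _ hb ⟨_, _, _, _, _, _, rfl⟩
    exact hb
  · rintro n σ _ hb rfl
    exact hb
  · rintro n σ _ _ ⟨_, rfl, _, rfl, rfl⟩
    -- Initially `best` is 0 and `bi` is class 0, whose trial cost may be positive; therefore the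
    -- invariant asserts only an inequality between them.
    exact ⟨by constructor <;> rfl, rfl, rfl, rfl, Nat.pos_of_ne_zero, rfl, Nat.zero_le _, by simp⟩
  · rintro n σ k τ hb hk ⟨hS, hu, hout, ht, hbi, hc, hbest, hmax⟩
    refine ⟨by simp only [Term.eval, eval_vNA, eval_vC, hS.nA, hc]; omega, hS.bnd hb, ?_⟩
    rintro _ ⟨_, rfl, _, ⟨e, x, s, d, w, hw, rfl⟩, _, rfl, ρ, ⟨h1, h2⟩, rfl⟩
    have hsum : ∑ x ∈ range τ.Y, w x = ∑ x ∈ range σ.Y, σ.trial k x := by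
      rw [hS.Y]
      refine Finset.sum_congr rfl fun x hx => ?_
      rw [hw x (by simpa [hS.Y] using hx), ← hS.trial hu, ← hc]
      rfl
    by_cases hlt : τ.best < ∑ x ∈ range τ.Y, w x
    · obtain ⟨_, rfl, rfl⟩ := h1 (by simp only [Term.eval, eval_vS, eval_vBest]; omega)
      refine ⟨hS.trans (by constructor <;> rfl), hu, hout, ht, fun _ => ?_, ?_, ?_, ?_⟩
      · simpa [Term.eval, hc] using hk
      · simp [Term.eval, hc]
      · simp only [eval_vS, eval_vC, hc, hsum, le_refl]
      · intro c hck
        simp only [eval_vS]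
        rcases Nat.lt_succ_iff_lt_or_eq.1 hck with h | rfl
        · exact (hmax c h).trans hlt.le
        · exact hsum.ge
    · rw [h2 (by simp only [Term.eval, eval_vS, eval_vBest]; omega)]
      refine ⟨hS.trans (by constructor <;> rfl), hu, hout, ht, hbi, ?_, hbest, ?_⟩
      · simp [Term.eval, hc]
      · intro c hck
        rcases Nat.lt_succ_iff_lt_or_eq.1 hck with h | rfl
        · exact hmax c h
        · exact hsum.symm.trans_le (not_lt.1 hlt)
  · rintro n σ τ _ ⟨hS, _, _, _, _, hc, _⟩
    simp [Term.eval, hS.nA, hc]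
  · rintro n σ τ _ ⟨hS, hu, hout, ht, hbi, _, hbest, hmax⟩
    exact ⟨hS, hu, hout, ht, hbi, fun c hc => (hmax c hc).trans hbest⟩

/-- One round of the greedy selection. -/
def roundP : Prog :=
  .seq bestP <| .seq (setI vBi) <| .seq tryP <| .seq commitP (storeOut vBi (.lit 1))

theorem realizes_roundP : Realizes roundP Bnd fun σ σ' =>
    Static σ σ' ∧ σ'.t = σ.t ∧ ∃ c, (σ.nA ≠ 0 → c < σ.nA) ∧
      (∀ c' < σ.nA, ∑ x ∈ range σ.Y, σ.trial c' x ≤ ∑ x ∈ range σ.Y, σ.trial c x) ∧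
      (∀ x < σ.Y, σ'.u x = σ.trial c x) ∧ σ'.out = Function.update σ.out c 1 := by
  refine (realizes_bestP.seq ((realizes_setI (pre := Bnd) _).seq (realizes_tryP.seq (realizes_commitP.then
    (realizes_storeOut _ _)) ?_) ?_) ?_).conseq ?_
  · rintro n σ _ hb ⟨_, _, _, _, _, _, rfl⟩
    exact hb
  · rintro n σ _ hb rfl
    exact hb
  · rintro n σ τ hb ⟨hS, _⟩
    exact hS.bnd hb
  · rintro n σ _ _ ⟨τ, ⟨hS, hu, hout, ht, hbi, hmax⟩, _, rfl, _, ⟨e, x, s, d, w, hw, rfl⟩, _,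
      ⟨u, hu', rfl⟩, rfl⟩
    refine ⟨hS.trans (by constructor <;> rfl), ht, τ.bi, hbi, hmax, fun x hx => ?_, ?_⟩
    · have hx' : x < τ.Y := by rwa [hS.Y]
      rw [← hS.trial hu]
      exact (hu' x hx').trans (hw x hx')
    · rw [← hout]
      rfl

/-- The greedy selection of the augmented vehicles. -/
def greedyP : Prog :=
  .seq (.seq clearP <| .seq commitP <| .seq clearOutP <| .seq (setI vNA) <| .seq tryP <|
    .seq commitP (setT (.lit 0))) <|
  .loop (.sub (.sub vK (.sub vK vNA)) vT) <| .seq roundP (setT (.add vT (.lit 1)))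

/-- The loop test is min(K, nA) - t in truncated arithmetic. The minimum matters for the running
time, since the budget `K` may be exponential in its bit length. -/
theorem realizes_greedyP : Realizes greedyP Bnd fun σ σ' => Static σ σ' ∧
    ∃ S, GreedyRun σ.edge σ.V σ.cls σ.m σ.Y σ.nA (min σ.K σ.nA) σ'.u S ∧
      ∀ j < σ.nA + σ.m, σ'.out j ≠ 0 ↔ j ∈ S := by
  refine Realizes.conseq (Realizes.loop (pre' := Bnd) (fun σ => min σ.K σ.nA)
    (fun σ k σ' => Static σ σ' ∧ σ'.t = k ∧
      ∃ S, GreedyRun σ.edge σ.V σ.cls σ.m σ.Y σ.nA k σ'.u S ∧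
        ∀ j < σ.nA + σ.m, σ'.out j ≠ 0 ↔ j ∈ S)
    (realizes_clearP.seq (realizes_commitP.seq (realizes_clearOutP.seq ((realizes_setI (pre := Bnd) _).seq
      (realizes_tryP.seq (realizes_commitP.then (realizes_setT _)) ?_) ?_) ?_) ?_) ?_)
    (realizes_roundP.then (realizes_setT _)) (fun n σ h => (min_le_right _ _).trans h.2.2.1)
    ?_ ?_ ?_) ?_
  · rintro n σ _ hb ⟨_, _, _, _, _, _, rfl⟩
    exact hb
  · rintro n σ _ hb rfl
    exact hb
  · rintro n σ _ hb ⟨_, _, rfl⟩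
    exact hb
  · rintro n σ _ hb ⟨_, _, rfl⟩
    exact hb
  · rintro n σ _ hb ⟨_, _, rfl⟩
    exact hb
  · rintro n σ _ _ ⟨_, ⟨w, hw, rfl⟩, _, ⟨u, hu, rfl⟩, _, ⟨out, hout, rfl⟩, _, rfl, _,
      ⟨e, x, s, d, w', hw', rfl⟩, _, ⟨u', hu', rfl⟩, rfl⟩
    refine ⟨by constructor <;> rfl, rfl, ∅, .init (u := u) (fun x hx => (hu x hx).trans (hw x hx))
      fun x hx => (hu' x hx).trans (hw' x hx), fun j hj => ?_⟩
    have h := hout j hj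
    simp [h]
  · rintro n σ k τ hb hk ⟨hS, ht, S, hrun, hout⟩
    refine ⟨?_, hS.bnd hb, ?_⟩
    · simp only [Term.eval, eval_vK, eval_vNA, eval_vT, hS.K, hS.nA, ht]
      omega
    rintro _ ⟨ρ, ⟨hS', ht', c, hc, hmax, hu, ho⟩, rfl⟩
    have htry : τ.trial = fun c => sweep σ.edge σ.V σ.cls c σ.m τ.u := by
      funext c
      rw [St.trial, hS.edge, hS.V, hS.cls, hS.m]
    rw [hS.nA] at hc
    simp only [htry, hS.nA, hS.Y] at hmax hu
    refine ⟨(hS.trans hS').trans (by constructor <;> rfl), ?_, insert c S,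
      .next hrun (hc (by omega)) hmax hu, fun j hj => ?_⟩
    · simp [Term.eval, ht', ht]
    · have h := hout j hj
      simp only [ho, Function.update_apply, Finset.mem_insert]
      by_cases hjc : j = c
      · simp [hjc]
      · simpa [hjc] using h
  · rintro n σ τ _ ⟨hS, ht, _⟩
    simp only [Term.eval, eval_vK, eval_vNA, eval_vT, hS.K, hS.nA, ht]
    omega
  · rintro n σ τ _ ⟨hS, _, h⟩
    exact ⟨hS, h⟩

end RAM

namespace RAM

open Finset Covering

/-! ### The greedy matching -/

/-- Compute in `bi` the most valuable available hyperedge disjoint from the chosen ones, and in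
`best` its value. -/
def pickP : Prog :=
  .seq (.seq (setBest (.lit 0)) (.seq (setBi (.lit 0)) (setE (.lit 0)))) <|
  .loop (.sub vM vE) <|
    .seq (.cond avT
      (.seq sumP <| .cond vS .skip <|
        .cond (.sub (rV vE) vBest) (.seq (setBest (rV vE)) (setBi vE)) .skip) .skip)
      (setE (.add vE (.lit 1)))

theorem St.avail_congr {σ σ' : St} (h : Static σ σ') (hout : σ'.out = σ.out) (e : ℕ) :
    σ'.Avail e ↔ σ.Avail e := by
  rw [St.Avail, St.Avail, h.row, h.inp, h.nA, hout]

/-- For positive values, `best = 0` says that no candidate is left; `bi` is then meaningless. -/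
theorem realizes_pickP : Realizes pickP Bnd fun σ σ' =>
    Static σ σ' ∧ σ'.w = σ.w ∧ σ'.out = σ.out ∧ σ'.t = σ.t ∧
      (σ'.best = 0 ∨ σ'.bi < σ.m ∧ σ.Avail σ'.bi ∧ ∑ x ∈ σ.edge σ'.bi, σ.w x = 0 ∧
        σ'.best = σ.V σ'.bi) ∧
      ∀ f < σ.m, σ.Avail f → ∑ x ∈ σ.edge f, σ.w x = 0 → σ.V f ≤ σ'.best := by
  refine Realizes.conseq (Realizes.loop (pre' := Bnd) (fun σ => σ.m)
    (fun σ k σ' => Static σ σ' ∧ σ'.w = σ.w ∧ σ'.out = σ.out ∧ σ'.t = σ.t ∧ σ'.e = k ∧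
      (σ'.best = 0 ∨ σ'.bi < σ.m ∧ σ.Avail σ'.bi ∧ ∑ x ∈ σ.edge σ'.bi, σ.w x = 0 ∧
        σ'.best = σ.V σ'.bi) ∧
      ∀ f < k, σ.Avail f → ∑ x ∈ σ.edge f, σ.w x = 0 → σ.V f ≤ σ'.best)
    ((realizes_setBest _).then ((realizes_setBi _).then (realizes_setE _)))
    ((Realizes.cond avT ((realizes_sumP.restrict fun _ _ h => h.1).then (Realizes.cond vS
      realizes_skip (Realizes.cond (.sub (rV vE) vBest)
        ((realizes_setBest _).then (realizes_setBi _)) realizes_skip)))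
      realizes_skip).then (realizes_setE _)) (fun n σ h => h.2.1) ?_ ?_ ?_) ?_
  · rintro n σ _ _ ⟨_, rfl, _, rfl, rfl⟩
    exact ⟨by constructor <;> rfl, rfl, rfl, rfl, rfl, Or.inl rfl, by simp⟩
  · rintro n σ k τ hb hk ⟨hS, hw, hout, ht, he, hbest, hmax⟩
    refine ⟨by simp only [Term.eval, eval_vM, eval_vE, hS.m, he]; omega, hS.bnd hb, ?_⟩
    rintro _ ⟨ρ, ⟨h1, h2⟩, rfl⟩
    have hav : τ.Avail τ.e ↔ σ.Avail k := by rw [St.avail_congr hS hout, he]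
    have hsum : ∑ x ∈ τ.edge τ.e, τ.w x = ∑ x ∈ σ.edge k, σ.w x := by rw [hS.edge, hw, he]
    by_cases h : σ.Avail k
    · obtain ⟨_, rfl, h3, h4⟩ := h1 (τ.eval_avT.2 (hav.2 h))
      by_cases h0 : ∑ x ∈ σ.edge k, σ.w x = 0
      · obtain ⟨h5, h6⟩ := h4 (hsum.trans h0)
        clear h1 h2 h3 h4
        by_cases hlt : τ.best < τ.V τ.e
        · obtain ⟨_, rfl, rfl⟩ := h5 (by
            simp only [Term.eval, eval_rV, eval_vE, eval_vBest]; omega)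
          have hV : τ.V τ.e = σ.V k := by rw [hS.V, he]
          refine ⟨hS.trans (by constructor <;> rfl), hw, hout, ht, ?_, Or.inr ?_, ?_⟩
          · simp [Term.eval, he]
          · simp only [eval_rV, eval_vE, he, hS.V]
            exact ⟨hk, h, h0, trivial⟩
          · intro f hf hfa hf0
            simp only [eval_rV, eval_vE]
            rcases Nat.lt_succ_iff_lt_or_eq.1 hf with h' | rfl
            · exact (hmax f h' hfa hf0).trans hlt.le
            · exact hV.ge
        · rw [h6 (by simp only [Term.eval, eval_rV, eval_vE, eval_vBest]; omega)]
          refine ⟨hS.trans (by constructor <;> rfl), hw, hout, ht, ?_, hbest, ?_⟩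
          · simp [Term.eval, he]
          · intro f hf hfa hf0
            rcases Nat.lt_succ_iff_lt_or_eq.1 hf with h' | rfl
            · exact hmax f h' hfa hf0
            · rw [hS.V, he] at hlt
              exact not_lt.1 hlt
      · rw [h3 fun h' => h0 (hsum.symm.trans h')]
        refine ⟨hS.trans (by constructor <;> rfl), hw, hout, ht, ?_, hbest, ?_⟩
        · simp [Term.eval, he]
        · intro f hf hfa hf0
          rcases Nat.lt_succ_iff_lt_or_eq.1 hf with h' | rfl
          · exact hmax f h' hfa hf0
          · exact absurd hf0 h0
    · rw [h2 (not_not.1 fun h' => h (hav.1 (τ.eval_avT.1 h')))]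
      refine ⟨hS.trans (by constructor <;> rfl), hw, hout, ht, ?_, hbest, ?_⟩
      · simp [Term.eval, he]
      · intro f hf hfa hf0
        rcases Nat.lt_succ_iff_lt_or_eq.1 hf with h' | rfl
        · exact hmax f h' hfa hf0
        · exact absurd hfa h
  · rintro n σ τ _ ⟨hS, _, _, _, he, _⟩
    simp [Term.eval, hS.m, he]
  · rintro n σ τ _ ⟨hS, hw, hout, ht, _, hbest, hmax⟩
    exact ⟨hS, hw, hout, ht, hbest, hmax⟩

/-- Choose the hyperedge `bi` with the value `best`. -/
def chooseP : Prog :=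
  .seq (setE vBi) <| .seq (setD vBest) <| .seq raiseP (storeOut (.add vNA vBi) (.lit 1))

theorem realizes_chooseP : Realizes chooseP Bnd fun σ σ' => Static σ σ' ∧ σ'.t = σ.t ∧
    σ'.w = raise (σ.edge σ.bi) σ.best σ.w ∧ σ'.out = Function.update σ.out (σ.nA + σ.bi) 1 := by
  refine ((realizes_setE (pre := Bnd) _).seq ((realizes_setD (pre := Bnd) _).seq
    (realizes_raiseP.then (realizes_storeOut _ _)) ?_) ?_).conseq ?_
  · rintro n σ _ hb rfl
    exact hb
  · rintro n σ _ hb rfl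
    exact hb
  · rintro n σ _ _ ⟨_, rfl, _, rfl, _, rfl, rfl⟩
    exact ⟨by constructor <;> rfl, rfl, rfl, rfl⟩

/-- The greedy matching among the available hyperedges. -/
def matchP : Prog :=
  .seq (.seq clearP (setT (.lit 0))) <| .loop (.sub vM vT) <|
    .seq (.seq pickP <| .cond vBest chooseP .skip) (setT (.add vT (.lit 1)))

theorem realizes_matchP : Realizes matchP
    (fun n σ => Bnd n σ ∧ (∀ e < σ.m, σ.out (σ.nA + e) = 0) ∧ ∀ e < σ.m, 0 < σ.V e) fun σ σ' =>
    Static σ σ' ∧ (∀ j < σ.nA, σ'.out j = σ.out j) ∧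
      ∃ M w, MatchRun σ.edge σ.V σ.Avail σ.m σ.Y σ.m w M ∧
        ∀ e < σ.m, σ'.out (σ.nA + e) ≠ 0 ↔ e ∈ M := by
  refine Realizes.conseq (Realizes.loop (pre' := Bnd) (fun σ => σ.m)
    (fun σ k σ' => Static σ σ' ∧ (∀ j < σ.nA, σ'.out j = σ.out j) ∧ σ'.t = k ∧
      ∃ M, MatchRun σ.edge σ.V σ.Avail σ.m σ.Y k σ'.w M ∧
        ∀ e < σ.m, σ'.out (σ.nA + e) ≠ 0 ↔ e ∈ M)
    ((realizes_clearP.restrict fun _ _ h => h.1).then (realizes_setT _))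
    ((realizes_pickP.seq (pre' := Bnd) (Realizes.cond vBest
      (realizes_chooseP.restrict fun _ _ h => h.1) realizes_skip) ?_).then (realizes_setT _))
    (fun n σ h => h.1.2.1) ?_ ?_ ?_) ?_
  · rintro n σ τ hb ⟨hS, _⟩
    exact hS.bnd hb
  · rintro n σ _ ⟨_, hout, _⟩ ⟨_, ⟨w, hw, rfl⟩, rfl⟩
    exact ⟨by constructor <;> rfl, fun _ _ => rfl, rfl, ∅, .init hw, fun e he => by
      simp [hout e he]⟩
  · rintro n σ k τ ⟨hb, _, hV⟩ hk ⟨hS, hout, ht, M, hrun, hM⟩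
    refine ⟨by simp only [Term.eval, eval_vM, eval_vT, hS.m, ht]; omega, hS.bnd hb, ?_⟩
    rintro _ ⟨ρ, ⟨π, ⟨hS', hw, hout', ht', hbest, hmax⟩, h1, h2⟩, rfl⟩
    -- The matching writes `out` only from `nA` on. Availability of an augmented vehicle is read
    -- below `nA`, and that of a basis vehicle does not depend on `out`.
    have hav : ∀ e, τ.Avail e ↔ σ.Avail e := by
      intro e
      rw [St.Avail, St.Avail, hS.row, hS.inp, hS.nA]
      by_cases hle : σ.nA ≤ σ.inp (σ.row e + 1)
      · simp [hle]
      · rw [hout _ (not_le.1 hle)]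
    simp only [hS.m, hS.edge, hS.V, hav] at hbest hmax
    by_cases h0 : π.best = 0
    · rw [h2 h0]
      refine ⟨(hS.trans hS').trans (by constructor <;> rfl), fun j hj => ?_, ?_, M, ?_, ?_⟩
      · exact (congrFun hout' j).trans (hout j hj)
      · simp [Term.eval, ht', ht]
      · simp only [hw]
        refine hrun.idle fun f hf hfa hf0 => ?_
        have h3 := hmax f hf hfa hf0
        have h4 := hV f hf
        omega
      · simp only [hout']
        exact hM
    · obtain ⟨hSρ, htρ, hwρ, hoρ⟩ := h1 h0
      obtain ⟨hbi, hba, hb0, hbV⟩ := hbest.resolve_left h0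
      have hSπ := hS.trans hS'
      rw [hSπ.edge, hbV, hw] at hwρ
      rw [hSπ.nA, hout'] at hoρ
      refine ⟨(hSπ.trans hSρ).trans (by constructor <;> rfl), fun j hj => ?_, ?_, insert π.bi M,
        ?_, ?_⟩
      · simp only [hoρ, Function.update_apply]
        rw [if_neg (by omega), hout j hj]
      · simp [Term.eval, htρ, ht', ht]
      · simp only [hwρ]
        exact hrun.pick hbi hba hb0 fun f hf hfa hf0 => hbV ▸ hmax f hf hfa hf0
      · intro e he
        simp only [hoρ, Function.update_apply, Nat.add_left_cancel_iff, Finset.mem_insert]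
        have h3 := hM e he
        by_cases heb : e = π.bi
        · simp [heb]
        · simpa [heb] using h3
  · rintro n σ τ _ ⟨hS, _, ht, _⟩
    simp [Term.eval, hS.m, ht]
  · rintro n σ τ _ ⟨hS, hout, _, M, hrun, hM⟩
    exact ⟨hS, hout, M, _, hrun, hM⟩

end RAM

namespace RAM

open Finset Covering

/-! ### Reading the input -/

/-- Start of the row of hyperedge `e` in the input. -/
def inputRow (inp : ℕ → ℕ) (e : ℕ) : ℕ :=
  6 + (inp 0 + inp 1) + inp 3 * (inp 2 + 1) + e * (4 + inp 2)

/-- Multiple of the first `k` denominators. -/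
def inputScale (inp : ℕ → ℕ) (k : ℕ) : ℕ :=
  8 * (inp 2 + 1) * ∏ e ∈ range k, inp (inputRow inp e + 3)

/-- Value of hyperedge `e`, scaled to an integer. -/
def inputValue (inp : ℕ → ℕ) (e : ℕ) : ℕ :=
  inp (inputRow inp e + 2) * (inputScale inp (inp 4) / inp (inputRow inp e + 3))

/-- Bounds for the input. -/
structure InputBnd (n : ℕ) (inp : ℕ → ℕ) : Prop where
  Y : inp 3 * (inp 0 + inp 1 + inp 2) ≤ n
  row : inputRow inp 0 ≤ n
  m : inp 0 + inp 4 ≤ n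
  scale : ∀ k ≤ inp 4, inputScale inp k < 2 ^ n
  value : ∀ e < inp 4, inputValue inp e < 2 ^ n
  value_pos : ∀ e < inp 4, 0 < inputValue inp e

/-- The scalars describe the instance given by the input. -/
structure Header (σ : St) : Prop where
  nA : σ.nA = σ.inp 0
  nV : σ.nV = σ.inp 0 + σ.inp 1
  L : σ.L = σ.inp 0 + σ.inp 1 + σ.inp 2
  Y : σ.Y = σ.inp 3 * (σ.inp 0 + σ.inp 1 + σ.inp 2)
  m : σ.m = σ.inp 4
  K : σ.K = σ.inp 5
  E0 : σ.E0 = inputRow σ.inp 0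
  st : σ.st = 4 + σ.inp 2

theorem Header.row {σ : St} (h : Header σ) (e : ℕ) : σ.row e = inputRow σ.inp e := by
  rw [St.row, h.E0, h.st, inputRow, inputRow, Nat.zero_mul, Nat.add_zero]

theorem Header.bnd {σ : St} {n : ℕ} (h : Header σ) (hb : InputBnd n σ.inp) : Bnd n σ := by
  have h1 := hb.Y
  have h2 := hb.m
  unfold Bnd
  rw [h.Y, h.m, h.nA]
  omega

/-- Set the scalars that describe the instance. -/
def headerP : Prog :=
  .seq (setNA (rInp (.lit 0))) <| .seq (setNV (.add (rInp (.lit 0)) (rInp (.lit 1)))) <|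
  .seq (setL (.add (.add (rInp (.lit 0)) (rInp (.lit 1))) (rInp (.lit 2)))) <|
  .seq (setY (.mul (rInp (.lit 3)) (.add (.add (rInp (.lit 0)) (rInp (.lit 1))) (rInp (.lit 2))))) <|
  .seq (setM (rInp (.lit 4))) <| .seq (setK (rInp (.lit 5))) <|
  .seq (setE0 (.add (.add (.lit 6) (.add (rInp (.lit 0)) (rInp (.lit 1))))
    (.mul (rInp (.lit 3)) (.add (rInp (.lit 2)) (.lit 1))))) <|
  .seq (setSt (.add (.lit 4) (rInp (.lit 2)))) <|
    setQ (.mul (.lit 8) (.add (rInp (.lit 2)) (.lit 1)))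

/-- Three of these writes store products, whose lengths are controlled by `InputBnd` instead of
`Term.Lin`. -/
theorem realizes_headerP : Realizes headerP (fun n σ => InputBnd n σ.inp) fun σ σ' =>
    Header σ' ∧ σ'.inp = σ.inp ∧ σ'.Q = inputScale σ.inp 0 := by
  refine Realizes.conseq (Realizes.seq (pre' := fun n σ => InputBnd n σ.inp) (realizes_setNA _)
    (Realizes.seq (pre' := fun n σ => InputBnd n σ.inp) (realizes_setNV _)
    (Realizes.seq (pre' := fun n σ => InputBnd n σ.inp) (realizes_setL _)
    (Realizes.seq (pre' := fun n σ => InputBnd n σ.inp)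
      (realizes_write_of_lt (fun σ => update_Y σ _) ?_)
    (Realizes.seq (pre' := fun n σ => InputBnd n σ.inp) (realizes_setM _)
    (Realizes.seq (pre' := fun n σ => InputBnd n σ.inp) (realizes_setK _)
    (Realizes.seq (pre' := fun n σ => InputBnd n σ.inp)
      (realizes_write_of_lt (fun σ => update_E0 σ _) ?_)
    (Realizes.seq (pre' := fun n σ => InputBnd n σ.inp) (realizes_setSt _)
      (realizes_write_of_lt (fun σ => update_Q σ _) ?_) ?_) ?_) ?_) ?_) ?_) ?_) ?_) ?_) ?_
  · intro n σ h
    simpa [Term.eval] using h.Y.trans_lt n.lt_two_pow_self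
  · intro n σ h
    simpa [Term.eval, inputRow] using h.row.trans_lt n.lt_two_pow_self
  · intro n σ h
    simpa [Term.eval, inputScale] using h.scale 0 (Nat.zero_le _)
  iterate 8
    · rintro n σ _ h rfl
      exact h
  · rintro n σ _ _ ⟨_, rfl, _, rfl, _, rfl, _, rfl, _, rfl, _, rfl, _, rfl, _, rfl, rfl⟩
    refine ⟨?_, rfl, ?_⟩
    · constructor <;> simp [Term.eval, inputRow]
    · simp [Term.eval, inputScale]

/-- Compute the common multiple of the denominators. -/
def scaleP : Prog :=
  .seq (setE (.lit 0)) <| .loop (.sub vM vE) <|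
    .seq (setQ (.mul vQ (rInp (.add rowT (.lit 3))))) (setE (.add vE (.lit 1)))

theorem eval_rowT (σ : St) : rowT.eval σ.mem = σ.row σ.e := by simp [rowT, St.row, Term.eval]

theorem realizes_scaleP : Realizes scaleP
    (fun n σ => InputBnd n σ.inp ∧ Header σ ∧ σ.Q = inputScale σ.inp 0) fun σ σ' =>
    σ' = { σ with e := σ.m, Q := inputScale σ.inp σ.m } := by
  have hnext : ∀ (σ : St) (k : ℕ), Header σ →
      inputScale σ.inp k * σ.inp (σ.row k + 3) = inputScale σ.inp (k + 1) := by
    intro σ k h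
    rw [inputScale, inputScale, Finset.prod_range_succ, h.row, mul_assoc]
  refine Realizes.loop (fun σ => σ.m)
    (fun σ k σ' => σ' = { σ with e := k, Q := inputScale σ.inp k })
    (realizes_setE _)
    (pre' := fun n σ => σ.Q * σ.inp (σ.row σ.e + 3) < 2 ^ n)
    ((realizes_write_of_lt (a := .lit 8) (b := .mul vQ (rInp (.add rowT (.lit 3))))
      (f := fun σ => { σ with Q := (Term.mul vQ (rInp (.add rowT (.lit 3)))).eval σ.mem })
      (fun σ => update_Q σ _) ?_).then (realizes_setE _))
    (fun n σ h => (h.2.1.bnd h.1).2.1) ?_ ?_ ?_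
  · intro n σ h
    simpa [Term.eval, eval_rowT] using h
  · rintro n σ _ ⟨_, _, hQ⟩ rfl
    rw [← hQ]
    rfl
  · rintro n σ k _ ⟨hb, h, _⟩ hk rfl
    refine ⟨by simp only [Term.eval, eval_vM, eval_vE]; omega, ?_, ?_⟩
    · refine (hnext σ k h).trans_lt (hb.scale (k + 1) ?_)
      rw [← h.m]
      exact hk
    · rintro _ ⟨_, rfl, rfl⟩
      simp only [Term.eval, eval_vE, eval_vQ, eval_rInp, eval_rowT, ← hnext σ k h]
      rfl
  · rintro n σ _ _ rfl
    simp [Term.eval]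

/-- Compute the scaled values. -/
def valueP : Prog :=
  .seq (setE (.lit 0)) <| .loop (.sub vM vE) <|
    .seq (storeV vE (.mul (rInp (.add rowT (.lit 2))) (.div vQ (rInp (.add rowT (.lit 3))))))
      (setE (.add vE (.lit 1)))

theorem realizes_valueP : Realizes valueP
    (fun n σ => InputBnd n σ.inp ∧ Header σ ∧ σ.Q = inputScale σ.inp (σ.inp 4)) fun σ σ' =>
    ∃ V : ℕ → ℕ, (∀ e < σ.m, V e = inputValue σ.inp e) ∧ σ' = { σ with e := σ.m, V := V } := by
  have hval : ∀ (σ : St) (k : ℕ), Header σ → σ.Q = inputScale σ.inp (σ.inp 4) →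
      σ.inp (σ.row k + 2) * (σ.Q / σ.inp (σ.row k + 3)) = inputValue σ.inp k := by
    intro σ k h hQ
    rw [inputValue, h.row, hQ]
  refine Realizes.loop (fun σ => σ.m) (fun σ k σ' => ∃ V : ℕ → ℕ,
      (∀ e < k, V e = inputValue σ.inp e) ∧ σ' = { σ with e := k, V := V })
    (realizes_setE _)
    (pre' := fun n σ => σ.inp (σ.row σ.e + 2) * (σ.Q / σ.inp (σ.row σ.e + 3)) < 2 ^ n)
    ((realizes_write_of_lt (a := adr 1 vE)
      (b := .mul (rInp (.add rowT (.lit 2))) (.div vQ (rInp (.add rowT (.lit 3)))))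
      (f := fun σ => { σ with V := (Function.update σ.V (vE.eval σ.mem)
        ((Term.mul (rInp (.add rowT (.lit 2)))
          (.div vQ (rInp (.add rowT (.lit 3))))).eval σ.mem)) })
      (fun σ => update_V σ _ _) ?_).then (realizes_setE _))
    (fun n σ h => (h.2.1.bnd h.1).2.1) ?_ ?_ ?_
  · intro n σ h
    simpa [Term.eval, eval_rowT] using h
  · rintro n σ _ _ rfl
    exact ⟨σ.V, by simp, rfl⟩
  · rintro n σ k _ ⟨hb, h, hQ⟩ hk ⟨V, hV, rfl⟩
    refine ⟨by simp only [Term.eval, eval_vM, eval_vE]; omega, ?_, ?_⟩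
    · refine (hval σ k h hQ).trans_lt (hb.value k ?_)
      rwa [← h.m]
    · rintro _ ⟨_, rfl, rfl⟩
      refine ⟨Function.update V k (inputValue σ.inp k), fun e he => ?_, ?_⟩
      · rw [Function.update_apply]
        split_ifs with hek
        · rw [hek]
        · exact hV e (by omega)
      · simp only [Term.eval, eval_vE, eval_vQ, eval_rInp, eval_rowT, ← hval σ k h hQ]
        rfl
  · rintro n σ _ _ ⟨V, _, rfl⟩
    simp [Term.eval]

/-- `ν` marks the classes of a greedy run and, in the cells from `nA` on, the hyperedges of a
subsequent greedy matching. -/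
def St.Marks (τ : St) (ν : ℕ → ℕ) : Prop :=
  ∃ u S w M, GreedyRun τ.edge τ.V τ.cls τ.m τ.Y τ.nA (min τ.K τ.nA) u S ∧
    MatchRun τ.edge τ.V (fun e => τ.cls e = τ.nA ∨ τ.cls e ∈ S) τ.m τ.Y τ.m w M ∧
    (∀ j < τ.nA, ν j ≠ 0 ↔ j ∈ S) ∧ ∀ e < τ.m, ν (τ.nA + e) ≠ 0 ↔ e ∈ M

theorem St.Marks.congr {τ : St} {ν ν' : ℕ → ℕ} (h : τ.Marks ν)
    (hν : ∀ j < τ.nA + τ.m, ν' j = ν j) : τ.Marks ν' := by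
  obtain ⟨u, S, w, M, h1, h2, h3, h4⟩ := h
  refine ⟨u, S, w, M, h1, h2, fun j hj => ?_, fun e he => ?_⟩
  · rw [hν j (by omega)]
    exact h3 j hj
  · rw [hν _ (by omega)]
    exact h4 e he

/-- Selection of vehicles and hyperedges for an input stored in the array `inp`. -/
def coreP : Prog := .seq headerP <| .seq scaleP <| .seq valueP <| .seq greedyP matchP

theorem realizes_coreP : Realizes coreP (fun n σ => InputBnd n σ.inp) fun σ σ' =>
    ∃ τ : St, Header τ ∧ τ.inp = σ.inp ∧ (∀ e < τ.m, τ.V e = inputValue τ.inp e) ∧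
      σ'.nA = τ.nA ∧ σ'.m = τ.m ∧ τ.Marks σ'.out := by
  refine (realizes_headerP.seq (realizes_scaleP.seq (realizes_valueP.seq (pre' := fun n σ =>
    Bnd n σ ∧ ∀ e < σ.m, 0 < σ.V e) ((realizes_greedyP.restrict fun _ _ h => h.1).seq
      realizes_matchP ?_) ?_) ?_) ?_).conseq ?_
  · rintro n σ τ ⟨hb, hV⟩ ⟨hS, S, hrun, hout⟩
    refine ⟨hS.bnd hb, fun e he => ?_, fun e he => ?_⟩
    · rw [hS.m] at he
      rw [hS.nA]
      by_contra h
      have h1 := hrun.lt _ ((hout (σ.nA + e) (by omega)).1 h)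
      omega
    · rw [hS.m] at he
      rw [hS.V]
      exact hV e he
  · rintro n σ _ ⟨hb, h, _⟩ ⟨V, hV, rfl⟩
    refine ⟨h.bnd hb, fun e he => ?_⟩
    change 0 < V e
    rw [hV e he]
    exact hb.value_pos e (h.m ▸ he)
  · rintro n σ _ ⟨hb, h, _⟩ rfl
    exact ⟨hb, by constructor <;> simp [h.nA, h.nV, h.L, h.Y, h.m, h.K, h.E0, h.st], by simp [h.m]⟩
  · rintro n σ τ hb ⟨h, hi, hQ⟩
    rw [hi]
    exact ⟨hb, h, hQ⟩
  · rintro n σ σ' hb ⟨ρ, ⟨h, hi, hQ⟩, _, rfl, _, ⟨V, hV, rfl⟩, π, ⟨hS, S, hrun, hout⟩, hS', hout',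
      M, w, hmatch, hM⟩
    refine ⟨{ ρ with e := ρ.m, Q := inputScale ρ.inp ρ.m, V := V }, ?_, hi, hV, (hS.trans hS').nA, (hS.trans hS').m, π.u, S, w, M, hrun, ?_,
      fun j hj => ?_, fun e he => ?_⟩
    · constructor <;> simp [h.nA, h.nV, h.L, h.Y, h.m, h.K, h.E0, h.st]
    · have hav : π.Avail = fun e => π.cls e = π.nA ∨ π.cls e ∈ S := by
        funext e
        refine propext ?_
        rw [St.Avail, St.cls]
        by_cases hle : π.nA ≤ π.inp (π.row e + 1)
        · simp [hle]
        · rw [min_eq_left (by omega), hout _ (by rw [← hS.nA]; omega)]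
          refine or_congr_left ⟨fun h' => absurd h' hle, fun h' => by omega⟩
      rw [hav, hS.edge, hS.V, hS.cls, hS.m, hS.Y, hS.nA] at hmatch
      exact hmatch
    · rw [hout' j (hS.nA.symm ▸ hj)]
      exact hout j (Nat.lt_add_right _ hj)
    · have h1 := hM e (hS.m.symm ▸ he)
      rwa [hS.nA] at h1

/-! ### Spreading the input and collecting the output -/

/-- Length of the input. -/
def lengthT : Term :=
  .add (.add (.add (.lit 6) (.add (.read (.lit 18)) (.read (.lit 19))))
    (.mul (.read (.lit 21)) (.add (.read (.lit 20)) (.lit 1))))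
    (.mul (.read (.lit 22)) (.add (.lit 4) (.read (.lit 20))))

/-- Move the input to the array `inp`. -/
def spreadP : Prog :=
  .seq (setX lengthT) <| .loop vX <|
    .seq (setX (.sub vX (.lit 1))) (.write (adr 0 vX) (.read (.add (.lit 18) vX)))

/-- Entries move from 18 + j to 18 + 5j. Working downwards from the last entry, no write hits an
entry still to be moved. Raw memories are used because the input does not yet have the interleaved
layout. -/
theorem runs_spreadP : ∃ T, PolyBdd T ∧ ∀ n μ, lengthT.eval μ ≤ n → ∃ ν,
    Runs spreadP μ (T n) ν ∧ ∀ j < lengthT.eval μ, ν (18 + 5 * j) = μ (18 + j) := by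
  refine ⟨fun n => writeCost (.lit 10) lengthT + n + (n * (vX.cw + 1 +
    (writeCost (.lit 10) (.sub vX (.lit 1)) +
      writeCost (adr 0 vX) (.read (.add (.lit 18) vX)))) + (vX.cw + 1)),
    ((PolyBdd.const _).add .id).add ((PolyBdd.id.mul (.const _)).add (.const _)), ?_⟩
  intro n μ hn
  set N := lengthT.eval μ with hN
  have h1 := runs_write_of_lt μ (.lit 10) lengthT (s := n) (hn.trans_lt n.lt_two_pow_self)
  obtain ⟨ν, h2, -, h3, -⟩ := runs_loop (t := vX)
    (P := .seq (setX (.sub vX (.lit 1))) (.write (adr 0 vX) (.read (.add (.lit 18) vX))))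
    (T := writeCost (.lit 10) (.sub vX (.lit 1)) +
      writeCost (adr 0 vX) (.read (.add (.lit 18) vX))) (n := N)
    (fun k ρ => ρ 10 = N - k ∧ (∀ j < N, N - k ≤ j → ρ (18 + 5 * j) = μ (18 + j)) ∧
      ∀ j < N - k, ρ (18 + j) = μ (18 + j))
    (by
      rintro k hk ρ ⟨h10, hhi, hlo⟩
      refine ⟨by change ρ 10 ≠ 0; omega, _, (runs_write ρ _ _ rfl).seq (runs_write _ _ _ rfl), ?_⟩
      have hx : (Function.update ρ 10 (ρ 10 - 1)) 10 = N - (k + 1) := by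
        rw [Function.update_self, h10]; omega
      have hval : (Function.update ρ 10 (ρ 10 - 1)) (18 + (N - (k + 1))) =
          μ (18 + (N - (k + 1))) := by
        rw [Function.update_of_ne (by omega)]
        exact hlo _ (by omega)
      change Function.update (Function.update ρ 10 (ρ 10 - 1))
          (18 + 0 + 5 * (Function.update ρ 10 (ρ 10 - 1)) 10)
          (Function.update ρ 10 (ρ 10 - 1) (18 + (Function.update ρ 10 (ρ 10 - 1)) 10)) 10 = _ ∧
        (∀ j < N, _ → Function.update (Function.update ρ 10 (ρ 10 - 1))
          (18 + 0 + 5 * (Function.update ρ 10 (ρ 10 - 1)) 10)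
          (Function.update ρ 10 (ρ 10 - 1) (18 + (Function.update ρ 10 (ρ 10 - 1)) 10))
            (18 + 5 * j) = _) ∧
        ∀ j < N - (k + 1), Function.update (Function.update ρ 10 (ρ 10 - 1))
          (18 + 0 + 5 * (Function.update ρ 10 (ρ 10 - 1)) 10)
          (Function.update ρ 10 (ρ 10 - 1) (18 + (Function.update ρ 10 (ρ 10 - 1)) 10))
            (18 + j) = _
      rw [hx, hval]
      refine ⟨?_, fun j hj hkj => ?_, fun j hj => ?_⟩
      · rw [Function.update_of_ne (by omega), hx]
      · by_cases hjk : j = N - (k + 1)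
        · rw [hjk, Nat.add_zero, Function.update_self]
        · rw [Function.update_of_ne (by omega), Function.update_of_ne (by omega)]
          exact hhi j hj (by omega)
      · rw [Function.update_of_ne (by omega), Function.update_of_ne (by omega)]
        exact hlo j (by omega))
    (by
      rintro ρ ⟨h10, -⟩
      change ρ 10 = 0
      omega)
    (μ := Function.update μ 10 N)
    ⟨by simp, fun j hj hj' => by omega, fun j _ => Function.update_of_ne (by omega) _ _⟩
  refine ⟨ν, (h1.seq h2).mono ?_, fun j hj => h3 j hj (by omega)⟩
  have := Nat.mul_le_mul_right (vX.cw + 1 +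
    (writeCost (.lit 10) (.sub vX (.lit 1)) +
      writeCost (adr 0 vX) (.read (.add (.lit 18) vX)))) hn
  dsimp only
  omega

/-- Move the array `out` to the output cells. -/
def collectP : Prog :=
  .seq (setE (.lit 0)) <| .loop (.sub (.add vNA vM) vE) <|
    .seq (.write (.add (.lit 18) vE) (rOut vE)) (setE (.add vE (.lit 1)))

/-- Here the order is upwards: the target 18 + k precedes every cell of `out` still to be read.
Other arrays may be overwritten, which no longer matters. -/
theorem runs_collectP : ∃ T, PolyBdd T ∧ ∀ n (σ : St), σ.nA + σ.m ≤ n → ∃ ν,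
    Runs collectP σ.mem (T n) ν ∧ ∀ j < σ.nA + σ.m, ν (18 + j) = σ.out j := by
  refine ⟨fun n => writeCost (.lit 9) (.lit 0) + (n * ((Term.sub (.add vNA vM) vE).cw + 1 +
    (writeCost (.add (.lit 18) vE) (rOut vE) + writeCost (.lit 9) (.add vE (.lit 1)))) +
      ((Term.sub (.add vNA vM) vE).cw + 1)),
    (PolyBdd.const _).add ((PolyBdd.id.mul (.const _)).add (.const _)), ?_⟩
  intro n σ hn
  have h1 := runs_write σ.mem (.lit 9) (.lit 0) rfl
  obtain ⟨ν, h2, -, -, -, h3, -⟩ := runs_loop (t := .sub (.add vNA vM) vE)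
    (P := .seq (.write (.add (.lit 18) vE) (rOut vE)) (setE (.add vE (.lit 1))))
    (T := writeCost (.add (.lit 18) vE) (rOut vE) + writeCost (.lit 9) (.add vE (.lit 1)))
    (n := σ.nA + σ.m)
    (fun k ρ => ρ 9 = k ∧ ρ 0 = σ.nA ∧ ρ 4 = σ.m ∧ (∀ j < k, ρ (18 + j) = σ.out j) ∧
      ∀ j, k ≤ j → ρ (18 + 4 + 5 * j) = σ.out j)
    (by
      rintro k hk ρ ⟨h9, h0, h4, hlo, hhi⟩
      refine ⟨by change ρ 0 + ρ 4 - ρ 9 ≠ 0; omega, _,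
        (runs_write ρ _ _ rfl).seq (runs_write _ _ _ rfl), ?_⟩
      set ρ' := Function.update ρ (18 + ρ 9) (ρ (18 + 4 + 5 * ρ 9)) with hρ'
      rw [h9] at hρ'
      change Function.update ρ' 9 (ρ' 9 + 1) 9 = _ ∧ Function.update ρ' 9 (ρ' 9 + 1) 0 = _ ∧
        Function.update ρ' 9 (ρ' 9 + 1) 4 = _ ∧
        (∀ j < k + 1, Function.update ρ' 9 (ρ' 9 + 1) (18 + j) = _) ∧
        ∀ j, k + 1 ≤ j → Function.update ρ' 9 (ρ' 9 + 1) (18 + 4 + 5 * j) = _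
      refine ⟨?_, ?_, ?_, fun j hj => ?_, fun j hj => ?_⟩
      · rw [Function.update_self, hρ', Function.update_of_ne (by omega), h9]
      · rw [Function.update_of_ne (by omega), hρ', Function.update_of_ne (by omega), h0]
      · rw [Function.update_of_ne (by omega), hρ', Function.update_of_ne (by omega), h4]
      · rw [Function.update_of_ne (by omega), hρ']
        by_cases hjk : j = k
        · rw [hjk, Function.update_self]
          exact hhi k le_rfl
        · rw [Function.update_of_ne (by omega)]
          exact hlo j (by omega)
      · rw [Function.update_of_ne (by omega), hρ', Function.update_of_ne (by omega)]
        exact hhi j (by omega))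
    (by
      rintro ρ ⟨h9, h0, h4, -⟩
      change ρ 0 + ρ 4 - ρ 9 = 0
      omega)
    (μ := Function.update σ.mem 9 0)
    ⟨Function.update_self _ _ _, Function.update_of_ne (by omega) _ _,
      Function.update_of_ne (by omega) _ _, fun j hj => by omega, fun j _ => by
        rw [Function.update_of_ne (by omega)]
        exact σ.mem_arr (j := 4) (by norm_num) j⟩
  refine ⟨ν, (h1.seq h2).mono ?_, h3⟩
  have := Nat.mul_le_mul_right ((Term.sub (.add vNA vM) vE).cw + 1 +
    (writeCost (.add (.lit 18) vE) (rOut vE) + writeCost (.lit 9) (.add vE (.lit 1)))) hn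
  dsimp only
  omega

end RAM

namespace RAM

open Finset Covering

/-! ### The whole program -/

theorem PolyBdd.comp {f g : ℕ → ℕ} (hf : PolyBdd f) (hg : PolyBdd g) (hmono : Monotone f) :
    PolyBdd fun n => f (g n) := by
  obtain ⟨p, hp⟩ := hf
  obtain ⟨q, hq⟩ := hg
  exact ⟨p.comp q, fun n => by
    rw [Polynomial.eval_comp]
    exact (hmono (hq n)).trans (hp _)⟩

theorem getD_lt_two_pow_bitSize (xs : List ℕ) (j : ℕ) : xs.getD j 0 < 2 ^ bitSize xs := by
  induction xs generalizing j with
  | nil => simp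
  | cons x xs ih =>
    have h : bitSize (x :: xs) = x.size + 1 + bitSize xs := rfl
    cases j with
    | zero =>
      exact (Nat.lt_size_self x).trans_le (Nat.pow_le_pow_right two_pos (by omega))
    | succ j => exact (ih j).trans_le (Nat.pow_le_pow_right two_pos (by omega))

theorem length_le_bitSize (xs : List ℕ) : xs.length ≤ bitSize xs := by
  induction xs with
  | nil => simp
  | cons x xs ih =>
    have h : bitSize (x :: xs) = x.size + 1 + bitSize xs := rfl
    rw [h, List.length_cons]
    omega

theorem load_lt (r : ℕ) (xs : List ℕ) (i : ℕ) : load r xs i < 2 ^ bitSize xs := by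
  unfold load
  split_ifs
  · exact Nat.two_pow_pos _
  · exact getD_lt_two_pow_bitSize xs _

theorem load_add (r : ℕ) (xs : List ℕ) (i : ℕ) : load r xs (r + i) = xs.getD i 0 := by
  simp [load]

/-- Bound for the dimensions and the numbers of bits in terms of the bit length. -/
def extent (b : ℕ) : ℕ := b * b + 4 * b + 10

/-- All budgets are evaluated at `extent` of the bit length, and the cost T(B + T + 1) is again
polynomial. The bounds are required for every array extending the input, since spreading leaves the
entries beyond its length unspecified. -/
theorem exists_prog : ∃ (P : Prog) (q : Polynomial ℕ), ∀ xs : List ℕ,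
    inputRow (fun j => xs.getD j 0) (xs.getD 4 0) = xs.length →
    (∀ inp : ℕ → ℕ, (∀ j < xs.length, inp j = xs.getD j 0) →
      InputBnd (extent (bitSize xs)) inp) →
    ∃ (c : ℕ) (ν : Mem) (τ : St), Exec P (load 18 xs) c ν ∧ c ≤ q.eval (bitSize xs) ∧
      Header τ ∧ (∀ j < xs.length, τ.inp j = xs.getD j 0) ∧
      (∀ e < τ.m, τ.V e = inputValue τ.inp e) ∧ τ.Marks fun i => ν (18 + i) := by
  obtain ⟨T₁, ⟨p₁, hT₁⟩, h₁⟩ := runs_spreadP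
  obtain ⟨T₂, ⟨p₂, hT₂⟩, h₂⟩ := realizes_coreP
  obtain ⟨T₃, ⟨p₃, hT₃⟩, h₃⟩ := runs_collectP
  have hext : PolyBdd extent := ((PolyBdd.id.mul .id).add ((PolyBdd.const 4).mul .id)).add (.const 10)
  have hev : ∀ p : Polynomial ℕ, PolyBdd fun n => p.eval (extent n) := fun p =>
    PolyBdd.comp ⟨p, fun _ => le_rfl⟩ hext fun a b hab => by
      simp only [Polynomial.eval_eq_sum]
      exact Finset.sum_le_sum fun i _ => Nat.mul_le_mul_left _ (Nat.pow_le_pow_left hab i)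
  have hT := (hev p₁).add ((hev p₂).add (hev p₃))
  obtain ⟨q, hq⟩ := hT.mul ((PolyBdd.id.add hT).add (.const 1))
  refine ⟨.seq spreadP (.seq coreP collectP), q, fun xs hlen hbnd => ?_⟩
  set n := extent (bitSize xs) with hn
  have hbn : bitSize xs ≤ n := by rw [hn, extent]; nlinarith
  have hlenT : lengthT.eval (load 18 xs) = xs.length := by
    rw [← hlen]
    rfl
  obtain ⟨ν₁, hr₁, hν₁⟩ := h₁ n (load 18 xs)
    (hlenT.trans_le ((length_le_bitSize xs).trans hbn))
  obtain ⟨σ, rfl⟩ := St.exists_eq_mem ν₁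
  have hinp : ∀ j < xs.length, σ.inp j = xs.getD j 0 := fun j hj => by
    rw [← load_add 18, ← hν₁ j (hlenT.symm ▸ hj)]
    exact (σ.mem_arr (j := 0) (by norm_num) j).symm
  obtain ⟨σ', hr₂, τ, hτ, hi, hV, hnA, hm, hmarks⟩ := h₂ n σ (hbnd _ hinp)
  obtain ⟨ν, hr₃, hν⟩ := h₃ n σ' (by
    rw [hnA, hm, hτ.nA, hτ.m, hi]
    exact (hbnd _ hinp).m)
  have hrun := hr₁.seq (hr₂.seq hr₃)
  obtain ⟨-, c, hc, hexec⟩ := hrun (bitSize xs) (load_lt 18 xs)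
  have hle : T₁ n + (T₂ n + T₃ n) ≤ p₁.eval n + (p₂.eval n + p₃.eval n) :=
    Nat.add_le_add (hT₁ n) (Nat.add_le_add (hT₂ n) (hT₃ n))
  refine ⟨c, ν, τ, hexec, hc.trans (le_trans ?_ (hq (bitSize xs))), hτ, fun j hj => ?_, hV, ?_⟩
  · exact Nat.mul_le_mul hle (Nat.add_le_add_right (Nat.add_le_add_left hle _) _)
  · rw [hi, hinp j hj]
  · refine hmarks.congr fun j hj => ?_
    rw [← hnA, ← hm] at hj
    exact hν j hj

end RAM

/-! ### The encoding of an instance, as read by the machine -/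

namespace RAM

theorem getD_flatten_ofFn {k c : ℕ} (f : Fin k → List ℕ) (hf : ∀ i, (f i).length = c) (i : Fin k)
    {j : ℕ} (hj : j < c) : (List.ofFn f).flatten.getD (i * c + j) 0 = (f i).getD j 0 := by
  induction k with
  | zero => exact i.elim0
  | succ k ih =>
    rw [List.ofFn_succ, List.flatten_cons]
    refine Fin.cases ?_ (fun i => ?_) i
    · rw [List.getD_append _ _ _ _ (by rw [hf]; simpa using hj)]
      simp
    · rw [List.getD_append_right _ _ _ _ (by rw [hf, Fin.val_succ]; nlinarith), hf,
        ← ih (fun i => f i.succ) (fun i => hf _) i]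
      congr 1
      rw [Fin.val_succ, Nat.succ_mul]
      omega

theorem length_flatten_ofFn {k c : ℕ} (f : Fin k → List ℕ) (hf : ∀ i, (f i).length = c) :
    (List.ofFn f).flatten.length = k * c := by
  simp [List.length_flatten, List.map_ofFn, Function.comp_def, hf]

theorem bitSize_append (xs ys : List ℕ) : bitSize (xs ++ ys) = bitSize xs + bitSize ys := by
  simp [bitSize]

theorem bitSize_flatten (l : List (List ℕ)) : bitSize l.flatten = (l.map bitSize).sum := by
  induction l with
  | nil => rfl
  | cons x l ih => rw [List.flatten_cons, bitSize_append, ih, List.map_cons, List.sum_cons]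

end RAM

namespace SRAMF

open RAM Finset

variable (I : SRAMF)

theorem length_encodeEdge (e : Fin I.m) : (I.encodeEdge e).length = 4 + I.nD := by
  rw [encodeEdge, List.length_append, List.length_ofFn]
  rfl

theorem length_encodeScenario (ξ : Fin I.N) : (I.encodeScenario ξ).length = I.nD + 1 := by
  simp [encodeScenario]

theorem length_encode :
    I.encode.length = 6 + (I.nA + I.nB) + I.N * (I.nD + 1) + I.m * (4 + I.nD) := by
  simp only [encode, List.length_append, length_flatten_ofFn _ I.length_encodeEdge,
    length_flatten_ofFn _ I.length_encodeScenario, List.length_ofFn, List.length_cons,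
    List.length_nil]

theorem getD_encode_edge (e : Fin I.m) {j : ℕ} (hj : j < 4 + I.nD) :
    I.encode.getD (6 + (I.nA + I.nB) + I.N * (I.nD + 1) + e * (4 + I.nD) + j) 0 =
      (I.encodeEdge e).getD j 0 := by
  rw [← getD_flatten_ofFn I.encodeEdge I.length_encodeEdge e hj, encode,
    List.getD_append_right]
  · congr 1
    simp only [List.length_append, length_flatten_ofFn _ I.length_encodeScenario,
      List.length_ofFn, List.length_cons, List.length_nil]
    omega
  · simp only [List.length_append, length_flatten_ofFn _ I.length_encodeScenario,
      List.length_ofFn, List.length_cons, List.length_nil]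
    omega

/-- An array that starts with the encoding of the instance. -/
def Encoded (inp : ℕ → ℕ) : Prop := ∀ j < I.encode.length, inp j = I.encode.getD j 0

namespace Encoded

variable {I} {inp : ℕ → ℕ}

theorem head (h : I.Encoded inp) {j : ℕ} (hj : j < 6) : inp j = [I.nA, I.nB, I.nD, I.N, I.m, I.K].getD j 0 := by
  rw [h j (by rw [I.length_encode]; omega), encode, List.append_assoc, List.append_assoc,
    List.getD_append _ _ _ _ hj]

theorem nA (h : I.Encoded inp) : inp 0 = I.nA := h.head (by norm_num)

theorem nB (h : I.Encoded inp) : inp 1 = I.nB := h.head (by norm_num)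

theorem nD (h : I.Encoded inp) : inp 2 = I.nD := h.head (by norm_num)

theorem N (h : I.Encoded inp) : inp 3 = I.N := h.head (by norm_num)

theorem m (h : I.Encoded inp) : inp 4 = I.m := h.head (by norm_num)

theorem K (h : I.Encoded inp) : inp 5 = I.K := h.head (by norm_num)

theorem edge (h : I.Encoded inp) (e : Fin I.m) {j : ℕ} (hj : j < 4 + I.nD) :
    inp (inputRow inp e + j) = (I.encodeEdge e).getD j 0 := by
  rw [← I.getD_encode_edge e hj, inputRow, h.nA, h.nB, h.nD, h.N, h]
  rw [length_encode]
  have := Nat.mul_le_mul_right (4 + I.nD) (Nat.succ_le_of_lt e.isLt)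
  rw [Nat.succ_mul] at this
  omega

theorem scenario (h : I.Encoded inp) (e : Fin I.m) : inp (inputRow inp e) = I.scenario e :=
  h.edge e (j := 0) (by omega)

theorem vehicle (h : I.Encoded inp) (e : Fin I.m) : inp (inputRow inp e + 1) = I.vehicleIndex (I.vehicle e) :=
  h.edge e (by omega)

theorem num (h : I.Encoded inp) (e : Fin I.m) : inp (inputRow inp e + 2) = (I.value e).num.toNat :=
  h.edge e (by omega)

theorem den (h : I.Encoded inp) (e : Fin I.m) : inp (inputRow inp e + 3) = (I.value e).den :=
  h.edge e (by omega)

theorem request (h : I.Encoded inp) (e : Fin I.m) (j : Fin I.nD) :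
    inp (inputRow inp e + 4 + j) ≠ 0 ↔ j ∈ I.requests e := by
  have h1 := h.edge e (j := 4 + j) (by omega)
  rw [← Nat.add_assoc] at h1
  rw [h1, encodeEdge, List.getD_append_right _ _ _ _ (by simp)]
  simp [List.getD_eq_getElem?_getD]

theorem prod_den (h : I.Encoded inp) :
    ∏ e ∈ range (inp 4), inp (inputRow inp e + 3) = ∏ e, (I.value e).den := by
  rw [h.m, ← Fin.prod_univ_eq_prod_range (fun e => inp (inputRow inp e + 3))]
  exact prod_congr rfl fun e _ => h.den e

theorem inputScale_eq (h : I.Encoded inp) :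
    inputScale inp (inp 4) = 8 * (I.nD + 1) * ∏ e, (I.value e).den := by
  rw [inputScale, h.prod_den, h.nD]

theorem inputScale_le (h : I.Encoded inp) {k : ℕ} (hk : k ≤ inp 4) :
    inputScale inp k ≤ inputScale inp (inp 4) := by
  refine Nat.mul_le_mul_left _ (prod_le_prod_of_subset_of_one_le' (range_mono hk) fun e he _ => ?_)
  rw [mem_range, h.m] at he
  rw [h.den ⟨e, he⟩]
  exact (I.value _).den_pos

/-- The scale is a multiple of each denominator, so the floor division is exact. -/
theorem inputValue_eq (h : I.Encoded inp) (e : Fin I.m) :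
    (inputValue inp e : ℝ) = inputScale inp (inp 4) * (I.value e : ℝ) := by
  have hdvd : (I.value e).den ∣ inputScale inp (inp 4) := by
    rw [h.inputScale_eq]
    exact Dvd.dvd.mul_left (dvd_prod_of_mem (fun e => (I.value e).den) (mem_univ e)) _
  have hnum : (((I.value e).num.toNat : ℕ) : ℝ) = ((I.value e).num : ℝ) := by
    exact_mod_cast Int.toNat_of_nonneg (Rat.num_pos.2 (I.value_pos e)).le
  have hden : ((I.value e).den : ℝ) ≠ 0 := by exact_mod_cast (I.value e).den_ne_zero
  rw [inputValue, h.num, h.den, Nat.cast_mul, Nat.cast_div hdvd hden, hnum, Rat.cast_def]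
  ring

end Encoded

theorem sum_size_le : ∑ e, ((I.value e).num.toNat.size + (I.value e).den.size) ≤
    bitSize I.encode := by
  rw [encode, bitSize_append, bitSize_flatten, List.map_ofFn, List.sum_ofFn]
  refine le_trans (sum_le_sum fun e _ => ?_) (Nat.le_add_left _ _)
  simp only [Function.comp_apply, encodeEdge, bitSize_append]
  simp only [bitSize, List.map_cons, List.map_nil, List.sum_cons, List.sum_nil]
  omega

theorem num_lt (e : Fin I.m) : (I.value e).num.toNat < 2 ^ bitSize I.encode := by
  refine (Nat.lt_size_self _).trans_le (Nat.pow_le_pow_right two_pos (le_trans ?_ I.sum_size_le))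
  exact (Nat.le_add_right _ _).trans (single_le_sum
    (f := fun e => (I.value e).num.toNat.size + (I.value e).den.size)
    (fun _ _ => Nat.zero_le _) (mem_univ e))

/-- The bit lengths of the denominators add up to at most the input length, so their plain product
is short enough and no least common multiple is needed. -/
theorem prod_den_le : ∏ e, (I.value e).den ≤ 2 ^ bitSize I.encode := by
  calc ∏ e, (I.value e).den ≤ ∏ e, 2 ^ (I.value e).den.size :=
        prod_le_prod' fun e _ => (Nat.lt_size_self _).le
    _ = 2 ^ ∑ e, (I.value e).den.size := prod_pow_eq_pow_sum _ _ _
    _ ≤ 2 ^ bitSize I.encode := Nat.pow_le_pow_right two_pos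
        ((sum_le_sum fun e _ => Nat.le_add_left _ _).trans I.sum_size_le)

theorem Encoded.inputBnd {I : SRAMF} {inp : ℕ → ℕ} (h : I.Encoded inp) :
    InputBnd (extent (bitSize I.encode)) inp := by
  set b := bitSize I.encode with hb
  have hlen : 6 + (I.nA + I.nB) + I.N * (I.nD + 1) + I.m * (4 + I.nD) ≤ b :=
    I.length_encode.symm.trans_le (length_le_bitSize _)
  -- The block of N(nD + 1) entries bounds `nD` by the length of the input only because there is at
  -- least one scenario.
  have hN := I.N_pos
  have hD : I.nD + 1 ≤ b := by nlinarith
  have hscale : inputScale inp (inp 4) < 2 ^ (2 * b + 3) := by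
    rw [h.inputScale_eq]
    calc 8 * (I.nD + 1) * ∏ e, (I.value e).den ≤ 8 * (I.nD + 1) * 2 ^ b :=
          Nat.mul_le_mul_left _ I.prod_den_le
      _ < 8 * 2 ^ b * 2 ^ b := by
          have := hD.trans_lt b.lt_two_pow_self
          have := Nat.two_pow_pos b
          gcongr
      _ = 2 ^ (2 * b + 3) := by ring
  have hpow : ∀ {k}, k ≤ 4 * b + 10 → 2 ^ k ≤ 2 ^ extent b := fun hk =>
    Nat.pow_le_pow_right two_pos (by rw [extent]; omega)
  refine ⟨?_, ?_, ?_, fun k hk => ?_, fun e he => ?_, fun e he => ?_⟩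
  · rw [h.nA, h.nB, h.nD, h.N, extent]
    have h1 : I.N ≤ b := by nlinarith
    have h2 : I.nA + I.nB ≤ b := by omega
    have h3 : I.N * (I.nD + 1) ≤ b := by omega
    nlinarith [Nat.mul_le_mul h1 h2]
  · rw [inputRow, h.nA, h.nB, h.nD, h.N, extent]
    nlinarith
  · rw [h.nA, h.m, extent]
    nlinarith
  · exact ((h.inputScale_le hk).trans_lt hscale).trans_le (hpow (by omega))
  · rw [h.m] at he
    rw [inputValue, h.num ⟨e, he⟩]
    calc _ < 2 ^ b * 2 ^ (2 * b + 3) :=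
          Nat.mul_lt_mul'' (I.num_lt _) ((Nat.div_le_self _ _).trans_lt hscale)
      _ = 2 ^ (b + (2 * b + 3)) := (pow_add _ _ _).symm
      _ ≤ _ := hpow (by omega)
  · rw [h.m] at he
    have h1 : (0 : ℝ) < inputValue inp e := by
      have hs : 0 < inputScale inp (inp 4) := by
        rw [h.inputScale_eq]
        exact Nat.mul_pos (by omega) (prod_pos fun e _ => (I.value e).den_pos)
      rw [h.inputValue_eq ⟨e, he⟩]
      exact mul_pos (by exact_mod_cast hs) (I.value_pos_real _)
    exact_mod_cast h1

end SRAMF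

/-! ### Machine states that hold an instance -/

namespace SRAMF

open RAM Finset Covering

variable (I : SRAMF)

/-- Numbering of the variables of the covering LP. -/
def cellEquiv : ((Fin I.nA ⊕ Fin I.nB) ⊕ Fin I.nD) × Fin I.N ≃
    Fin (I.N * (I.nA + I.nB + I.nD)) :=
  (Equiv.prodComm _ _).trans (((Equiv.refl _).prodCongr
    ((finSumFinEquiv.sumCongr (Equiv.refl _)).trans finSumFinEquiv)).trans finProdFinEquiv)

/-- Blocks by scenario with vehicles before requests: the layout that `St.IsMem` decodes. -/
def cellIndex (k : ((Fin I.nA ⊕ Fin I.nB) ⊕ Fin I.nD) × Fin I.N) : ℕ := I.cellEquiv k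

theorem cellIndex_injective : Function.Injective I.cellIndex :=
  Fin.val_injective.comp I.cellEquiv.injective

theorem cellIndex_inl (i : Fin I.nA ⊕ Fin I.nB) (ξ : Fin I.N) :
    I.cellIndex (.inl i, ξ) = I.vehicleIndex i + (I.nA + I.nB + I.nD) * ξ := rfl

theorem cellIndex_inr (j : Fin I.nD) (ξ : Fin I.N) :
    I.cellIndex (.inr j, ξ) = I.nA + I.nB + j + (I.nA + I.nB + I.nD) * ξ := rfl

theorem vehicleIndex_lt (i : Fin I.nA ⊕ Fin I.nB) : I.vehicleIndex i < I.nA + I.nB :=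
  Fin.isLt _

theorem vehicleIndex_injective : Function.Injective I.vehicleIndex :=
  Fin.val_injective.comp finSumFinEquiv.injective

theorem map_cellIndex_univ : univ.map ⟨I.cellIndex, I.cellIndex_injective⟩ =
    range (I.N * (I.nA + I.nB + I.nD)) := by
  ext x
  simp only [mem_map, mem_univ, true_and, Function.Embedding.coeFn_mk, mem_range]
  refine ⟨?_, fun hx => ⟨I.cellEquiv.symm ⟨x, hx⟩, by simp [cellIndex]⟩⟩
  rintro ⟨k, rfl⟩
  exact Fin.isLt _

theorem mem_cells {e : Fin I.m} {g : (Fin I.nA ⊕ Fin I.nB) ⊕ Fin I.nD} {ξ : Fin I.N} :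
    (g, ξ) ∈ I.cells e ↔ g ∈ I.verts e ∧ I.scenario e = ξ := by
  rw [cells, mem_product, mem_singleton, eq_comm (a := ξ)]

theorem card_cells (e : Fin I.m) : #(I.cells e) = 1 + #(I.requests e) := by
  simp [cells, verts]

/-- The state of the machine holds the instance and its scaled values. -/
structure Loaded (τ : St) : Prop where
  enc : I.Encoded τ.inp
  header : Header τ
  value : ∀ e < τ.m, τ.V e = inputValue τ.inp e

/-- Common multiple of the denominators of the values. -/
def scale : ℝ := 8 * (I.nD + 1) * ∏ e, ((I.value e).den : ℝ)

theorem scale_pos : 0 < I.scale :=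
  mul_pos (by positivity) (prod_pos fun e _ => by exact_mod_cast (I.value e).den_pos)

namespace Loaded

variable {I} {τ : St}

theorem nA (h : I.Loaded τ) : τ.nA = I.nA := h.header.nA.trans h.enc.nA

theorem m (h : I.Loaded τ) : τ.m = I.m := h.header.m.trans h.enc.m

theorem K (h : I.Loaded τ) : τ.K = I.K := h.header.K.trans h.enc.K

theorem nV (h : I.Loaded τ) : τ.nV = I.nA + I.nB := by rw [h.header.nV, h.enc.nA, h.enc.nB]

theorem L (h : I.Loaded τ) : τ.L = I.nA + I.nB + I.nD := by
  rw [h.header.L, h.enc.nA, h.enc.nB, h.enc.nD]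

theorem Y (h : I.Loaded τ) : τ.Y = I.N * (I.nA + I.nB + I.nD) := by
  rw [h.header.Y, h.enc.nA, h.enc.nB, h.enc.nD, h.enc.N]

theorem value_eq (h : I.Loaded τ) (e : Fin I.m) : (τ.V e : ℝ) = I.scale * (I.value e : ℝ) := by
  rw [h.value e (e.isLt.trans_eq h.m.symm), h.enc.inputValue_eq, h.enc.inputScale_eq, scale]
  push_cast
  rfl

theorem isMem_cellIndex (h : I.Loaded τ) (e : Fin I.m)
    (k : ((Fin I.nA ⊕ Fin I.nB) ⊕ Fin I.nD) × Fin I.N) :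
    τ.IsMem e (I.cellIndex k) ↔ k ∈ I.cells e := by
  obtain ⟨g, ξ⟩ := k
  have key : ∀ i < I.nA + I.nB + I.nD, τ.IsMem e (i + (I.nA + I.nB + I.nD) * ξ) ↔
      ξ.val = I.scenario e ∧ (i = I.vehicleIndex (I.vehicle e) ∨
        I.nA + I.nB ≤ i ∧ τ.inp (inputRow τ.inp e + 4 + (i - (I.nA + I.nB))) ≠ 0) := by
    intro i hi
    have h1 : (i + (I.nA + I.nB + I.nD) * ξ) / (I.nA + I.nB + I.nD) = ξ := by
      rw [Nat.add_mul_div_left _ _ (by omega), Nat.div_eq_of_lt hi, Nat.zero_add]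
    rw [St.IsMem, h.L, h.nV, h.header.row, h1, Nat.add_sub_cancel, h.enc.scenario, h.enc.vehicle]
  rw [mem_cells, and_comm]
  rcases g with i | j
  · have hi := I.vehicleIndex_lt i
    rw [cellIndex_inl, key _ (by omega), verts, inl_mem_disjSum, mem_singleton,
      I.vehicleIndex_injective.eq_iff, Fin.val_inj, eq_comm (a := ξ)]
    exact and_congr_right' ⟨fun h' => h'.resolve_right fun h'' => by omega, .inl⟩
  · have hi := I.vehicleIndex_lt (I.vehicle e)
    rw [cellIndex_inr, key _ (by omega), verts, inr_mem_disjSum, Fin.val_inj, eq_comm (a := ξ),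
      Nat.add_sub_cancel_left, h.enc.request]
    exact and_congr_right' ⟨fun h' => (h'.resolve_left fun h'' => by omega).2, fun h' =>
      .inr ⟨by omega, h'⟩⟩

theorem edge_eq (h : I.Loaded τ) (e : Fin I.m) :
    τ.edge e = (I.cells e).map ⟨I.cellIndex, I.cellIndex_injective⟩ := by
  ext x
  rw [St.edge, mem_filter, h.Y, ← I.map_cellIndex_univ]
  simp only [mem_map, mem_univ, true_and, Function.Embedding.coeFn_mk]
  constructor
  · rintro ⟨⟨k, rfl⟩, hk⟩
    exact ⟨k, (h.isMem_cellIndex e k).1 hk, rfl⟩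
  · rintro ⟨k, hk, rfl⟩
    exact ⟨⟨k, rfl⟩, (h.isMem_cellIndex e k).2 hk⟩

theorem card_edge (h : I.Loaded τ) (e : Fin I.m) : #(τ.edge e) = #(I.cells e) := by
  rw [h.edge_eq, card_map]

theorem sum_edge (h : I.Loaded τ) (e : Fin I.m) (z : ℕ → ℝ) :
    ∑ x ∈ τ.edge e, z x = ∑ k ∈ I.cells e, z (I.cellIndex k) := by
  rw [h.edge_eq, sum_map]
  rfl

theorem sum_range (h : I.Loaded τ) (z : ℕ → ℝ) :
    ∑ x ∈ range τ.Y, z x = ∑ k, z (I.cellIndex k) := by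
  rw [h.Y, ← I.map_cellIndex_univ, sum_map]
  rfl

theorem edge_nonempty (h : I.Loaded τ) : ∀ e < τ.m, (τ.edge e).Nonempty := by
  intro e he
  rw [h.m] at he
  rw [h.edge_eq ⟨e, he⟩, map_nonempty]
  exact I.cells_nonempty _

/-- This is the purpose of the factor 8(nD + 1) in the scale. The product of the denominators alone
makes every value a positive integer, and a hyperedge has at most nD + 1 vertices. Hence the rounded
increments of the updates are never zero. -/
theorem eight_mul_card_le (h : I.Loaded τ) : ∀ e < τ.m, 8 * #(τ.edge e) ≤ τ.V e := by
  intro e he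
  rw [h.m] at he
  lift e to Fin I.m using he
  have hcard : #(τ.edge e) ≤ I.nD + 1 := by
    rw [h.card_edge, card_cells, add_comm]
    exact Nat.add_le_add_right (card_finset_fin_le _) 1
  have hprod : 1 ≤ (∏ f, ((I.value f).den : ℝ)) * (I.value e : ℝ) := by
    have h1 : ((I.value e).den : ℝ) ≤ ∏ f, ((I.value f).den : ℝ) := by
      exact_mod_cast Nat.le_of_dvd (prod_pos fun f _ => (I.value f).den_pos)
        (dvd_prod_of_mem (fun f => (I.value f).den) (mem_univ e))
    refine le_trans ?_ (mul_le_mul_of_nonneg_right h1 (I.value_pos_real e).le)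
    rw [← Rat.cast_natCast, ← Rat.cast_mul, Rat.den_mul_eq_num]
    exact_mod_cast Rat.num_pos.2 (I.value_pos e)
  have hV : (8 * (I.nD + 1) : ℝ) ≤ τ.V e := by
    rw [h.value_eq, scale, mul_assoc (8 * ((I.nD : ℝ) + 1))]
    exact le_mul_of_one_le_right (by positivity) hprod
  have : 8 * (I.nD + 1) ≤ τ.V e := by exact_mod_cast hV
  omega

theorem value_pos (h : I.Loaded τ) : ∀ e < τ.m, 0 < τ.V e := fun e he =>
  (Nat.mul_pos (by norm_num) (card_pos.2 (h.edge_nonempty e he))).trans_le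
    (h.eight_mul_card_le e he)

/-- Basis vehicles are numbered from `nA` on and collapse to the class `nA`, which no augmented
vehicle has. -/
theorem mem_fleet_iff (h : I.Loaded τ) (S : Finset (Fin I.nA)) (e : Fin I.m) :
    (τ.cls e = τ.nA ∨ τ.cls e ∈ S.image Fin.val) ↔ I.vehicle e ∈ I.fleet S := by
  rw [St.cls, h.header.row, h.enc.vehicle, h.nA, fleet]
  rcases I.vehicle e with i | i
  · have hi : min (I.vehicleIndex (.inl i)) I.nA = i := min_eq_left i.isLt.le
    rw [hi, inl_mem_disjSum, mem_image]
    constructor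
    · rintro (h' | ⟨j, hj, hji⟩)
      · exact absurd h' i.isLt.ne
      · rwa [← Fin.ext hji]
    · exact fun h' => .inr ⟨i, h', rfl⟩
  · have hi : min (I.vehicleIndex (.inr i)) I.nA = I.nA := min_eq_right (Nat.le_add_right _ _)
    simp [hi]

/-- Dividing by the scale turns machine covers into covers of the instance, whence lower bounds for
their cost. The converse `exists_covers` supplies the reference cover for competitiveness. -/
theorem isCover_of_covers (h : I.Loaded τ) {S : Finset (Fin I.nA)} {z : ℕ → ℝ}
    (hz : Covers τ.edge τ.V τ.cls τ.m τ.nA (S.image Fin.val) z) :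
    I.IsCover S fun k => z (I.cellIndex k) / I.scale := by
  refine ⟨fun k => div_nonneg (hz.1 _) I.scale_pos.le, fun e he => ?_⟩
  have h1 := hz.2 e (e.isLt.trans_eq h.m.symm) ((h.mem_fleet_iff S e).2 he)
  rw [h.value_eq, h.sum_edge] at h1
  rw [← sum_div, le_div_iff₀ I.scale_pos, mul_comm]
  exact h1

theorem exists_covers (h : I.Loaded τ) {S : Finset (Fin I.nA)}
    {u : ((Fin I.nA ⊕ Fin I.nB) ⊕ Fin I.nD) × Fin I.N → ℝ} (hu : I.IsCover S u) :
    ∃ z, Covers τ.edge τ.V τ.cls τ.m τ.nA (S.image Fin.val) z ∧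
      ∀ k, z (I.cellIndex k) = I.scale * u k := by
  refine ⟨Function.extend I.cellIndex (fun k => I.scale * u k) 0, ⟨fun x => ?_, fun e he hS => ?_⟩,
    fun k => I.cellIndex_injective.extend_apply _ _ k⟩
  · rw [Function.extend_def]
    split_ifs
    · exact mul_nonneg I.scale_pos.le (hu.1 _)
    · exact le_rfl
  · rw [h.m] at he
    lift e to Fin I.m using he
    rw [h.sum_edge, h.value_eq]
    simp only [I.cellIndex_injective.extend_apply]
    rw [← mul_sum]
    exact mul_le_mul_of_nonneg_left (hu.2 e ((h.mem_fleet_iff S e).1 hS)) I.scale_pos.le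

end Loaded

end SRAMF

/-! ### Guarantees for the decoded output -/

namespace SRAMF

open RAM Finset Covering

variable {I : SRAMF}

theorem assignmentValue_eq (M : Finset (Fin I.m)) :
    I.assignmentValue M = (1 / (I.N : ℝ)) * ∑ e ∈ M, (I.value e : ℝ) := by
  simp only [assignmentValue, scenarioValue, edges, indicator]
  rw [sum_fiberwise]
  simp

/-- Pairwise disjoint hyperedges of available vehicles form an integral assignment. -/
theorem intAssignment_indicator {S : Finset (Fin I.nA)} {M : Finset (Fin I.m)}
    (hS : ∀ e ∈ M, I.vehicle e ∈ I.fleet S)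
    (hM : ∀ e ∈ M, ∀ f ∈ M, e ≠ f → Disjoint (I.cells e) (I.cells f)) (ξ : Fin I.N) :
    I.IntAssignment S ξ (I.indicator M) := by
  have hle : ∀ (g : (Fin I.nA ⊕ Fin I.nB) ⊕ Fin I.nD) (q : Fin I.m → Prop) [DecidablePred q],
      (∀ e, q e → g ∈ I.verts e) → ∑ e ∈ (I.edges ξ).filter q, I.indicator M e ≤ 1 := by
    intro g q _ hq
    simp only [indicator]
    rw [sum_ite_mem, sum_const, nsmul_eq_mul, mul_one]
    norm_cast
    rw [card_le_one]
    intro e he f hf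
    simp only [mem_inter, mem_filter, I.mem_edges] at he hf
    by_contra hef
    exact disjoint_left.1 (hM e he.2 f hf.2 hef) (I.mem_cells.2 ⟨hq e he.1.2, he.1.1⟩)
      (I.mem_cells.2 ⟨hq f hf.1.2, hf.1.1⟩)
  refine ⟨⟨fun j _ => hle (.inr j) _ fun e he => ?_, fun i => hle (.inl i) _ fun e he => ?_,
    fun e _ he => ?_, fun e _ => ?_⟩, fun e _ => ?_⟩
  · simpa [verts] using he
  · simp [verts, he]
  · exact if_neg fun h => he (hS e h)
  · rw [indicator]
    split_ifs <;> norm_num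
  · rw [indicator]
    split_ifs <;> simp

namespace Loaded

variable {τ : St} {ν : ℕ → ℕ}

/-- Decoding looks only at cells in range, and runs select only classes below `nA` and hyperedges
below `m`, so the decoded sets are exactly those of the runs. -/
theorem exists_runs (h : I.Loaded τ) (hν : τ.Marks ν) : ∃ u w,
    GreedyRun τ.edge τ.V τ.cls τ.m τ.Y τ.nA (min τ.K τ.nA) u ((I.decode ν).1.image Fin.val) ∧
    MatchRun τ.edge τ.V (fun e => τ.cls e = τ.nA ∨ τ.cls e ∈ (I.decode ν).1.image Fin.val)
      τ.m τ.Y τ.m w ((I.decode ν).2.image Fin.val) := by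
  obtain ⟨u, S, w, M, hrun, hmatch, hS, hM⟩ := hν
  have h1 : (I.decode ν).1.image Fin.val = S := by
    ext j
    simp only [decode, mem_image, mem_filter, mem_univ, true_and]
    constructor
    · rintro ⟨i, hi, rfl⟩
      exact (hS i (i.isLt.trans_eq h.nA.symm)).1 hi
    · intro hj
      have hlt := hrun.lt j hj
      exact ⟨⟨j, hlt.trans_eq h.nA⟩, (hS j hlt).2 hj, rfl⟩
  have h2 : (I.decode ν).2.image Fin.val = M := by
    ext e
    simp only [decode, mem_image, mem_filter, mem_univ, true_and]
    rw [← h.nA]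
    constructor
    · rintro ⟨i, hi, rfl⟩
      exact (hM i (i.isLt.trans_eq h.m.symm)).1 hi
    · intro he
      have hlt := (hmatch.mem h.value_pos e he).1
      exact ⟨⟨e, hlt.trans_eq h.m⟩, (hM e hlt).2 he, rfl⟩
  rw [h1, h2]
  exact ⟨u, w, hrun, hmatch⟩

theorem card_decode_le (h : I.Loaded τ) (hν : τ.Marks ν) : #(I.decode ν).1 ≤ I.K := by
  obtain ⟨u, w, hrun, -⟩ := h.exists_runs hν
  have h1 := hrun.card_le
  rw [card_image_of_injective _ Fin.val_injective, h.K] at h1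
  exact h1.trans (min_le_left _ _)

theorem intAssignment_decode (h : I.Loaded τ) (hν : τ.Marks ν) (ξ : Fin I.N) :
    I.IntAssignment (I.decode ν).1 ξ (I.indicator (I.decode ν).2) := by
  obtain ⟨u, w, -, hmatch⟩ := h.exists_runs hν
  refine intAssignment_indicator (fun e he => ?_) (fun e he f hf hef => ?_) ξ
  · exact (h.mem_fleet_iff _ e).1 (hmatch.mem h.value_pos e (mem_image_of_mem _ he)).2.1
  · have h1 := hmatch.disjoint h.value_pos e (mem_image_of_mem _ he) f (mem_image_of_mem _ hf)
      (Fin.val_injective.ne hef)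
    rwa [h.edge_eq, h.edge_eq, disjoint_map] at h1

theorem card_edge_le (h : I.Loaded τ) {p : ℕ} (hp : I.rowSparsity ≤ p) :
    ∀ e < τ.m, #(τ.edge e) ≤ p := by
  intro e he
  rw [h.m] at he
  lift e to Fin I.m using he
  rw [h.card_edge]
  exact (I.card_cells_le_rowSparsity e).trans hp

/-- The cost of the computed cover lies between the two sides: greedy growth bounds it from below by
means of `S`, competitiveness from above against an optimal cover for the decoded selection. -/
theorem mul_vHat_le (h : I.Loaded τ) (hν : τ.Marks ν) {p : ℕ} (hp : I.rowSparsity ≤ p)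
    {S : Finset (Fin I.nA)} (hS : #S ≤ I.K) :
    (1 - Real.exp (-1)) * I.vHat S ≤ ratio p * I.vHat (I.decode ν).1 := by
  obtain ⟨u, w, hrun, -⟩ := h.exists_runs hν
  have hsN : 0 < I.scale * I.N := mul_pos I.scale_pos I.N_pos_real
  have h1 : (1 - Real.exp (-1)) * (I.scale * (I.N * I.vHat S)) ≤ ∑ x ∈ range τ.Y, (u x : ℝ) := by
    refine hrun.mul_le_sum (T := S.image Fin.val) h.edge_nonempty τ.edge_subset
      h.eight_mul_card_le ?_ ?_ ?_ fun z hz => ?_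
    · intro i hi
      obtain ⟨j, -, rfl⟩ := mem_image.1 hi
      exact j.isLt.trans_eq h.nA.symm
    · rw [card_image_of_injective _ Fin.val_injective, h.K, h.nA]
      exact le_min hS (card_finset_fin_le S)
    · exact mul_nonneg I.scale_pos.le (mul_nonneg I.N_pos_real.le (I.vHat_nonneg S))
    · have h2 := (I.exists_isCover_sum_eq S).2 _ (h.isCover_of_covers hz)
      rwa [← sum_div, le_div_iff₀ I.scale_pos, ← h.sum_range, mul_comm] at h2
  obtain ⟨c, hc, hsum⟩ := (I.exists_isCover_sum_eq (I.decode ν).1).1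
  obtain ⟨z, hz, hzc⟩ := h.exists_covers hc
  have h3 := hrun.sum_le h.edge_nonempty τ.edge_subset h.eight_mul_card_le (h.card_edge_le hp) hz
  rw [h.sum_range z] at h3
  simp only [hzc] at h3
  rw [← mul_sum, hsum] at h3
  refine le_of_mul_le_mul_left ?_ hsN
  calc _ = (1 - Real.exp (-1)) * (I.scale * (I.N * I.vHat S)) := by ring
    _ ≤ ratio p * (I.scale * (I.N * I.vHat (I.decode ν).1)) := h1.trans h3
    _ = _ := by ring

/-- The vertex weights of the matching cover all hyperedges of the selected fleet, so by duality
their total bounds `vHat`. This total counts each chosen value at most `p` times. -/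
theorem vHat_le (h : I.Loaded τ) (hν : τ.Marks ν) {p : ℕ} (hp : I.rowSparsity ≤ p) :
    I.vHat (I.decode ν).1 ≤ p * I.assignmentValue (I.decode ν).2 := by
  obtain ⟨u, w, -, hmatch⟩ := h.exists_runs hν
  have hcov : Covers τ.edge τ.V τ.cls τ.m τ.nA ((I.decode ν).1.image Fin.val)
      fun x => (w x : ℝ) := by
    refine ⟨fun x => Nat.cast_nonneg _, fun e he hav => ?_⟩
    obtain ⟨x, hx, hle⟩ := hmatch.exists_le h.edge_nonempty τ.edge_subset h.value_pos he hav
    exact le_trans (by exact_mod_cast hle)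
      (single_le_sum (f := fun x => (w x : ℝ)) (fun _ _ => Nat.cast_nonneg _) hx)
  have h1 := (I.exists_isCover_sum_eq _).2 _ (h.isCover_of_covers hcov)
  rw [← sum_div, le_div_iff₀ I.scale_pos, ← h.sum_range fun x => (w x : ℝ)] at h1
  have h2 : ∑ x ∈ range τ.Y, (w x : ℝ) ≤
      I.scale * (p * ∑ e ∈ (I.decode ν).2, (I.value e : ℝ)) := by
    have h3 := hmatch.sum_eq h.edge_nonempty τ.edge_subset h.value_pos
    rw [sum_image Fin.val_injective.injOn] at h3
    rw [← Nat.cast_sum, h3, Nat.cast_sum, mul_sum, mul_sum]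
    refine sum_le_sum fun e _ => ?_
    rw [Nat.cast_mul, h.value_eq]
    have h4 : (#(τ.edge e) : ℝ) ≤ p := by
      exact_mod_cast h.card_edge_le hp e (e.isLt.trans_eq h.m.symm)
    have h5 := mul_le_mul_of_nonneg_right h4
      (mul_nonneg I.scale_pos.le (I.value_pos_real e).le)
    linarith
  rw [assignmentValue_eq, mul_left_comm, one_div, ← div_eq_inv_mul, le_div_iff₀ I.N_pos_real]
  have h6 := I.scale_pos
  nlinarith

end Loaded

end SRAMF

/-! ### Asymptotics of the ratio and conclusion -/

/-- The error term of the approximation factor. -/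
noncomputable def ratioError (p : ℕ) : ℝ :=
  max 0 (Real.exp 1 * Covering.ratio p / Real.log p - 2 * Real.exp 1)

/-- From 1 + 128p ≤ 2^8 p and ln 2 > 0.69 the ratio is at most 9/7 · (9 + ln p / 0.69). The
coefficient 9/(7 · 0.69) is below 1.87, and the rest of 2 ln p pays for the constant once ln p ≥
100. -/
theorem ratio_le_of_log_le {p : ℕ} (hp : 100 ≤ Real.log p) :
    Covering.ratio p ≤ 2 * Real.log p := by
  have hp0 : p ≠ 0 := by
    rintro rfl
    norm_num at hp
  have hp1 : (1 : ℝ) ≤ p := by exact_mod_cast Nat.one_le_iff_ne_zero.2 hp0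
  have h2 := Real.log_two_gt_d9
  have hlog : Real.log (1 + 128 * p) ≤ 8 * Real.log 2 + Real.log p := by
    rw [← Real.log_rpow two_pos, ← Real.log_mul (by positivity) (by positivity)]
    refine Real.log_le_log (by positivity) ?_
    norm_num
    linarith
  have hdiv : Real.logb 2 (1 + 128 * p) ≤ 8 + Real.log p / (0.69 : ℝ) := by
    rw [Real.logb, div_le_iff₀ (by linarith)]
    have h3 : Real.log p ≤ Real.log p / 0.69 * Real.log 2 := by
      rw [div_mul_eq_mul_div, le_div_iff₀ (by norm_num)]
      exact mul_le_mul_of_nonneg_left (by linarith) (by linarith)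
    linarith
  rw [Covering.ratio]
  have h4 : Real.log p / (0.69 : ℝ) = Real.log p * (100 / 69) := by ring
  linarith

/-- The error is in fact zero for all large `p`. -/
theorem tendsto_ratioError : Filter.Tendsto ratioError Filter.atTop (nhds 0) := by
  refine tendsto_const_nhds.congr' ?_
  filter_upwards [(Real.tendsto_log_atTop.comp tendsto_natCast_atTop_atTop).eventually_ge_atTop 100]
    with p hp
  have hp' : 100 ≤ Real.log p := hp
  refine (max_eq_left ?_).symm
  rw [sub_nonpos, div_le_iff₀ (by linarith)]
  nlinarith [ratio_le_of_log_le hp', Real.exp_pos 1]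

theorem exp_mul_ratio_le {p : ℕ} (hp : 2 ≤ p) :
    Real.exp 1 * Covering.ratio p ≤ (2 * Real.exp 1 + ratioError p) * Real.log p := by
  have hlog : 0 < Real.log p := Real.log_pos (by exact_mod_cast hp)
  rw [← div_le_iff₀ hlog, ← sub_le_iff_le_add']
  exact le_max_right _ _

theorem SRAMF.exists_select : ∃ (P : RAM.Prog) (q : Polynomial ℕ), ∀ I : SRAMF,
    ∃ (c : ℕ) (ν : RAM.Mem) (τ : RAM.St), RAM.Exec P (RAM.load 18 I.encode) c ν ∧
      c ≤ q.eval (RAM.bitSize I.encode) ∧ I.Loaded τ ∧ τ.Marks fun i => ν (18 + i) := by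
  obtain ⟨P, q, h⟩ := RAM.exists_prog
  refine ⟨P, q, fun I => ?_⟩
  have henc : I.Encoded fun j => I.encode.getD j 0 := fun _ _ => rfl
  obtain ⟨c, ν, τ, hexec, hc, hτ, hinp, hV, hmarks⟩ := h I.encode (by
    have hm := henc.m
    rw [RAM.inputRow, henc.nA, henc.nB, henc.nD, henc.N, hm, I.length_encode]) fun inp hinp =>
      SRAMF.Encoded.inputBnd hinp
  exact ⟨c, ν, τ, hexec, hc, ⟨hinp, hτ, hV⟩, hmarks⟩

theorem mainTheorem2 :
    (∀ (I : SRAMF) (S : Finset (Fin I.nA)), IsLeast (I.coverValues S) (I.vHat S)) ∧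
    ∃ (ε : ℕ → ℝ) (alg : (I : SRAMF) → I.Solution),
      Filter.Tendsto ε Filter.atTop (nhds 0) ∧
      (∀ p, 2 ≤ p → 0 < 2 * Real.exp 1 + ε p) ∧
      RAM.PolyTimeComputable SRAMF.encode SRAMF.decode alg ∧
      ∀ I : SRAMF,
        (alg I).1.card ≤ I.K ∧
        (∀ ξ, I.IntAssignment (alg I).1 ξ (I.indicator (alg I).2)) ∧
        ∀ p : ℕ, 2 ≤ p → I.rowSparsity ≤ p → ∀ S : Finset (Fin I.nA), S.card ≤ I.K →
          (Real.exp 1 - 1) / ((2 * Real.exp 1 + ε p) * Real.log p) * I.vHat S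
            ≤ I.vHat (alg I).1 ∧
          (Real.exp 1 - 1) / ((2 * Real.exp 1 + ε p) * (p * Real.log p)) * I.vStar S
            ≤ I.assignmentValue (alg I).2 := by
  refine ⟨fun I S => I.isLeast_coverValues S, ?_⟩
  obtain ⟨P, q, h⟩ := SRAMF.exists_select
  -- The program and the polynomial are fixed beforehand; only the halting run is chosen for each
  -- instance, and the algorithm is the decoding of its final memory.
  choose c ν τ hexec hc hload hmarks using h
  have hpos : ∀ p, 0 < 2 * Real.exp 1 + ratioError p := fun p =>
    add_pos_of_pos_of_nonneg (by positivity) (le_max_left _ _)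
  refine ⟨ratioError, fun I => I.decode fun i => ν I (18 + i), tendsto_ratioError,
    fun p _ => hpos p, ⟨18, P, q, fun I => ⟨c I, ν I, hexec I, hc I, rfl⟩⟩, fun I =>
    ⟨(hload I).card_decode_le (hmarks I), (hload I).intAssignment_decode (hmarks I),
      fun p hp hsparse S hS => ?_⟩⟩
  have hlog : 0 < Real.log p := Real.log_pos (by exact_mod_cast hp)
  have hp0 : (0 : ℝ) < p := by positivity
  have h1 := (hload I).mul_vHat_le (hmarks I) hsparse hS
  have h2 := (hload I).vHat_le (hmarks I) hsparse
  set R := I.decode fun i => ν I (18 + i)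
  have hD := mul_pos (hpos p) hlog
  set D := (2 * Real.exp 1 + ratioError p) * Real.log p with hDdef
  have he : Real.exp 1 * (1 - Real.exp (-1)) = Real.exp 1 - 1 := by
    rw [mul_sub, ← Real.exp_add]
    simp
  have h3 : (Real.exp 1 - 1) * I.vHat S ≤ D * I.vHat R.1 := by
    calc (Real.exp 1 - 1) * I.vHat S = Real.exp 1 * ((1 - Real.exp (-1)) * I.vHat S) := by
          rw [← he, mul_assoc]
      _ ≤ Real.exp 1 * (Covering.ratio p * I.vHat R.1) :=
          mul_le_mul_of_nonneg_left h1 (Real.exp_pos 1).le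
      _ = Real.exp 1 * Covering.ratio p * I.vHat R.1 := (mul_assoc _ _ _).symm
      _ ≤ D * I.vHat R.1 := mul_le_mul_of_nonneg_right (exp_mul_ratio_le hp) (I.vHat_nonneg _)
  constructor
  · rw [div_mul_eq_mul_div, div_le_iff₀ hD, mul_comm (I.vHat R.1)]
    exact h3
  · rw [show (2 * Real.exp 1 + ratioError p) * (p * Real.log p) = D * p by rw [hDdef]; ring,
      div_mul_eq_mul_div, div_le_iff₀ (mul_pos hD hp0)]
    calc (Real.exp 1 - 1) * I.vStar S ≤ (Real.exp 1 - 1) * I.vHat S :=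
          mul_le_mul_of_nonneg_left (I.vStar_le_vHat S)
            (sub_nonneg.2 (Real.one_le_exp zero_le_one))
      _ ≤ D * I.vHat R.1 := h3
      _ ≤ D * (p * I.assignmentValue R.2) := mul_le_mul_of_nonneg_left h2 hD.le
      _ = I.assignmentValue R.2 * (D * p) := by ring
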